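/- Let $\mathcal G$ be a locally finite connected planar graph drawn in $\mathbb R^2$ with straight edges that meet only at common end-points, with finitely many vertices in every bounded set, and invariant under the translations by $(1,0)$ and $(0,1)$, the rotation by $\pi/2$ around the origin, and the reflection in the line $\{0\}\times\mathbb R$. Let $E$ be its edge set, $q\ge 1$ and $p\in(0,1)$. For a finite set $F\subset E$, let $V_F$ be the set of end-points of edges of $F$ and $\partial F$ the set of vertices of $V_F$ incident to an edge of $E\setminus F$. For a partition $\xi$ of $\partial F$, the random-cluster measure $\phi^{\xi}_{F}$ on $\{0,1\}^{F}$ gives $\eta$ a probability proportional to $p^{o(\eta)}(1-p)^{c(\eta)}q^{k(\eta^\xi)}$, where $o(\eta)$ and $c(\eta)$ are the numbers of open and closed edges and $k(\eta^\xi)$ is the number of connected components of the graph with vertex set $V_F$ and the open edges of $\eta$ after the vertices in each class of $\xi$ have been identified. An infinite-volume measure is a probability measure on $\{0,1\}^{E}$ such that for every finite $F\subset E$, conditionally on the event (whenever it has positive probability) that the partition of $\partial F$ induced by open paths in $E\setminus F$ is $\xi$, the configuration in $F$ has law $\phi^{\xi}_{F}$. Assume that there is exactly one infinite-volume measure with parameters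 $p,q$, and call it $\phi_p$. Open paths are regarded as curves in the plane, contained in the union of the open edges (as closed segments). For $b,d>0$, a horizontal (vertical) crossing of $[0,b]\times[0,d]$ is an open path contained in this rectangle from its left to its right side (from its bottom to its top side); $\mathcal C_h(b,d)$ and $\mathcal C_v(b,d)$ are the events that such crossings exist. Crossings of a rectangle are separated if no two of them are connected by an open path contained in the rectangle. There exist universal constants $c_0,c_1>0$ (independent of $\mathcal G,q,p,n,I$) such that for all $n\in\mathbb N$ and every integer $1\le I\le n/400$ with $$I^2\le c_0\,\frac{\phi_p(\mathcal C_v(2n,n))}{\phi_p(\mathcal C_h(2n,n))^{c_1/I}},$$ we have $$\phi_p\big([0,2n]\times[0,n/2]\text{ has }2^I\text{ separated vertical crossings}\big)\ \ge\ \tfrac12\,\phi_p(\mathcal C_v(2n,n)).$$ -/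

import Mathlib

/-- The Euclidean plane in coordinates (only its topology and affine structure are used). -/
abbrev Plane : Type := ℝ × ℝ

/-- `τ` maps the graph `(V, G)` drawn in the plane to itself (it is used for bijections `τ`). -/
def IsGraphSymmetry (V : Set Plane) (G : SimpleGraph Plane) (τ : Plane → Plane) : Prop :=
  (∀ x, τ x ∈ V ↔ x ∈ V) ∧ ∀ x y, G.Adj (τ x) (τ y) ↔ G.Adj x y

/-- A connected locally finite planar graph, drawn in the plane with straight edges that meet only
at common end-points, and invariant under the translations by `(1,0)` and `(0,1)`, the rotation by
`π/2` around the origin and the reflection in the vertical axis.  The vertex set is `V`; points of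
the plane outside `V` are not vertices and have no neighbours. -/
structure PlanarLattice where
  V : Set Plane
  graph : SimpleGraph Plane
  mem_of_adj : ∀ x y, graph.Adj x y → x ∈ V
  connected : (graph.induce V).Connected
  finite_neighbors : ∀ x, (graph.neighborSet x).Finite
  finite_of_bounded : ∀ B : Set Plane, Bornology.IsBounded B → (V ∩ B).Finite
  planar : ∀ a b c d, graph.Adj a b → graph.Adj c d → s(a, b) ≠ s(c, d) →
    segment ℝ a b ∩ segment ℝ c d ⊆ ({a, b} ∩ {c, d} : Set Plane)
  translation_right : IsGraphSymmetry V graph (fun z => (z.1 + 1, z.2))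
  translation_up : IsGraphSymmetry V graph (fun z => (z.1, z.2 + 1))
  rotation : IsGraphSymmetry V graph (fun z => (-z.2, z.1))
  reflection : IsGraphSymmetry V graph (fun z => (-z.1, z.2))

namespace PlanarLattice

variable (L : PlanarLattice)

/-- The edges of the lattice. -/
abbrev Edge : Type := L.graph.edgeSet

/-- Configurations: `ω e = true` means that `e` is open. -/
abbrev Config : Type := L.Edge → Bool

/-! ### Random-cluster measures on finite subgraphs

A finite subgraph is given by its finite set `F` of edges; its vertices are the end-points. -/

/-- The vertices of the finite subgraph with edge set `F`. -/
def verts (F : Finset L.Edge) : Set Plane := {x | ∃ e ∈ F, x ∈ (e : Sym2 Plane)}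

/-- The boundary: the vertices of the subgraph incident to an edge of the lattice outside `F`. -/
def boundary (F : Finset L.Edge) : Set Plane :=
  {x | x ∈ L.verts F ∧ ∃ e : L.Edge, e ∉ F ∧ x ∈ (e : Sym2 Plane)}

/-- Boundary conditions: partitions of the boundary, as equivalence relations. -/
abbrev BoundaryCondition (F : Finset L.Edge) : Type := Setoid (L.boundary F)

/-- The graph on the vertices of `F` whose edges are the open edges of `η` together with an edge
between any two distinct boundary vertices in the same class of `ξ`.  Its connected components
correspond to those of the graph obtained from `η` by identifying the vertices of each class. -/
def wiredGraph (F : Finset L.Edge) (ξ : L.BoundaryCondition F) (η : F → Bool) :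
    SimpleGraph (L.verts F) :=
  SimpleGraph.fromRel fun x y =>
    (∃ e : F, η e = true ∧ ((e : L.Edge) : Sym2 Plane) = s((x : Plane), (y : Plane))) ∨
    ∃ (hx : (x : Plane) ∈ L.boundary F) (hy : (y : Plane) ∈ L.boundary F), ξ.r ⟨x, hx⟩ ⟨y, hy⟩

/-- The number of clusters of the wired configuration. -/
noncomputable def numClusters (F : Finset L.Edge) (ξ : L.BoundaryCondition F) (η : F → Bool) : ℕ :=
  Nat.card (L.wiredGraph F ξ η).ConnectedComponent

/-- The weight `p ^ (number of open edges) (1 - p) ^ (number of closed edges) q ^ (clusters)`. -/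
noncomputable def weight (p q : ℝ) (F : Finset L.Edge) (ξ : L.BoundaryCondition F)
    (η : F → Bool) : ℝ :=
  p ^ Nat.card {e : F // η e = true} * (1 - p) ^ Nat.card {e : F // η e = false} *
    q ^ L.numClusters F ξ η

open Classical in
/-- The partition function. -/
noncomputable def partitionFunction (p q : ℝ) (F : Finset L.Edge) (ξ : L.BoundaryCondition F) : ℝ :=
  ∑ η : F → Bool, L.weight p q F ξ η

/-- The probability of `η` under the random-cluster measure on `F` with boundary condition `ξ`. -/
noncomputable def finiteVolumeProb (p q : ℝ) (F : Finset L.Edge) (ξ : L.BoundaryCondition F)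
    (η : F → Bool) : ℝ :=
  L.weight p q F ξ η / L.partitionFunction p q F ξ

/-! ### Infinite-volume measures -/

/-- The boundary condition on `F` induced by `ω`: two boundary vertices are wired when they are
connected by a path of open edges outside `F`. -/
def inducedBC (F : Finset L.Edge) (ω : L.Config) : L.BoundaryCondition F :=
  (SimpleGraph.fromEdgeSet
    {e : Sym2 Plane | ∃ h : e ∈ L.graph.edgeSet, (⟨e, h⟩ : L.Edge) ∉ F ∧ ω ⟨e, h⟩ = true}
    ).reachableSetoid.comap Subtype.val

/-- Infinite-volume random-cluster measures: probability measures on configurations such that, for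
every finite subgraph `F`, conditionally on the induced boundary condition being `ξ`, the
configuration in `F` follows the random-cluster measure on `F` with boundary condition `ξ`. -/
def IsInfiniteVolume (p q : ℝ) (φ : MeasureTheory.Measure L.Config) : Prop :=
  MeasureTheory.IsProbabilityMeasure φ ∧
    ∀ (F : Finset L.Edge) (ξ : L.BoundaryCondition F), φ {ω | L.inducedBC F ω = ξ} ≠ 0 →
      ∀ η : F → Bool,
        ProbabilityTheory.cond φ {ω | L.inducedBC F ω = ξ} {ω | ∀ e : F, ω e = η e} =
          ENNReal.ofReal (L.finiteVolumeProb p q F ξ η)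

/-! ### Crossings of rectangles

Open paths are regarded as curves in the plane, so that crossings also make sense when no vertex
lies on a side of the rectangle; an edge that leaves the rectangle counts up to the side. -/

/-- The union of the open edges, as a subset of the plane. -/
def openSet (ω : L.Config) : Set Plane :=
  {z | ∃ (x y : Plane) (h : L.graph.Adj x y), ω ⟨s(x, y), h⟩ = true ∧ z ∈ segment ℝ x y}

/-- `x` and `y` are connected by an open path inside `[a,b] × [c,d]`. -/
def ConnectedInRect (ω : L.Config) (a b c d : ℝ) (x y : Plane) : Prop :=
  JoinedIn (L.openSet ω ∩ Set.Icc a b ×ˢ Set.Icc c d) x y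

/-- `[0,b] × [0,d]` contains an open path from its left side to its right side. -/
def horizontalCrossing (b d : ℝ) : Set L.Config :=
  {ω | ∃ x y : Plane, x.1 = 0 ∧ y.1 = b ∧ L.ConnectedInRect ω 0 b 0 d x y}

/-- `[0,b] × [0,d]` contains an open path from its bottom side to its top side. -/
def verticalCrossing (b d : ℝ) : Set L.Config :=
  {ω | ∃ x y : Plane, x.2 = 0 ∧ y.2 = d ∧ L.ConnectedInRect ω 0 b 0 d x y}

/-- `[0,b] × [0,d]` contains `K` vertical crossings (the `i`-th one from `x i` to `y i`), no two of
which are connected by an open path inside `[0,b] × [0,d]`. -/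
def separatedVerticalCrossings (b d : ℝ) (K : ℕ) : Set L.Config :=
  {ω | ∃ x y : Fin K → Plane,
    (∀ i, (x i).2 = 0 ∧ (y i).2 = d ∧ L.ConnectedInRect ω 0 b 0 d (x i) (y i)) ∧
    ∀ i j, i ≠ j → ¬ L.ConnectedInRect ω 0 b 0 d (x i) (x j)}

end PlanarLattice

/-! Divide lengths by a scale `u` of order `n / (400 I)`, so that the rectangle has height `N`
between `400 I` and `800 I`. Consider crossings of horizontal strips of height `h ≤ N` that start
from a unit interval. Such a crossing is exceptional if it drifts sideways, if it avoids the far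
left or the far right, or if it splits into a piece avoiding one far side followed by a piece
avoiding the other; crossings of a rectangle the long way are exceptional as well (`Exceptional`).

Geometry. If neither a set nor its transpose has exceptional crossings (`Regular`), every crossing
doubles. It must go far to the left and far to the right, hence contains a horizontal pass almost as
long as the strip is high. The transposed regularity makes this pass contain two vertical passes of
a slightly thinner strip that are not joined inside it. A connection between them through the
outside would create a long crossing. Thus each crossing of a strip of height `h + 36` yields two
separated crossings of the concentric strip of height `h` (`Regular.exists_two_crossings`), and `I`
iterations yield `2 ^ I` of them, still in a strip of more than half the height of the rectangle.

Probability. Drifting crossings and long crossings can be chained into a horizontal crossing of the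
`2n × n` rectangle. Positive association bounds the probability of each by `κ ^ 4`, where `κ ^ (4 *
(4 * N + 5))` is the probability of the horizontal crossing. Two crossings staying on opposite sides
force a drift or a long crossing, and two crossings turning in opposite orders force a drift or a
crossing that stays on one side. Positive association and symmetry then bound these probabilities by
multiples of `κ ^ 2` and of `κ` (`IsLatticeProb.exceptional_le`). A union bound over order `N ^ 3`
positions and heights finishes the proof.

Positive association and symmetry of the measure come from uniqueness. The definition of
infinite-volume measures, which conditions only on the induced partition, is shown equivalent to a
relation between the two states of one edge given all others (`SingleEdge`). This relation survives
lattice symmetries and reweighting by tail functions. If `Y` is the tail limit of the conditional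
probabilities of `B`, then reweighting by `Y` gives the same measure by uniqueness, and the
finite-volume FKG inequality passes to the limit (`SingleEdge.mul_le_measure_inter`). -/

/-! ### Crossing curves in the plane -/

section CrossingCurves

open Set unitInterval

/-- A continuous real function on `[0,1]` that starts in `[c, c + π]` and along which
`sin (θ - c)` stays nonnegative remains in `[c, c + π]`. -/
lemma mem_Icc_of_sin_nonneg {θ : I → ℝ} (hθ : Continuous θ) {c : ℝ}
    (h0 : θ 0 ∈ Icc c (c + Real.pi)) (hs : ∀ t, 0 ≤ Real.sin (θ t - c)) (t : I) :
    θ t ∈ Icc c (c + Real.pi) := by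
  have hpi := Real.pi_pos
  have hconn : IsPreconnected (range θ) := isPreconnected_range hθ
  have hord := hconn.ordConnected
  by_contra hcon
  rw [mem_Icc, not_and_or, not_le, not_le] at hcon
  rcases hcon with hlt | hgt
  · set v := max (θ t) (c - Real.pi / 2) with hv
    have hvmem : v ∈ range θ :=
      hord.out (mem_range_self t) (mem_range_self 0)
        ⟨le_max_left _ _, max_le (by linarith [h0.1]) (by linarith [h0.1])⟩
    obtain ⟨s, hs'⟩ := hvmem
    have h1 : v < c := max_lt hlt (by linarith)
    have h2 : c - Real.pi / 2 ≤ v := le_max_right _ _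
    have := hs s
    rw [hs'] at this
    have h3 : Real.sin (v - c) < 0 := Real.sin_neg_of_neg_of_neg_pi_lt (by linarith) (by linarith)
    linarith
  · set v := min (θ t) (c + Real.pi + Real.pi / 2) with hv
    have hvmem : v ∈ range θ :=
      hord.out (mem_range_self 0) (mem_range_self t)
        ⟨le_min (by linarith [h0.2]) (by linarith [h0.2]), min_le_left _ _⟩
    obtain ⟨s, hs'⟩ := hvmem
    have h1 : c + Real.pi < v := lt_min hgt (by linarith)
    have h2 : v ≤ c + Real.pi + Real.pi / 2 := min_le_right _ _
    have := hs s
    rw [hs'] at this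
    have h3 : Real.sin (v - c - 2 * Real.pi) < 0 :=
      Real.sin_neg_of_neg_of_neg_pi_lt (by linarith) (by linarith)
    rw [Real.sin_sub_two_pi] at h3
    linarith

/-- The planar Poincaré–Miranda theorem, for functions of a complex value. -/
lemma exists_zero_of_signs (F : C(I × I, ℂ)) (hl : ∀ t, (F (0, t)).re ≤ 0)
    (hr : ∀ t, 0 ≤ (F (1, t)).re) (hb : ∀ s, 0 ≤ (F (s, 0)).im) (ht : ∀ s, (F (s, 1)).im ≤ 0) :
    ∃ x, F x = 0 := by
  by_contra! hne
  have hpi := Real.pi_pos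
  let π : C(ℝ × ℝ, I × I) := ⟨fun x => (projIcc 0 1 zero_le_one x.1, projIcc 0 1 zero_le_one x.2),
    by fun_prop⟩
  have hπ : ∀ x : I × I, π ((x.1 : ℝ), (x.2 : ℝ)) = x := fun x => by
    simp [π]
  -- Without zeros, `F` has a continuous logarithm: it is extended to the simply connected plane by
  -- the projection onto the square and lifted through `exp`.
  have : SimplyConnectedSpace (ℝ × ℝ) := SimplyConnectedSpace.ofContractible _
  obtain ⟨G', ⟨hG0', hG'⟩, -⟩ :=
    Complex.isCoveringMapOn_exp.existsUnique_continuousMap_lifts (F.comp π)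
    (a₀ := (0, 0)) (e₀ := Complex.log (F (π (0, 0)))) (Complex.exp_log (hne _)) (fun a => hne _)
  let G : C(I × I, ℂ) := G'.comp ⟨fun x => ((x.1 : ℝ), (x.2 : ℝ)), by fun_prop⟩
  have hG0 : G (0, 0) = Complex.log (F (0, 0)) := by
    have := hπ (0, 0)
    simp only [Icc.coe_zero] at this
    simp [G, hG0', this]
  have hG : Complex.exp ∘ G = F := by
    funext x
    have := congrFun hG' ((x.1 : ℝ), (x.2 : ℝ))
    simp only [Function.comp_apply, ContinuousMap.comp_apply, hπ] at this
    simpa [G] using this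
  have hexp : ∀ x, F x = Complex.exp (G x) := fun x => (congrFun hG x).symm
  have hre : ∀ x, (F x).re = Real.exp (G x).re * Real.cos (G x).im := fun x => by
    rw [hexp, Complex.exp_re]
  have him : ∀ x, (F x).im = Real.exp (G x).re * Real.sin (G x).im := fun x => by
    rw [hexp, Complex.exp_im]
  have cos_nonneg : ∀ x, 0 ≤ (F x).re → 0 ≤ Real.cos (G x).im := fun x h => by
    rw [hre] at h; exact nonneg_of_mul_nonneg_right h (Real.exp_pos _)
  have cos_nonpos : ∀ x, (F x).re ≤ 0 → Real.cos (G x).im ≤ 0 := fun x h => by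
    rw [hre] at h; exact nonpos_of_mul_nonpos_right h (Real.exp_pos _)
  have sin_nonneg : ∀ x, 0 ≤ (F x).im → 0 ≤ Real.sin (G x).im := fun x h => by
    rw [him] at h; exact nonneg_of_mul_nonneg_right h (Real.exp_pos _)
  have sin_nonpos : ∀ x, (F x).im ≤ 0 → Real.sin (G x).im ≤ 0 := fun x h => by
    rw [him] at h; exact nonpos_of_mul_nonpos_right h (Real.exp_pos _)
  -- The argument is followed from `(0, 0)` to `(1, 1)` in both ways around the square: along bottom
  -- and right it ends at most at `π / 2`, along left and top at least at `π`.
  have h00 : (G (0, 0)).im ∈ Icc 0 Real.pi := by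
    rw [hG0, Complex.log_im]
    exact ⟨Complex.arg_nonneg_iff.2 (hb 0), Complex.arg_le_pi _⟩
  have h00' : Real.pi / 2 ≤ (G (0, 0)).im := by
    by_contra! hlt
    have := Real.cos_pos_of_mem_Ioo (x := (G (0, 0)).im) ⟨by linarith [h00.1], hlt⟩
    linarith [cos_nonpos _ (hl 0)]
  have bottom : (G (1, 0)).im ∈ Icc 0 (0 + Real.pi) :=
    mem_Icc_of_sin_nonneg (θ := fun s : I => (G (s, 0)).im) (by fun_prop)
      ⟨h00.1, by linarith [h00.2]⟩ (fun s => by simpa using sin_nonneg _ (hb s)) 1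
  have bottom' : (G (1, 0)).im ≤ Real.pi / 2 := by
    by_contra! hlt
    have := Real.cos_neg_of_pi_div_two_lt_of_lt (x := (G (1, 0)).im) hlt
      (by linarith [bottom.2])
    linarith [cos_nonneg _ (hr 0)]
  have right : (G (1, 1)).im ∈ Icc (-(Real.pi / 2)) (-(Real.pi / 2) + Real.pi) :=
    mem_Icc_of_sin_nonneg (θ := fun t : I => (G (1, t)).im) (by fun_prop)
      ⟨by linarith [bottom.1], by linarith⟩
      (fun t => by
        rw [sub_neg_eq_add, Real.sin_add_pi_div_two]; exact cos_nonneg _ (hr t)) 1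
  have left : (G (0, 1)).im ∈ Icc (Real.pi / 2) (Real.pi / 2 + Real.pi) :=
    mem_Icc_of_sin_nonneg (θ := fun t : I => (G (0, t)).im) (by fun_prop)
      ⟨h00', by linarith [h00.2]⟩
      (fun t => by
        rw [Real.sin_sub_pi_div_two]; linarith [cos_nonpos _ (hl t)]) 1
  have left' : Real.pi ≤ (G (0, 1)).im := by
    by_contra! hlt
    have := Real.sin_pos_of_pos_of_lt_pi (x := (G (0, 1)).im) (by linarith [left.1]) hlt
    linarith [sin_nonpos _ (ht 0)]
  have top : (G (1, 1)).im ∈ Icc Real.pi (Real.pi + Real.pi) :=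
    mem_Icc_of_sin_nonneg (θ := fun s : I => (G (s, 1)).im) (by fun_prop)
      ⟨left', by linarith [left.2]⟩
      (fun s => by rw [Real.sin_sub_pi]; linarith [sin_nonpos _ (ht s)]) 1
  linarith [right.2, top.1]

/-- A curve crossing a rectangle from left to right meets a curve crossing it from bottom to
top. -/
lemma inter_nonempty_of_crossing {A B : Set Plane} {x y z w : Plane} {a b c d : ℝ}
    (hA : JoinedIn A x y) (hB : JoinedIn B z w) (hAs : ∀ v ∈ A, c ≤ v.2 ∧ v.2 ≤ d)
    (hBs : ∀ v ∈ B, a ≤ v.1 ∧ v.1 ≤ b) (hx : x.1 ≤ a) (hy : b ≤ y.1) (hz : z.2 ≤ c)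
    (hw : d ≤ w.2) : (A ∩ B).Nonempty := by
  obtain ⟨f, hf⟩ := hA
  obtain ⟨g, hg⟩ := hB
  let F : C(I × I, ℂ) := ⟨fun st => Complex.ofReal ((f st.1).1 - (g st.2).1) +
      Complex.ofReal ((f st.1).2 - (g st.2).2) * Complex.I, by fun_prop⟩
  have hFre : ∀ s t, (F (s, t)).re = (f s).1 - (g t).1 := fun s t => by simp [F]
  have hFim : ∀ s t, (F (s, t)).im = (f s).2 - (g t).2 := fun s t => by simp [F]
  obtain ⟨⟨s, t⟩, hst⟩ := exists_zero_of_signs F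
    (fun t => by rw [hFre, f.source]; linarith [(hBs _ (hg t)).1])
    (fun t => by rw [hFre, f.target]; linarith [(hBs _ (hg t)).2])
    (fun s => by rw [hFim, g.source]; linarith [(hAs _ (hf s)).1])
    (fun s => by rw [hFim, g.target]; linarith [(hAs _ (hf s)).2])
  have h1 := hFre s t
  have h2 := hFim s t
  rw [hst] at h1 h2
  have : f s = g t := Prod.ext (by simpa [sub_eq_zero] using h1.symm)
    (by simpa [sub_eq_zero] using h2.symm)
  exact ⟨f s, hf s, this ▸ hg t⟩

lemma JoinedIn.trans' {X : Type*} [TopologicalSpace X] {A B C : Set X} {x y z : X}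
    (h₁ : JoinedIn A x y) (h₂ : JoinedIn B y z) (hA : A ⊆ C) (hB : B ⊆ C) : JoinedIn C x z :=
  (h₁.mono hA).trans (h₂.mono hB)

lemma joinedIn_vertical {x c d : ℝ} {v w : Plane} (hv : v.1 = x) (hw : w.1 = x)
    (hv2 : v.2 ∈ Icc c d) (hw2 : w.2 ∈ Icc c d) : JoinedIn ({x} ×ˢ Icc c d) v w :=
  (((convex_singleton x).prod (convex_Icc c d)).isPathConnected ⟨v, hv, hv2⟩).joinedIn
    _ ⟨hv, hv2⟩ _ ⟨hw, hw2⟩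

lemma joinedIn_horizontal {y c d : ℝ} {v w : Plane} (hv : v.2 = y) (hw : w.2 = y)
    (hv2 : v.1 ∈ Icc c d) (hw2 : w.1 ∈ Icc c d) : JoinedIn (Icc c d ×ˢ {y}) v w :=
  (((convex_Icc c d).prod (convex_singleton y)).isPathConnected ⟨v, hv2, hv⟩).joinedIn
    _ ⟨hv2, hv⟩ _ ⟨hw2, hw⟩

/-- To join two curves it suffices that their compact sub-curves with the same end-points meet. -/
lemma exists_joinedIn_of_forall_inter {A B : Set Plane} {x y z w : Plane} (hA : JoinedIn A x y)
    (hB : JoinedIn B z w)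
    (H : ∀ A' B', A' ⊆ A → B' ⊆ B → IsCompact A' → IsCompact B' → JoinedIn A' x y →
      JoinedIn B' z w → (A' ∩ B').Nonempty) : ∃ v, JoinedIn A x v ∧ JoinedIn B z v := by
  obtain ⟨f, hf⟩ := hA
  obtain ⟨g, hg⟩ := hB
  obtain ⟨v, ⟨s, hs⟩, ⟨t, ht⟩⟩ := H (range f) (range g) (range_subset_iff.2 hf)
    (range_subset_iff.2 hg) (isCompact_range f.continuous) (isCompact_range g.continuous)
    ⟨f, fun t => mem_range_self t⟩ ⟨g, fun t => mem_range_self t⟩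
  refine ⟨v, ?_, ?_⟩
  · have : JoinedIn A (f 0) (f s) := ⟨f.subpath 0 s, fun t => hf _⟩
    rwa [f.source, hs] at this
  · have : JoinedIn B (g 0) (g t) := ⟨g.subpath 0 t, fun t => hg _⟩
    rwa [g.source, ht] at this

lemma exists_abs_fst_le {A : Set Plane} (hA : IsCompact A) : ∃ M, ∀ v ∈ A, |v.1| ≤ M :=
  (hA.image continuous_fst).isBounded.exists_norm_le.imp fun _ hM _ hv =>
    hM _ (mem_image_of_mem _ hv)

/-- Tails below the strip reduce this to a rectangle: `A` is prolonged straight down from `p`, and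
`B` is prolonged down from `p'` and then far to the left. As `p'` is not to the right of `p`, the
tails create no intersection except possibly at `p' = p`. -/
lemma inter_nonempty_of_right {A B : Set Plane} {p q p' q' : Plane} {y₀ y₁ b : ℝ}
    (hAc : IsCompact A) (hA : JoinedIn A p q) (hB : JoinedIn B p' q')
    (hAs : ∀ v ∈ A, v.1 ≤ b ∧ y₀ ≤ v.2 ∧ v.2 ≤ y₁) (hBs : ∀ v ∈ B, y₀ ≤ v.2 ∧ v.2 ≤ y₁)
    (hp : p.2 = y₀) (hq : q.2 = y₁) (hp' : p'.2 = y₀) (hq' : b ≤ q'.1) (hpp : p'.1 ≤ p.1) :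
    (A ∩ B).Nonempty := by
  obtain ⟨M, hM⟩ := exists_abs_fst_le hAc
  set m := min (-M) p'.1 with hm
  have hpA := hA.source_mem
  have hp'B := hB.source_mem
  have hpb := (hAs p hpA).1
  have hmp : m ≤ p'.1 := min_le_right _ _
  have hyy : y₀ ≤ y₁ := hp ▸ (hAs p hpA).2.2
  have eqp : p'.1 = p.1 → (A ∩ B).Nonempty := fun h => by
    have : p' = p := Prod.ext h (by rw [hp, hp'])
    exact ⟨p, hpA, this ▸ hp'B⟩
  obtain ⟨v, hvB, hvA⟩ := inter_nonempty_of_crossing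
    (A := (Icc m p'.1 ×ˢ {y₀ - 1} ∪ {p'.1} ×ˢ Icc (y₀ - 1) y₀) ∪ B)
    (B := {p.1} ×ˢ Icc (y₀ - 1) y₀ ∪ A)
    (x := (m, y₀ - 1)) (y := q') (z := (p.1, y₀ - 1)) (w := q) (a := m) (b := b)
    (c := y₀ - 1) (d := y₁)
    (((joinedIn_horizontal (v := (m, y₀ - 1)) (w := (p'.1, y₀ - 1)) rfl rfl ⟨le_rfl, hmp⟩
        ⟨hmp, le_rfl⟩).trans' (y := (p'.1, y₀ - 1))
        (joinedIn_vertical (x := p'.1) (c := y₀ - 1) (d := y₀) rfl rfl ⟨le_rfl, by simp⟩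
        ⟨by simp [hp'], hp'.le⟩) subset_union_left subset_union_right).trans' hB
        subset_union_left subset_union_right)
    ((joinedIn_vertical (v := (p.1, y₀ - 1)) (w := p) rfl rfl ⟨le_rfl, by simp⟩
        ⟨by simp [hp], hp.le⟩).trans' hA subset_union_left subset_union_right)
    (by
      rintro v ((⟨h1, h2⟩ | ⟨h1, h2⟩) | h)
      · rw [mem_singleton_iff] at h2; constructor <;> linarith
      · constructor <;> linarith [h2.1, h2.2]
      · constructor <;> linarith [(hBs v h).1, (hBs v h).2])
    (by
      rintro v (⟨h1, h2⟩ | h)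
      · rw [mem_singleton_iff] at h1; constructor <;> linarith
      · exact ⟨(min_le_left _ _).trans (abs_le.1 (hM v h)).1, (hAs v h).1⟩)
    le_rfl hq' le_rfl hq.ge
  rcases hvB with (⟨h1, h2⟩ | ⟨h1, h2⟩) | h <;> rcases hvA with ⟨h3, h4⟩ | h'
  · rw [mem_singleton_iff] at h3
    exact eqp (le_antisymm hpp (h3 ▸ h1.2))
  · rw [mem_singleton_iff] at h2
    linarith [(hAs v h').2.1]
  · rw [mem_singleton_iff] at h1 h3
    exact eqp (h1 ▸ h3)
  · have : v = p' := Prod.ext h1 (by linarith [h2.2, (hAs v h').2.1])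
    exact ⟨p', this ▸ h', hp'B⟩
  · have : v = p := Prod.ext h3 (by linarith [h4.2, (hBs v h).1])
    exact ⟨p, hpA, this ▸ h⟩
  · exact ⟨v, h', h⟩

/-- In a horizontal strip, a curve from bottom to top that stays to the left of `b` meets every
curve that starts on the bottom to the left of it and reaches `b`. -/
lemma exists_joinedIn_of_right {A B : Set Plane} {p q p' q' : Plane} {y₀ y₁ b : ℝ}
    (hA : JoinedIn A p q) (hB : JoinedIn B p' q')
    (hAs : ∀ v ∈ A, v.1 ≤ b ∧ y₀ ≤ v.2 ∧ v.2 ≤ y₁) (hBs : ∀ v ∈ B, y₀ ≤ v.2 ∧ v.2 ≤ y₁)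
    (hp : p.2 = y₀) (hq : q.2 = y₁) (hp' : p'.2 = y₀) (hq' : b ≤ q'.1) (hpp : p'.1 ≤ p.1) :
    ∃ v, JoinedIn A p v ∧ JoinedIn B p' v :=
  exists_joinedIn_of_forall_inter hA hB fun _ _ hA' hB' hAc _ hAj hBj =>
    inter_nonempty_of_right hAc hAj hBj (fun v hv => hAs v (hA' hv)) (fun v hv => hBs v (hB' hv))
      hp hq hp' hq' hpp

/-- Two curves crossing a horizontal strip in opposite orders meet. -/
lemma exists_joinedIn_of_swap {A B : Set Plane} {p q p' q' : Plane} {y₀ y₁ : ℝ}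
    (hA : JoinedIn A p q) (hB : JoinedIn B p' q')
    (hAs : ∀ v ∈ A, y₀ ≤ v.2 ∧ v.2 ≤ y₁) (hBs : ∀ v ∈ B, y₀ ≤ v.2 ∧ v.2 ≤ y₁)
    (hp : p.2 = y₀) (hq : q.2 = y₁) (hp' : p'.2 = y₀) (hq' : q'.2 = y₁) (hpp : p'.1 ≤ p.1)
    (hqq : q.1 ≤ q'.1) : ∃ v, JoinedIn A p v ∧ JoinedIn B p' v := by
  refine exists_joinedIn_of_forall_inter hA hB fun A' B' hA' hB' hAc hBc hAj hBj => ?_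
  obtain ⟨M, hM⟩ := exists_abs_fst_le hAc
  -- Above the strip, `A'` is prolonged straight up and `B'` up and then right to the line `x = m`,
  -- beyond all of `A'`; this is the situation of `inter_nonempty_of_right`.
  set m := max M q'.1 with hm
  have hqA := hAj.target_mem
  have hq'B := hBj.target_mem
  have hqm : q'.1 ≤ m := le_max_right _ _
  have hqM : q.1 ≤ m := (abs_le.1 (hM q hqA)).2.trans (le_max_left _ _)
  have hyy : y₀ ≤ y₁ := by rw [← hp]; exact (hAs p (hA' hAj.source_mem)).2
  have eqq : q'.1 = q.1 → (A' ∩ B').Nonempty := fun h => by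
    have : q' = q := Prod.ext h (by rw [hq, hq'])
    exact ⟨q, hqA, this ▸ hq'B⟩
  obtain ⟨v, hvA, hvB⟩ := inter_nonempty_of_right
    (A := A' ∪ {q.1} ×ˢ Icc y₁ (y₁ + 1))
    (B := B' ∪ ({q'.1} ×ˢ Icc y₁ (y₁ + 1) ∪ Icc q'.1 m ×ˢ {y₁ + 1}))
    (p := p) (q := (q.1, y₁ + 1)) (p' := p') (q' := (m, y₁ + 1)) (y₀ := y₀) (y₁ := y₁ + 1)
    (b := m) (hAc.union (isCompact_singleton.prod isCompact_Icc))
    (hAj.trans' (joinedIn_vertical rfl rfl ⟨hq.ge, by simp [hq]⟩ ⟨by simp, le_rfl⟩)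
      subset_union_left subset_union_right)
    (hBj.trans' ((joinedIn_vertical (v := q') (w := (q'.1, y₁ + 1)) rfl rfl ⟨hq'.ge, by simp [hq']⟩
      ⟨le_add_of_nonneg_right zero_le_one, le_rfl⟩).trans'
      (joinedIn_horizontal (w := (m, y₁ + 1)) rfl rfl ⟨le_rfl, hqm⟩ ⟨hqm, le_rfl⟩) subset_union_left subset_union_right) subset_union_left subset_union_right)
    (by
      rintro v (h | ⟨h1, h2⟩)
      · exact ⟨(abs_le.1 (hM v h)).2.trans (le_max_left _ _), (hAs v (hA' h)).1,
          by linarith [(hAs v (hA' h)).2]⟩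
      · rw [mem_singleton_iff] at h1
        exact ⟨by linarith, by linarith [h2.1], h2.2⟩)
    (by
      rintro v (h | ⟨h1, h2⟩ | ⟨h1, h2⟩)
      · exact ⟨(hBs v (hB' h)).1, by linarith [(hBs v (hB' h)).2]⟩
      · exact ⟨by linarith [h2.1], h2.2⟩
      · rw [mem_singleton_iff] at h2
        constructor <;> linarith)
    hp rfl hp' le_rfl hpp
  rcases hvA with h | ⟨h1, h2⟩ <;> rcases hvB with h' | ⟨h3, h4⟩ | ⟨h3, h4⟩
  · exact ⟨v, h, h'⟩
  · have : v = q' := Prod.ext h3 (by linarith [h4.1, (hAs v (hA' h)).2])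
    exact ⟨q', this ▸ h, hq'B⟩
  · rw [mem_singleton_iff] at h4
    linarith [(hAs v (hA' h)).2]
  · have : v = q := Prod.ext h1 (by linarith [h2.1, (hBs v (hB' h')).2])
    exact ⟨q, hqA, this ▸ h'⟩
  · rw [mem_singleton_iff] at h1 h3
    exact eqq (h3 ▸ h1)
  · rw [mem_singleton_iff] at h1
    exact eqq (le_antisymm (h1 ▸ h3.1) hqq)

/-- In a horizontal strip, a curve from the line `x = b` to the top that stays to the right of
`c` meets every curve from the line `x = c` to the top that stays to the left of `b`, if the
first one ends to the left of the second one. -/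
lemma exists_joinedIn_of_top {A B : Set Plane} {p q p' q' : Plane} {y₀ y₁ b c : ℝ}
    (hA : JoinedIn A p q) (hB : JoinedIn B p' q')
    (hAs : ∀ v ∈ A, c < v.1 ∧ y₀ ≤ v.2 ∧ v.2 ≤ y₁) (hBs : ∀ v ∈ B, v.1 ≤ b ∧ y₀ ≤ v.2 ∧ v.2 ≤ y₁)
    (hp : b ≤ p.1) (hq : q.2 = y₁) (hp' : p'.1 = c) (hq' : q'.2 = y₁)
    (hqq : q.1 ≤ q'.1) : ∃ v, JoinedIn A p v ∧ JoinedIn B p' v := by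
  refine exists_joinedIn_of_forall_inter hA hB fun A' B' hA' hB' hAc hBc hAj hBj => ?_
  have hfl : Continuous fun v : Plane => ((v.1, -v.2) : Plane) := by fun_prop
  have hp's := hBs p' (hB' hBj.source_mem)
  -- The picture is turned upside down, and the second curve is completed to a crossing of the strip
  -- by a segment on the line `x = c`, which the first curve cannot touch.
  obtain ⟨v, ⟨v₁, hv₁, e₁⟩, ⟨v₂, hv₂, e₂⟩⟩ := inter_nonempty_of_right
    (A := (fun v : Plane => ((v.1, -v.2) : Plane)) '' (B' ∪ {c} ×ˢ Icc y₀ p'.2))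
    (B := (fun v : Plane => ((v.1, -v.2) : Plane)) '' A')
    (p := (q'.1, -q'.2)) (q := (c, -y₀)) (p' := (q.1, -q.2)) (q' := (p.1, -p.2))
    (y₀ := -y₁) (y₁ := -y₀) (b := b)
    ((hBc.union (isCompact_singleton.prod isCompact_Icc)).image hfl)
    ((hBj.symm.trans' (joinedIn_vertical (w := (c, y₀)) hp' rfl ⟨hp's.2.1, le_rfl⟩
      ⟨le_rfl, hp's.2.1⟩) subset_union_left subset_union_right).map hfl)
    (hAj.symm.map hfl)
    (by
      rintro _ ⟨v, h | ⟨h1, h2⟩, rfl⟩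
      · have := hBs v (hB' h)
        exact ⟨this.1, neg_le_neg this.2.2, neg_le_neg this.2.1⟩
      · rw [mem_singleton_iff] at h1
        have h3 : v.2 ≤ y₁ := h2.2.trans hp's.2.2
        exact ⟨by simp only [h1, ← hp']; exact hp's.1, neg_le_neg h3, neg_le_neg h2.1⟩)
    (by
      rintro _ ⟨v, h, rfl⟩
      have := hAs v (hA' h)
      exact ⟨neg_le_neg this.2.2, neg_le_neg this.2.1⟩)
    (by simp [hq']) rfl (by simp [hq]) hp hqq
  have : v₁ = v₂ := by
    have := e₁.trans e₂.symm
    simp only [Prod.mk.injEq, neg_inj] at this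
    exact Prod.ext this.1 this.2
  subst this
  rcases hv₁ with h | ⟨h1, -⟩
  · exact ⟨v₁, hv₂, h⟩
  · rw [mem_singleton_iff] at h1
    linarith [(hAs v₁ (hA' hv₂)).1]

/-! ### Parts of curves -/

variable {X : Type*} [TopologicalSpace X]

/-- The part of a curve up to its first visit to the level `c`. -/
lemma JoinedIn.exists_first {A : Set X} {x y : X} (h : JoinedIn A x y) {f : X → ℝ}
    (hf : Continuous f) {c : ℝ} (hx : f x ≤ c) (hy : c ≤ f y) :
    ∃ z, f z = c ∧ JoinedIn (A ∩ {v | f v ≤ c}) x z ∧ JoinedIn A z y := by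
  obtain ⟨γ, hγ⟩ := h
  have hcont : Continuous fun t => f (γ t) := hf.comp γ.continuous
  set S : Set I := {t | c ≤ f (γ t)} with hS
  have hSc : IsClosed S := isClosed_le continuous_const hcont
  obtain ⟨t, htS, htm⟩ := hSc.isCompact.exists_isLeast (s := S) ⟨1, by simpa [hS] using hy⟩
  have hlt : ∀ s < t, f (γ s) < c := fun s hs => by
    by_contra! hge
    exact absurd (htm hge) (not_le.2 hs)
  have hle : f (γ t) ≤ c := by
    by_contra! hgt
    have hconn : (range fun s : I => f (γ s)).OrdConnected :=
      (isPreconnected_range hcont).ordConnected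
    have hpre := (isPreconnected_Icc (a := (0 : I)) (b := t)).image _ hcont.continuousOn
    obtain ⟨s, hs, hsv⟩ := hpre.ordConnected.out (mem_image_of_mem _ (left_mem_Icc.2 nonneg'))
      (mem_image_of_mem _ (right_mem_Icc.2 nonneg')) ⟨by simpa using hx, hgt.le⟩
    have hst : s = t := le_antisymm hs.2 (htm (hsv.ge : c ≤ f (γ s)))
    simp only [hst] at hsv
    linarith
  refine ⟨γ t, le_antisymm hle htS, ?_, ?_⟩
  · have : JoinedIn (A ∩ {v | f v ≤ c}) (γ 0) (γ t) := by
      refine ⟨γ.subpath 0 t, fun s => ⟨hγ _, ?_⟩⟩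
      have hmem : γ.subpath 0 t s ∈ γ '' Icc 0 t := by
        rw [← γ.range_subpath_of_le 0 t nonneg']
        exact mem_range_self s
      obtain ⟨r, hr, hrv⟩ := hmem
      rw [← hrv]
      rcases hr.2.lt_or_eq with h | h
      · exact (hlt r h).le
      · rw [h]; exact hle
    rwa [γ.source] at this
  · have : JoinedIn A (γ t) (γ 1) := ⟨γ.subpath t 1, fun s => hγ _⟩
    rwa [γ.target] at this

/-- The part of a curve after its last visit to the level `c`. -/
lemma JoinedIn.exists_last {A : Set X} {x y : X} (h : JoinedIn A x y) {f : X → ℝ}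
    (hf : Continuous f) {c : ℝ} (hx : f x ≤ c) (hy : c ≤ f y) :
    ∃ z, f z = c ∧ JoinedIn A x z ∧ JoinedIn (A ∩ {v | c ≤ f v}) z y := by
  obtain ⟨z, hz, h1, h2⟩ := h.symm.exists_first (f := fun v => -f v) (c := -c) hf.neg
    (neg_le_neg hy) (neg_le_neg hx)
  exact ⟨z, neg_injective hz, h2.symm, h1.symm.mono fun v hv => ⟨hv.1, by simpa using hv.2⟩⟩

/-- A curve whose end-points cannot be joined below the level `c` reaches this level. -/
lemma JoinedIn.exists_of_not_le {A : Set X} {x y : X} (h : JoinedIn A x y) {f : X → ℝ}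
    (hf : Continuous f) {c : ℝ} (hx : f x ≤ c) (hn : ¬ JoinedIn (A ∩ {v | f v ≤ c}) x y) :
    ∃ z, f z = c ∧ JoinedIn (A ∩ {v | f v ≤ c}) x z ∧ JoinedIn A z y := by
  obtain ⟨γ, hγ⟩ := h
  have : ∃ t, c < f (γ t) := by
    by_contra! hle
    exact hn ⟨γ, fun t => ⟨hγ t, hle t⟩⟩
  obtain ⟨t, ht⟩ := this
  have h1 : JoinedIn A x (γ t) := by
    have : JoinedIn A (γ 0) (γ t) := ⟨γ.subpath 0 t, fun s => hγ _⟩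
    rwa [γ.source] at this
  have h2 : JoinedIn A (γ t) y := by
    have : JoinedIn A (γ t) (γ 1) := ⟨γ.subpath t 1, fun s => hγ _⟩
    rwa [γ.target] at this
  obtain ⟨z, hz, h3, h4⟩ := h1.exists_first hf hx ht.le
  exact ⟨z, hz, h3, h4.trans h2⟩

lemma JoinedIn.exists_of_not_ge {A : Set X} {x y : X} (h : JoinedIn A x y) {f : X → ℝ}
    (hf : Continuous f) {c : ℝ} (hx : c ≤ f x) (hn : ¬ JoinedIn (A ∩ {v | c ≤ f v}) x y) :
    ∃ z, f z = c ∧ JoinedIn (A ∩ {v | c ≤ f v}) x z ∧ JoinedIn A z y := by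
  obtain ⟨z, hz, h1, h2⟩ := h.exists_of_not_le (f := fun v => -f v) (c := -c) hf.neg
    (neg_le_neg hx) (by simpa using hn)
  exact ⟨z, neg_injective hz, by simpa using h1, h2⟩

end CrossingCurves

/-! ### Curves in strips

The following conditions on a subset `A` of the plane say that `A` contains curves crossing the
strip `y ≤ v.2 ≤ y + h` from the unit interval `[x, x + 1]` on its bottom in some exceptional
way. -/

section Strips

open Set

/-- The part of `A` in the horizontal strip `[y, y + h]`. -/
def slab (A : Set Plane) (y h : ℝ) : Set Plane := A ∩ {v | y ≤ v.2 ∧ v.2 ≤ y + h}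

/-- A crossing of the strip ends far to the right of its start. -/
def DriftRight (A : Set Plane) (x y h : ℝ) : Prop :=
  ∃ p q : Plane, x ≤ p.1 ∧ p.1 ≤ x + 1 ∧ p.2 = y ∧ q.2 = y + h ∧ x + 2 ≤ q.1 ∧
    JoinedIn (slab A y h) p q

/-- A crossing of the strip ends far to the left of its start. -/
def DriftLeft (A : Set Plane) (x y h : ℝ) : Prop :=
  ∃ p q : Plane, x ≤ p.1 ∧ p.1 ≤ x + 1 ∧ p.2 = y ∧ q.2 = y + h ∧ q.1 ≤ x - 1 ∧
    JoinedIn (slab A y h) p q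

/-- A horizontal crossing of a rectangle that is longer than high. -/
def LongCrossing (A : Set Plane) (x y h : ℝ) : Prop :=
  ∃ p q : Plane, p.1 = x ∧ q.1 = x + h + 1 ∧
    JoinedIn (slab A y h ∩ {v | x ≤ v.1 ∧ v.1 ≤ x + h + 1}) p q

/-- A crossing of the strip that does not go far to the right. -/
def StaysLeft (A : Set Plane) (x y h b : ℝ) : Prop :=
  ∃ p q : Plane, x ≤ p.1 ∧ p.1 ≤ x + 1 ∧ p.2 = y ∧ q.2 = y + h ∧
    JoinedIn (slab A y h ∩ {v | v.1 ≤ x + b}) p q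

/-- A crossing of the strip that does not go far to the left. -/
def StaysRight (A : Set Plane) (x y h b : ℝ) : Prop :=
  ∃ p q : Plane, x ≤ p.1 ∧ p.1 ≤ x + 1 ∧ p.2 = y ∧ q.2 = y + h ∧
    JoinedIn (slab A y h ∩ {v | x + 1 - b ≤ v.1}) p q

/-- A crossing of the strip that goes far to the left only before it goes far to the right. -/
def LeftThenRight (A : Set Plane) (x y h b : ℝ) : Prop :=
  ∃ p w q : Plane, x ≤ p.1 ∧ p.1 ≤ x + 1 ∧ p.2 = y ∧ q.2 = y + h ∧
    JoinedIn (slab A y h ∩ {v | v.1 ≤ x + b - 1}) p w ∧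
    JoinedIn (slab A y h ∩ {v | x + 5 - b ≤ v.1}) w q

/-- A crossing of the strip that goes far to the right only before it goes far to the left. -/
def RightThenLeft (A : Set Plane) (x y h b : ℝ) : Prop :=
  ∃ p w q : Plane, x ≤ p.1 ∧ p.1 ≤ x + 1 ∧ p.2 = y ∧ q.2 = y + h ∧
    JoinedIn (slab A y h ∩ {v | x + 2 - b ≤ v.1}) p w ∧
    JoinedIn (slab A y h ∩ {v | v.1 ≤ x + b - 4}) w q

lemma slab_mono {A B : Set Plane} (hAB : A ⊆ B) (y h : ℝ) : slab A y h ⊆ slab B y h :=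
  inter_subset_inter_left _ hAB

lemma slab_subset (A : Set Plane) (y h : ℝ) : slab A y h ⊆ A := inter_subset_left

lemma JoinedIn.mapsTo {X Y : Type*} [TopologicalSpace X] [TopologicalSpace Y] {A : Set X}
    {B : Set Y} {x y : X} (h : JoinedIn A x y) {f : X → Y} (hf : Continuous f)
    (hAB : MapsTo f A B) : JoinedIn B (f x) (f y) :=
  (h.map hf).mono hAB.image_subset

/-! ### Chaining and intersecting exceptional crossings -/

lemma exists_joinedIn_of_crossing {A B : Set Plane} {x y z w : Plane} {a b c d : ℝ}
    (hA : JoinedIn A x y) (hB : JoinedIn B z w) (hAs : ∀ v ∈ A, c ≤ v.2 ∧ v.2 ≤ d)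
    (hBs : ∀ v ∈ B, a ≤ v.1 ∧ v.1 ≤ b) (hx : x.1 ≤ a) (hy : b ≤ y.1) (hz : z.2 ≤ c)
    (hw : d ≤ w.2) : ∃ v, JoinedIn A x v ∧ JoinedIn B z v :=
  exists_joinedIn_of_forall_inter hA hB fun _ _ hA' hB' _ _ hAj hBj =>
    inter_nonempty_of_crossing hAj hBj (fun v hv => hAs v (hA' hv)) (fun v hv => hBs v (hB' hv))
      hx hy hz hw

/-- Chaining drifting crossings gives a long horizontal curve. -/
lemma exists_long_of_drift {A : Set Plane} {x y h : ℝ} {M : ℕ}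
    (hR : ∀ j ≤ M, DriftRight A (x + 2 * j) y h) (hL : ∀ j < M, DriftLeft A (x + 2 * j + 3) y h) :
    ∃ p q : Plane, p.1 ≤ x + 1 ∧ x + 2 * M + 2 ≤ q.1 ∧ JoinedIn (slab A y h) p q := by
  choose! p q hp hp' hp2 hq2 hq hj using hR
  have hs : ∀ v ∈ slab A y h, y ≤ v.2 ∧ v.2 ≤ y + h := fun v hv => hv.2
  have key : ∀ j ≤ M, JoinedIn (slab A y h) (p 0) (p j) := by
    intro j
    induction j with
    | zero => exact fun _ => JoinedIn.refl (hj 0 (Nat.zero_le _)).source_mem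
    | succ j ih =>
      intro hjM
      have hj' : j ≤ M := by omega
      -- This left drift starts to the right of the starts of the right drifts `j` and `j + 1` and
      -- ends to the left of their ends, so it meets and links both.
      obtain ⟨r, s, hr, hr', hr2, hs2, hs1, hrs⟩ := hL j (by omega)
      obtain ⟨v, hv1, hv2⟩ := exists_joinedIn_of_swap hrs (hj j hj') hs hs hr2 hs2
        (hp2 j hj') (hq2 j hj') (by linarith [hp' j hj']) (by linarith [hq j hj'])
      have e1 := hp' (j + 1) hjM
      have e2 := hq (j + 1) hjM
      push_cast at e1 e2
      obtain ⟨w, hw1, hw2⟩ := exists_joinedIn_of_swap hrs (hj (j + 1) hjM) hs hs hr2 hs2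
        (hp2 _ hjM) (hq2 _ hjM) (by linarith) (by linarith)
      exact (ih hj').trans (hv2.trans (hv1.symm.trans (hw1.trans hw2.symm)))
  refine ⟨p 0, q M, ?_, ?_, (key M le_rfl).trans (hj M le_rfl)⟩
  · simpa using hp' 0 (Nat.zero_le _)
  · exact hq M le_rfl

lemma joinedIn_of_swap_preimage {A B : Set Plane} {p q : Plane} (hj : JoinedIn B p q)
    (hB : ∀ v ∈ B, v.swap ∈ A) : JoinedIn A p.swap q.swap :=
  hj.mapsTo continuous_swap hB

/-- Chaining horizontal and vertical crossings of rectangles gives a long horizontal curve. -/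
lemma exists_long_of_longCrossing {A : Set Plane} {x y h : ℝ} {M : ℕ}
    (hH : ∀ j ≤ M, LongCrossing A (x + j) y h)
    (hV : ∀ j < M, LongCrossing (Prod.swap ⁻¹' A) y (x + j + 1) h) (hh : 0 ≤ h) :
    ∃ p q : Plane, p.1 = x ∧ q.1 = x + M + h + 1 ∧ JoinedIn (slab A y h) p q := by
  choose! p q hp hq hj using hH
  have key : ∀ j ≤ M, JoinedIn (slab A y h) (p 0) (p j) := by
    intro j
    induction j with
    | zero => exact fun _ => JoinedIn.refl (hj 0 (Nat.zero_le _)).source_mem.1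
    | succ j ih =>
      intro hjM
      have hj' : j ≤ M := by omega
      -- The horizontal crossings `j` and `j + 1` overlap on an interval of length `h`, above which
      -- this vertical crossing lies; hence it meets both.
      obtain ⟨r, s, hr, hs, hrs⟩ := hV j (by omega)
      obtain ⟨t, ht, hrt, -⟩ := hrs.exists_first (f := Prod.fst) (c := y + h) continuous_fst
        (by linarith) (by linarith)
      have hB := joinedIn_of_swap_preimage (A := slab A y h ∩
        {v | x + j + 1 ≤ v.1 ∧ v.1 ≤ x + j + 1 + h}) hrt (by
          rintro v ⟨⟨⟨h1, h2⟩, h3⟩, h4⟩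
          exact ⟨⟨h1, h3.1, h4⟩, h2⟩)
      have e1 := hp (j + 1) hjM
      have e2 := hq (j + 1) hjM
      push_cast at e1 e2
      obtain ⟨v, hv1, hv2⟩ := exists_joinedIn_of_crossing (a := x + j + 1) (b := x + j + 1 + h)
        (c := y) (d := y + h) (hj j hj') hB (fun v hv => hv.1.2) (fun v hv => hv.2)
        (by linarith [hp j hj']) (by linarith [hq j hj']) (by simp [hr]) (by simp [ht])
      obtain ⟨w, hw1, hw2⟩ := exists_joinedIn_of_crossing (a := x + j + 1) (b := x + j + 1 + h)
        (c := y) (d := y + h) (hj (j + 1) hjM) hB (fun v hv => hv.1.2) (fun v hv => hv.2)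
        (by linarith) (by linarith) (by simp [hr]) (by simp [ht])
      exact (ih hj').trans (((hv1.trans' hv2.symm inter_subset_left inter_subset_left)).trans
        (hw2.trans' hw1.symm inter_subset_left inter_subset_left))
  refine ⟨p 0, q M, ?_, hq M le_rfl, (key M le_rfl).trans ((hj M le_rfl).mono inter_subset_left)⟩
  simpa using hp 0 (Nat.zero_le _)

/-- Two crossings that stay on different sides give a drifting crossing or a long crossing. -/
lemma drift_or_long_of_stays {A : Set Plane} {x y h b : ℝ} (hb : 2 * b + 3 ≤ h)
    (hL : StaysLeft A x y h b) (hR : StaysRight A (x - 3) y h b) :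
    DriftLeft A x y h ∨ DriftRight A (x - 3) y h ∨
      LongCrossing (Prod.swap ⁻¹' A) y (x - 2 - b) (h - 1) := by
  obtain ⟨p, q, hp, hp', hp2, hq2, hpq⟩ := hL
  obtain ⟨r, s, hr, hr', hr2, hs2, hrs⟩ := hR
  -- If the second crossing also stays to the left of `x + b`, it crosses a rectangle of width `2 *
  -- b + 2 ≤ h - 1` the long way. Otherwise it starts to the left of the first one and reaches `x +
  -- b`, so the two meet, and the common end `q` is far from one of the starts.
  by_cases hc : JoinedIn (slab A y h ∩ {v | x - 3 + 1 - b ≤ v.1} ∩ {v | v.1 ≤ x + b}) r s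
  · refine Or.inr (Or.inr ⟨r.swap, s.swap, hr2, by simp only [Prod.fst_swap, hs2]; ring, ?_⟩)
    refine hc.mapsTo continuous_swap ?_
    rintro v ⟨⟨⟨h1, h2, h3⟩, h4⟩, h5⟩
    rw [mem_ofPred_eq] at h4 h5
    refine ⟨⟨by simpa using h1, ?_, ?_⟩, ?_, ?_⟩
    · simp only [Prod.snd_swap]; linarith
    · simp only [Prod.snd_swap]; linarith
    · exact h2
    · simp only [Prod.fst_swap]; linarith
  · have hbx : x ≤ x + b := hp.trans hpq.source_mem.2
    obtain ⟨z, hz, hrz, -⟩ := hrs.exists_of_not_le continuous_fst (by linarith) hc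
    obtain ⟨v, hv1, hv2⟩ := exists_joinedIn_of_right (y₀ := y) (y₁ := y + h) (b := x + b) hpq hrz
      (fun v hv => ⟨hv.2, hv.1.2⟩) (fun v hv => hv.1.1.2) hp2 hq2 hr2 hz.ge (by linarith)
    have hrq : JoinedIn (slab A y h) r q := (hv2.trans' hv1.symm
      (fun v hv => hv.1.1) (fun v hv => hv.1)).trans (hpq.mono inter_subset_left)
    by_cases hq : x - 1 ≤ q.1
    · exact Or.inr (Or.inl ⟨r, q, hr, hr', hr2, hq2, by linarith, hrq⟩)
    · exact Or.inl ⟨p, q, hp, hp', hp2, hq2, by linarith, hpq.mono inter_subset_left⟩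

/-- Two crossings that go far to both sides in different orders meet, unless one of them drifts
or stays on one side. -/
lemma drift_or_stays_of_turns {A : Set Plane} {x y h b : ℝ} (hb : 3 ≤ b)
    (hL : LeftThenRight A x y h b) (hR : RightThenLeft A (x + 3) y h b) :
    DriftRight A x y h ∨ DriftLeft A (x + 3) y h ∨ StaysLeft A x y h b ∨
      StaysRight A (x + 3) y h b := by
  obtain ⟨p, w, q, hp, hp', hp2, hq2, hpw, hwq⟩ := hL
  obtain ⟨r, u, s, hr, hr', hr2, hs2, hru, hus⟩ := hR
  have hpq : JoinedIn (slab A y h) p q := hpw.trans' hwq inter_subset_left inter_subset_left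
  have hrs : JoinedIn (slab A y h) r s := hru.trans' hus inter_subset_left inter_subset_left
  by_cases h1 : x + 2 ≤ q.1
  · exact Or.inl ⟨p, q, hp, hp', hp2, hq2, h1, hpq⟩
  by_cases h2 : s.1 ≤ x + 3 - 1
  · exact Or.inr (Or.inl ⟨r, s, hr, hr', hr2, hs2, h2, hrs⟩)
  push Not at h1 h2
  by_cases h3 : JoinedIn (slab A y h ∩ {v | x + 5 - b ≤ v.1} ∩ {v | v.1 ≤ x + b}) q w
  · refine Or.inr (Or.inr (Or.inl ⟨p, q, hp, hp', hp2, hq2, hpw.trans' h3.symm ?_ ?_⟩))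
    · exact fun v hv => ⟨hv.1, by have := hv.2; rw [mem_ofPred_eq] at this ⊢; linarith⟩
    · exact fun v hv => ⟨hv.1.1, hv.2⟩
  by_cases h4 : JoinedIn (slab A y h ∩ {v | v.1 ≤ x + 3 + b - 4} ∩ {v | x + 4 - b ≤ v.1}) s u
  · refine Or.inr (Or.inr (Or.inr ⟨r, s, hr, hr', hr2, hs2, hru.trans' h4.symm ?_ ?_⟩))
    · exact fun v hv => ⟨hv.1, by have := hv.2; rw [mem_ofPred_eq] at this ⊢; linarith⟩
    · exact fun v hv => ⟨hv.1.1, by have := hv.2; rw [mem_ofPred_eq] at this ⊢; linarith⟩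
  -- In the remaining case the final pieces come from the opposite far sides but end with `q` to the
  -- left of `s`, so they meet near the top and `p` is joined to `s`.
  obtain ⟨z, hz, hqz, -⟩ := hwq.symm.exists_of_not_le continuous_fst (by linarith) h3
  obtain ⟨z', hz', hsz', -⟩ := hus.symm.exists_of_not_ge continuous_fst (by linarith) h4
  obtain ⟨v, hv1, hv2⟩ := exists_joinedIn_of_top (y₀ := y) (y₁ := y + h) (b := x + b)
    (c := x + 4 - b) hqz.symm hsz'.symm
    (fun v hv => ⟨by have := hv.1.2; rw [mem_ofPred_eq] at this; linarith, hv.1.1.2⟩)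
    (fun v hv => ⟨by have := hv.1.2; rw [mem_ofPred_eq] at this; linarith, hv.1.1.2⟩)
    hz.ge hq2 hz' hs2 (by linarith)
  refine Or.inl ⟨p, s, hp, hp', hp2, hs2, by linarith, ?_⟩
  have e1 : slab A y h ∩ {v | x + 5 - b ≤ v.1} ∩ {v | v.1 ≤ x + b} ⊆ slab A y h :=
    fun v hv => hv.1.1
  have e2 : slab A y h ∩ {v | v.1 ≤ x + 3 + b - 4} ∩ {v | x + 4 - b ≤ v.1} ⊆ slab A y h :=
    fun v hv => hv.1.1
  exact hpq.trans ((hqz.mono e1).trans ((hv1.mono e1).trans ((hv2.symm.mono e2).trans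
    (hsz'.symm.mono e2))))

/-! ### Regular sets -/

/-- The half-width used for crossings of strips of height `h`. -/
def halfWidth (h : ℕ) : ℕ := (h - 3) / 2

/-- `A` contains one of the exceptional crossings at `(x, y)`. -/
def Exceptional (A : Set Plane) (x y : ℝ) (h : ℕ) : Prop :=
  DriftRight A x y h ∨ DriftLeft A x y h ∨ LongCrossing A x y h ∨
    StaysLeft A x y h (halfWidth h) ∨ StaysRight A x y h (halfWidth h) ∨
    LeftThenRight A x y h (halfWidth h) ∨ RightThenLeft A x y h (halfWidth h)

/-- `A` contains no exceptional crossing at the integer points, for heights up to `N`. -/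
def Regular (A : Set Plane) (N : ℕ) : Prop :=
  ∀ (x y : ℤ) (h : ℕ), 20 ≤ h → h ≤ N → ¬ Exceptional A x y h

lemma Exceptional.mono {A B : Set Plane} (hAB : A ⊆ B) {x y : ℝ} {h : ℕ}
    (hA : Exceptional A x y h) : Exceptional B x y h := by
  have hs := slab_mono hAB y h
  rcases hA with ⟨p, q, h1, h2, h3, h4, h5, h6⟩ | ⟨p, q, h1, h2, h3, h4, h5, h6⟩ |
    ⟨p, q, h1, h2, h3⟩ | ⟨p, q, h1, h2, h3, h4, h5⟩ | ⟨p, q, h1, h2, h3, h4, h5⟩ |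
    ⟨p, w, q, h1, h2, h3, h4, h5, h6⟩ | ⟨p, w, q, h1, h2, h3, h4, h5, h6⟩
  · exact Or.inl ⟨p, q, h1, h2, h3, h4, h5, h6.mono hs⟩
  · exact Or.inr (Or.inl ⟨p, q, h1, h2, h3, h4, h5, h6.mono hs⟩)
  · exact Or.inr (Or.inr (Or.inl ⟨p, q, h1, h2, h3.mono (inter_subset_inter_left _ hs)⟩))
  · exact Or.inr (Or.inr (Or.inr (Or.inl ⟨p, q, h1, h2, h3, h4,
      h5.mono (inter_subset_inter_left _ hs)⟩)))
  · exact Or.inr (Or.inr (Or.inr (Or.inr (Or.inl ⟨p, q, h1, h2, h3, h4,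
      h5.mono (inter_subset_inter_left _ hs)⟩))))
  · exact Or.inr (Or.inr (Or.inr (Or.inr (Or.inr (Or.inl ⟨p, w, q, h1, h2, h3, h4,
      h5.mono (inter_subset_inter_left _ hs), h6.mono (inter_subset_inter_left _ hs)⟩)))))
  · exact Or.inr (Or.inr (Or.inr (Or.inr (Or.inr (Or.inr ⟨p, w, q, h1, h2, h3, h4,
      h5.mono (inter_subset_inter_left _ hs), h6.mono (inter_subset_inter_left _ hs)⟩)))))

lemma Regular.mono {A B : Set Plane} {N : ℕ} (hB : Regular B N) (hAB : A ⊆ B) : Regular A N :=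
  fun x y h h1 h2 hA => hB x y h h1 h2 (hA.mono hAB)

/-- A curve that can neither stay below `Y'` nor above `Y` crosses the band between these levels;
the part before its first crossing stays on one side. -/
lemma exists_first_pass {X : Type*} [TopologicalSpace X] {A : Set X} {P Q : X}
    (hPQ : JoinedIn A P Q) {f : X → ℝ} (hf : Continuous f) {Y Y' : ℝ} (hYY : Y ≤ Y')
    (hP : Y ≤ f P) (hP' : f P ≤ Y') (h1 : ¬ JoinedIn (A ∩ {v | f v ≤ Y'}) P Q)
    (h2 : ¬ JoinedIn (A ∩ {v | Y ≤ f v}) P Q) :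
    ∃ z w, f z = Y ∧ f w = Y' ∧ JoinedIn (A ∩ {v | Y ≤ f v ∧ f v ≤ Y'}) z w ∧
      (JoinedIn (A ∩ {v | f v ≤ Y'}) P z ∨ JoinedIn (A ∩ {v | Y ≤ f v}) P z) := by
  obtain ⟨w, hw, hPw, -⟩ := hPQ.exists_of_not_le hf hP' h1
  -- If the way back from `w` leaves the band, it does so through `Y`, which gives the pass.
  -- Otherwise `P` is joined to the top level inside the band, and the first visit to `Y` is used
  -- instead.
  by_cases hc : JoinedIn (A ∩ {v | f v ≤ Y'} ∩ {v | Y ≤ f v}) w P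
  · obtain ⟨z, hz, hPz, -⟩ := hPQ.exists_of_not_ge hf hP h2
    by_cases hd : JoinedIn (A ∩ {v | Y ≤ f v} ∩ {v | f v ≤ Y'}) z P
    · exact ⟨z, w, hz, hw, hd.trans' hc.symm (fun v hv => ⟨hv.1.1, hv.1.2, hv.2⟩)
        (fun v hv => ⟨hv.1.1, hv.2, hv.1.2⟩), Or.inr hPz⟩
    · obtain ⟨w', hw', hzw', -⟩ := hPz.symm.exists_of_not_le hf (by linarith) hd
      exact ⟨z, w', hz, hw', hzw'.mono fun v hv => ⟨hv.1.1, hv.1.2, hv.2⟩, Or.inr hPz⟩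
  · obtain ⟨z, hz, hwz, hzP⟩ := hPw.symm.exists_of_not_ge hf (by linarith) hc
    exact ⟨z, w, hz, hw, hwz.symm.mono fun v hv => ⟨hv.1.1, hv.2, hv.1.2⟩, Or.inl hzP.symm⟩

section Crossing

variable {A : Set Plane} {N h : ℕ} {y : ℤ} {p q : Plane}

lemma Regular.drift_lt (hA : Regular A N) (h1 : 20 ≤ h) (h2 : h ≤ N) (hp : p.2 = y)
    (hq : q.2 = y + h) (hpq : JoinedIn (slab A y h) p q) :
    (⌊p.1⌋ : ℝ) - 1 < q.1 ∧ q.1 < ⌊p.1⌋ + 2 := by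
  have := hA ⌊p.1⌋ y h h1 h2
  constructor
  · by_contra! hc
    exact this (Or.inr (Or.inl ⟨p, q, Int.floor_le _, (Int.lt_floor_add_one _).le, hp, hq, hc,
      hpq⟩))
  · by_contra! hc
    exact this (Or.inl ⟨p, q, Int.floor_le _, (Int.lt_floor_add_one _).le, hp, hq, hc, hpq⟩)

lemma Regular.exists_right (hA : Regular A N) (h1 : 20 ≤ h) (h2 : h ≤ N) (hp : p.2 = y)
    (hq : q.2 = y + h) (hpq : JoinedIn (slab A y h) p q) :
    ∃ z : Plane, z.1 = ⌊p.1⌋ + halfWidth h ∧ JoinedIn (slab A y h) p z := by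
  have hb : (1 : ℝ) ≤ halfWidth h := by
    have : 1 ≤ halfWidth h := by unfold halfWidth; omega
    exact_mod_cast this
  have := hA ⌊p.1⌋ y h h1 h2
  obtain ⟨z, hz, hpz, -⟩ := hpq.exists_of_not_le (f := Prod.fst) (c := ⌊p.1⌋ + halfWidth h)
    continuous_fst (by linarith [Int.lt_floor_add_one p.1]) (fun hc =>
      this (Or.inr (Or.inr (Or.inr (Or.inl ⟨p, q, Int.floor_le _, (Int.lt_floor_add_one _).le, hp,
        hq, hc⟩)))))
  exact ⟨z, hz, hpz.mono inter_subset_left⟩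

lemma Regular.exists_left (hA : Regular A N) (h1 : 20 ≤ h) (h2 : h ≤ N) (hp : p.2 = y)
    (hq : q.2 = y + h) (hpq : JoinedIn (slab A y h) p q) :
    ∃ z : Plane, z.1 = ⌊p.1⌋ + 1 - halfWidth h ∧ JoinedIn (slab A y h) p z := by
  have hb : (1 : ℝ) ≤ halfWidth h := by
    have : 1 ≤ halfWidth h := by unfold halfWidth; omega
    exact_mod_cast this
  have := hA ⌊p.1⌋ y h h1 h2
  obtain ⟨z, hz, hpz, -⟩ := hpq.exists_of_not_ge (f := Prod.fst) (c := ⌊p.1⌋ + 1 - halfWidth h)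
    continuous_fst (by linarith [Int.floor_le p.1]) (fun hc =>
      this (Or.inr (Or.inr (Or.inr (Or.inr (Or.inl ⟨p, q, Int.floor_le _,
        (Int.lt_floor_add_one _).le, hp, hq, hc⟩))))))
  exact ⟨z, hz, hpz.mono inter_subset_left⟩

/-- In a regular set, a crossing of a strip contains two passes in the perpendicular direction
that are not joined between the two levels. -/
lemma Regular.exists_separated_passes (hA : Regular A N) (h1 : 50 ≤ h) (h2 : h ≤ N)
    (hp : p.2 = y) (hq : q.2 = y + h) (hpq : JoinedIn (slab A y h) p q) {Y Y' : ℝ}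
    (hY : Y = ⌊p.1⌋ + 5 - halfWidth h) (hY' : Y' = ⌊p.1⌋ + halfWidth h - 5) :
    ∃ z w z' w' : Plane, z.1 = Y ∧ w.1 = Y' ∧ z'.1 = Y ∧ w'.1 = Y' ∧
      JoinedIn (slab A y h ∩ {v | Y ≤ v.1 ∧ v.1 ≤ Y'}) z w ∧
      JoinedIn (slab A y h ∩ {v | Y ≤ v.1 ∧ v.1 ≤ Y'}) z' w' ∧
      JoinedIn (slab A y h) p z ∧ JoinedIn (slab A y h) p z' ∧
      ¬ JoinedIn (slab A y h ∩ {v | Y ≤ v.1 ∧ v.1 ≤ Y'}) z z' := by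
  have hb : (20 : ℝ) ≤ halfWidth h := by
    have : 20 ≤ halfWidth h := by unfold halfWidth; omega
    exact_mod_cast this
  have hf1 := Int.floor_le p.1
  have hf2 := Int.lt_floor_add_one p.1
  have hex := hA ⌊p.1⌋ y h (by omega) h2
  have hdr := hA.drift_lt (by omega) h2 hp hq hpq
  have n1 : ¬ JoinedIn (slab A y h ∩ {v | v.1 ≤ Y'}) p q := fun hc =>
    hex (Or.inr (Or.inr (Or.inr (Or.inl ⟨p, q, hf1, hf2.le, hp, hq, hc.mono fun v hv =>
      ⟨hv.1, by have := hv.2; rw [mem_ofPred_eq] at this ⊢; linarith⟩⟩))))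
  have n2 : ¬ JoinedIn (slab A y h ∩ {v | Y ≤ v.1}) p q := fun hc =>
    hex (Or.inr (Or.inr (Or.inr (Or.inr (Or.inl ⟨p, q, hf1, hf2.le, hp, hq, hc.mono fun v hv =>
      ⟨hv.1, by have := hv.2; rw [mem_ofPred_eq] at this ⊢; linarith⟩⟩)))))
  have n3 : ∀ w, JoinedIn (slab A y h ∩ {v | v.1 ≤ Y'}) p w →
      ¬ JoinedIn (slab A y h ∩ {v | Y ≤ v.1}) w q := fun w hc hd =>
    hex (Or.inr (Or.inr (Or.inr (Or.inr (Or.inr (Or.inl ⟨p, w, q, hf1, hf2.le, hp, hq,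
      hc.mono fun v hv => ⟨hv.1, by have := hv.2; rw [mem_ofPred_eq] at this ⊢; linarith⟩,
      hd.mono fun v hv => ⟨hv.1, by have := hv.2; rw [mem_ofPred_eq] at this ⊢; linarith⟩⟩))))))
  have n4 : ∀ w, JoinedIn (slab A y h ∩ {v | Y ≤ v.1}) p w →
      ¬ JoinedIn (slab A y h ∩ {v | v.1 ≤ Y'}) w q := fun w hc hd =>
    hex (Or.inr (Or.inr (Or.inr (Or.inr (Or.inr (Or.inr ⟨p, w, q, hf1, hf2.le, hp, hq,
      hc.mono fun v hv => ⟨hv.1, by have := hv.2; rw [mem_ofPred_eq] at this ⊢; linarith⟩,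
      hd.mono fun v hv => ⟨hv.1, by have := hv.2; rw [mem_ofPred_eq] at this ⊢; linarith⟩⟩))))))
  obtain ⟨z, w, hz, hw, hzw, hpz⟩ := exists_first_pass hpq continuous_fst
    (by linarith : Y ≤ Y') (by linarith) (by linarith) n1 n2
  -- The second pass is the first one of the reversed curve. If the two passes were joined in the
  -- band, `p` and `q` would be connected in one of the four ways excluded by `n1`, `n2`, `n3`,
  -- `n4`.
  obtain ⟨z', w', hz', hw', hzw', hqz'⟩ := exists_first_pass hpq.symm continuous_fst
    (by linarith : Y ≤ Y') (by linarith) (by linarith) (fun hc => n1 hc.symm)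
    (fun hc => n2 hc.symm)
  have pz : JoinedIn (slab A y h) p z := by
    rcases hpz with hc | hc <;> exact hc.mono inter_subset_left
  have qz : JoinedIn (slab A y h) q z' := by
    rcases hqz' with hc | hc <;> exact hc.mono inter_subset_left
  refine ⟨z, w, z', w', hz, hw, hz', hw', hzw, hzw', pz, hpq.trans qz, fun hc => ?_⟩
  have c1 : JoinedIn (slab A y h ∩ {v | v.1 ≤ Y'}) z z' := hc.mono fun v hv => ⟨hv.1, hv.2.2⟩
  have c2 : JoinedIn (slab A y h ∩ {v | Y ≤ v.1}) z z' := hc.mono fun v hv => ⟨hv.1, hv.2.1⟩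
  rcases hpz with hz | hz <;> rcases hqz' with hz' | hz'
  · exact n1 (hz.trans (c1.trans hz'.symm))
  · exact n3 _ hz (c2.trans hz'.symm)
  · exact n4 _ hz (c1.trans hz'.symm)
  · exact n2 (hz.trans (c2.trans hz'.symm))

end Crossing

end Strips

section Strips

open Set

/-! ### Doubling of crossings in regular sets -/

section Doubling

variable {A : Set Plane} {N : ℕ}

/-- The first bound is what `drift_or_long_of_stays` requires; the second says that the rounding
loses at most one. -/
lemma two_mul_halfWidth {h : ℕ} (hh : 4 ≤ h) :
    2 * (halfWidth h : ℤ) + 3 ≤ h ∧ (h : ℤ) ≤ 2 * halfWidth h + 4 := by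
  unfold halfWidth; omega

/-- A curve in a strip between two distant vertical lines contains a long crossing. -/
lemma longCrossing_of_joinedIn {x y h : ℝ} {s t : Plane} (hst : JoinedIn (slab A y h) s t)
    (hs : s.1 ≤ x) (ht : x + h + 1 ≤ t.1) (hh : 0 ≤ h) : LongCrossing A x y h := by
  obtain ⟨t', ht', hst', -⟩ := hst.exists_first continuous_fst (c := x + h + 1) (by linarith) ht
  obtain ⟨s', hs', -, hst''⟩ := hst'.exists_last continuous_fst (c := x) hs (by linarith)
  exact ⟨s', t', hs', ht', hst''.mono fun v hv => ⟨hv.1.1, hv.2, hv.1.2⟩⟩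

/-- A crossing of a strip contains a crossing of any smaller strip, close to its middle. -/
lemma Regular.exists_inner_crossing (hA : Regular A N) {Y y : ℤ} {k h : ℕ} (hk : 20 ≤ k)
    (hkN : k ≤ N) {z w : Plane} (hz : z.2 = Y) (hw : w.2 = Y + k)
    (hzw : JoinedIn (slab A Y k) z w) (hh : 20 ≤ h) (hYy : Y ≤ y) (hyY : y + h ≤ Y + k) {c d : ℤ}
    (hA' : ∀ v ∈ A, (c : ℝ) ≤ v.1 ∧ v.1 ≤ d) :
    ∃ p q : Plane, p.2 = y ∧ q.2 = y + h ∧ JoinedIn (slab A y h) p q ∧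
      JoinedIn (slab A Y k) z p ∧ c + halfWidth k - 3 ≤ ⌊p.1⌋ ∧ ⌊p.1⌋ ≤ d - halfWidth k + 2 := by
  have hYy' : (Y : ℝ) ≤ y := by exact_mod_cast hYy
  have hyY' : (y : ℝ) + h ≤ Y + k := by exact_mod_cast hyY
  have hh0 : (0 : ℝ) ≤ h := Nat.cast_nonneg _
  obtain ⟨q, hq, hzq, -⟩ := hzw.exists_first continuous_snd (c := y + h)
    (by rw [hz]; linarith) (by rw [hw]; linarith)
  obtain ⟨p, hp, hzp, hpq⟩ := hzq.exists_last continuous_snd (c := y)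
    (by rw [hz]; linarith) (by rw [hq]; linarith)
  have hpq' : JoinedIn (slab A y h) p q := hpq.mono fun v hv => ⟨hv.1.1.1, hv.2, hv.1.2⟩
  have hd1 := hA.drift_lt hh (by omega) hp hq hpq'
  -- The strips from `y` and from `Y` to `y + h` have crossings with the same end `q`, starting at
  -- `p` and `z`. Neither drifts, so `p` is nearly above `z`, and `z` is far from both vertical
  -- lines because its crossing reaches far to both sides without leaving `A`.
  obtain ⟨m, hm⟩ : ∃ m : ℕ, (m : ℤ) = y + h - Y := ⟨(y + h - Y).toNat, by omega⟩
  have hm' : (m : ℝ) = y + h - Y := by exact_mod_cast hm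
  have hd2 := hA.drift_lt (h := m) (y := Y) (p := z) (q := q) (by omega) (by omega) hz
    (by rw [hq, hm']; ring) (hzq.mono fun v hv => ⟨hv.1.1, hv.1.2.1, by
      have := hv.2; rw [mem_ofPred_eq] at this; linarith⟩)
  obtain ⟨r, hr, hzr⟩ := hA.exists_right hk hkN hz hw hzw
  obtain ⟨l, hl, hzl⟩ := hA.exists_left hk hkN hz hw hzw
  have hr' := (hA' r hzr.target_mem.1).2
  have hl' := (hA' l hzl.target_mem.1).1
  rw [hr] at hr'
  rw [hl] at hl'
  have hr2 : ⌊z.1⌋ + halfWidth k ≤ d := by exact_mod_cast hr'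
  have hl2 : c ≤ ⌊z.1⌋ + 1 - halfWidth k := by exact_mod_cast hl'
  have e1 : ⌊p.1⌋ - 1 < ⌊z.1⌋ + 2 := by
    have : (⌊p.1⌋ : ℝ) - 1 < ⌊z.1⌋ + 2 := by linarith [hd1.1, hd2.2]
    exact_mod_cast this
  have e2 : ⌊z.1⌋ - 1 < ⌊p.1⌋ + 2 := by
    have : (⌊z.1⌋ : ℝ) - 1 < ⌊p.1⌋ + 2 := by linarith [hd1.2, hd2.1]
    exact_mod_cast this
  exact ⟨p, q, hp, hq, hpq', hzp.mono inter_subset_left, by omega, by omega⟩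

/-- In a regular set, each crossing of a strip contains two separated crossings of a slightly
thinner strip. -/
lemma Regular.exists_two_crossings (hA : Regular A N) (hA' : Regular (Prod.swap ⁻¹' A) N) {y : ℤ}
    {h : ℕ} (h1 : 100 ≤ h) (h2 : h + 36 ≤ N) {p q : Plane} (hp : p.2 = y)
    (hq : q.2 = y + (h + 36 : ℕ)) (hpq : JoinedIn (slab A y (h + 36 : ℕ)) p q) :
    ∃ p₁ q₁ p₂ q₂ : Plane, p₁.2 = (y + 18 : ℤ) ∧ q₁.2 = (y + 18 : ℤ) + h ∧
      p₂.2 = (y + 18 : ℤ) ∧ q₂.2 = (y + 18 : ℤ) + h ∧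
      JoinedIn (slab A (y + 18 : ℤ) h) p₁ q₁ ∧ JoinedIn (slab A (y + 18 : ℤ) h) p₂ q₂ ∧
      JoinedIn (slab A y (h + 36 : ℕ)) p p₁ ∧ JoinedIn (slab A y (h + 36 : ℕ)) p p₂ ∧
      ¬ JoinedIn (slab A (y + 18 : ℤ) h) p₁ p₂ := by
  -- The successive roundings and margins below leave a band of height `k ≥ H - 19 = h + 17`. The
  -- rest of the 36 units keeps the new crossings far enough from the vertical lines for the final
  -- long-crossing argument.
  set H : ℕ := h + 36 with hH
  set x : ℤ := ⌊p.1⌋ with hx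
  set b : ℕ := halfWidth H with hb
  have hb2 := two_mul_halfWidth (h := H) (by omega)
  rw [← hb] at hb2
  -- a horizontal pass
  obtain ⟨zr, hzr, hpzr⟩ := hA.exists_right (by omega) h2 hp hq hpq
  obtain ⟨zl, hzl, hpzl⟩ := hA.exists_left (by omega) h2 hp hq hpq
  rw [← hx, ← hb] at hzr hzl
  obtain ⟨Q, hQ, hzQ, -⟩ := (hpzl.symm.trans hpzr).exists_first continuous_fst (c := x + b)
    (by
      rw [hzl]
      have : (x : ℤ) + 1 - b ≤ x + b := by omega
      exact_mod_cast this) hzr.ge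
  obtain ⟨P, hP, hzP, hPQ⟩ := hzQ.exists_last continuous_fst (c := x + 1 - b) hzl.le
    (by
      rw [hQ]
      have : (x : ℤ) + 1 - b ≤ x + b := by omega
      exact_mod_cast this)
  have hpP : JoinedIn (slab A y H) p P := hpzl.trans (hzP.mono inter_subset_left)
  set B : Set Plane := slab A y H ∩ {v | ((x + 1 - b : ℤ) : ℝ) ≤ v.1 ∧ v.1 ≤ ((x + b : ℤ) : ℝ)}
    with hB
  have hBA : B ⊆ A := fun v hv => hv.1.1
  have hPQB : JoinedIn B P Q := hPQ.mono fun v hv => ⟨hv.1.1, by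
    push_cast; exact ⟨hv.2, hv.1.2⟩⟩
  -- Transposing makes the horizontal pass a crossing of a strip of height `k₁`, to which the
  -- regularity of the transposed set applies.
  set E : Set Plane := Prod.swap ⁻¹' (slab A y H) with hE
  have hEreg : Regular E N := hA'.mono (preimage_mono (slab_subset _ _ _))
  obtain ⟨k₁, hk₁⟩ : ∃ k₁ : ℕ, (k₁ : ℤ) = 2 * b - 1 := ⟨2 * b - 1, by omega⟩
  have hk₁' : (k₁ : ℝ) = 2 * b - 1 := by exact_mod_cast hk₁
  have hPQE : JoinedIn (slab E (x + 1 - b : ℤ) k₁) P.swap Q.swap :=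
    hPQB.mapsTo continuous_swap (by
      rintro v ⟨hv1, hv2, hv3⟩
      refine ⟨by simpa [hE] using hv1, hv2, ?_⟩
      push_cast at hv3 ⊢
      simp only [Prod.snd_swap, hk₁']
      linarith)
  have hPE : P.swap.2 = (x + 1 - b : ℤ) := by simp [hP]
  have hQE : Q.swap.2 = (x + 1 - b : ℤ) + k₁ := by
    simp only [Prod.snd_swap, hQ, hk₁']; push_cast; ring
  set l : ℤ := ⌊P.2⌋ with hl
  set b₁ : ℕ := halfWidth k₁ with hb₁
  have hb₁2 := two_mul_halfWidth (h := k₁) (by omega)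
  rw [← hb₁] at hb₁2
  -- the pass is close to the middle of the strip
  have hl1 : l + b₁ ≤ y + H := by
    obtain ⟨r, hr, hPr⟩ := hEreg.exists_right (by omega) (by omega) hPE hQE hPQE
    have := hPr.target_mem.1.2.2
    simp only [Prod.snd_swap, hr] at this
    exact_mod_cast this
  have hl2 : y ≤ l + 1 - b₁ := by
    obtain ⟨r, hr, hPr⟩ := hEreg.exists_left (by omega) (by omega) hPE hQE hPQE
    have := hPr.target_mem.1.2.1
    simp only [Prod.snd_swap, hr] at this
    exact_mod_cast this
  set Y : ℤ := l + 5 - b₁ with hY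
  obtain ⟨k, hk⟩ : ∃ k : ℕ, (k : ℤ) = 2 * b₁ - 10 := ⟨2 * b₁ - 10, by omega⟩
  have hk' : (k : ℝ) = 2 * b₁ - 10 := by exact_mod_cast hk
  have hbk := two_mul_halfWidth (h := k) (by omega)
  obtain ⟨z, w, z', w', hz, hw, hz', hw', hzw, hzw', hPz, hPz', hsep⟩ :=
    hEreg.exists_separated_passes (by omega) (by omega) hPE hQE hPQE (Y := Y) (Y' := Y + k)
      (by simp [hY, hl, hb₁]) (by simp only [hY, hl, hb₁, hk', Prod.fst_swap]; push_cast; ring)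
  have hband : ∀ v ∈ slab E (x + 1 - b : ℤ) k₁ ∩ {v | (Y : ℝ) ≤ v.1 ∧ v.1 ≤ Y + k},
      v.swap ∈ slab B Y k := by
    rintro v ⟨⟨hv1, hv2, hv3⟩, hv4⟩
    refine ⟨⟨hv1, hv2, ?_⟩, hv4⟩
    push_cast at hv3 ⊢
    simp only [Prod.fst_swap]
    linarith
  have hEA : ∀ v ∈ slab E (x + 1 - b : ℤ) k₁, v.swap ∈ slab A y H := fun v hv => hv.1
  have hzwB := joinedIn_of_swap_preimage hzw hband
  have hzwB' := joinedIn_of_swap_preimage hzw' hband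
  have hPzA : JoinedIn (slab A y H) P z.swap := joinedIn_of_swap_preimage hPz hEA
  have hPzA' : JoinedIn (slab A y H) P z'.swap := joinedIn_of_swap_preimage hPz' hEA
  have hsepB : ¬ JoinedIn (slab B Y k) z.swap z'.swap := fun hc => hsep (by
    have := hc.mapsTo (B := slab E (x + 1 - b : ℤ) k₁ ∩ {v | (Y : ℝ) ≤ v.1 ∧ v.1 ≤ Y + k})
      continuous_swap (by
        rintro v ⟨⟨hv1, hv2, hv3⟩, hv4⟩
        refine ⟨⟨by simpa [hE] using hv1, hv2, ?_⟩, hv4⟩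
        push_cast at hv3 ⊢
        simp only [Prod.snd_swap, hk₁']
        linarith)
    simpa using this)
  have hBreg : Regular B N := hA.mono hBA
  obtain ⟨p₁, q₁, hp₁, hq₁, hpq₁, hzp₁, hc₁, hd₁⟩ := hBreg.exists_inner_crossing (by omega)
    (by omega) (by simpa using hz) (by simpa using hw) hzwB (by omega : 20 ≤ h) (y := y + 18)
    (by omega) (by omega) (c := x + 1 - b) (d := x + b) (fun v hv => hv.2)
  obtain ⟨p₂, q₂, hp₂, hq₂, hpq₂, hzp₂, -, -⟩ := hBreg.exists_inner_crossing (by omega)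
    (by omega) (by simpa using hz') (by simpa using hw') hzwB' (by omega : 20 ≤ h) (y := y + 18)
    (by omega) (by omega) (c := x + 1 - b) (d := x + b) (fun v hv => hv.2)
  have hslab : slab B Y k ⊆ slab A y H := fun v hv => hv.1.1
  have hpqA : JoinedIn (slab A (y + 18 : ℤ) h) p₁ q₁ := hpq₁.mono (slab_mono hBA _ _)
  refine ⟨p₁, q₁, p₂, q₂, hp₁, hq₁, hp₂, hq₂, hpqA, hpq₂.mono (slab_mono hBA _ _),
    hpP.trans (hPzA.trans (hzp₁.mono hslab)), hpP.trans (hPzA'.trans (hzp₂.mono hslab)),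
    fun hc => ?_⟩
  -- the new crossings stay between the two vertical lines
  have hp₁B := hpq₁.source_mem.1.2
  have hbh := two_mul_halfWidth (h := h) (by omega)
  have hh0 : (0 : ℝ) ≤ h := Nat.cast_nonneg _
  by_cases hr : JoinedIn (slab A (y + 18 : ℤ) h ∩ {v | v.1 ≤ ((x + b : ℤ) : ℝ)}) p₁ p₂
  · by_cases hl : JoinedIn (slab A (y + 18 : ℤ) h ∩ {v | v.1 ≤ ((x + b : ℤ) : ℝ)} ∩
        {v | ((x + 1 - b : ℤ) : ℝ) ≤ v.1}) p₁ p₂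
    · refine hsepB (hzp₁.trans ((hl.mono ?_).trans hzp₂.symm))
      rintro v ⟨⟨⟨hv1, hv2, hv3⟩, hv4⟩, hv5⟩
      have e1 : (y : ℝ) ≤ (y + 18 : ℤ) := by push_cast; linarith
      have e2 : ((y + 18 : ℤ) : ℝ) + h ≤ y + H := by push_cast [hH]; linarith
      have e3 : (Y : ℝ) ≤ (y + 18 : ℤ) := by
        have : Y ≤ y + 18 := by omega
        exact_mod_cast this
      have e4 : ((y + 18 : ℤ) : ℝ) + h ≤ Y + k := by
        have : y + 18 + (h : ℤ) ≤ Y + k := by omega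
        exact_mod_cast this
      exact ⟨⟨⟨hv1, e1.trans hv2, hv3.trans e2⟩, hv5, hv4⟩, e3.trans hv2, hv3.trans e4⟩
    -- A connection that leaves through one vertical line, continued through `p₁` to the opposite
    -- far side of its own crossing, spans at least `h + 1` horizontally: a forbidden long crossing.
    -- The other line is treated in the same way below.
    · obtain ⟨s, hs, hps, -⟩ := hr.exists_of_not_ge continuous_fst hp₁B.1 hl
      obtain ⟨t, ht, hpt⟩ := hA.exists_right (by omega) (by omega) hp₁ hq₁ hpqA
      refine hA (x + 1 - b) (y + 18) h (by omega) (by omega) (Or.inr (Or.inr (Or.inl ?_)))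
      refine longCrossing_of_joinedIn ((hps.symm.mono fun v hv => hv.1.1).trans hpt) hs.le ?_ hh0
      rw [ht]
      have : x + 1 - (b : ℤ) + h + 1 ≤ ⌊p₁.1⌋ + halfWidth h := by omega
      exact_mod_cast this
  · obtain ⟨t, ht, hpt, -⟩ := hc.exists_of_not_le continuous_fst hp₁B.2 hr
    obtain ⟨s, hs, hps⟩ := hA.exists_left (by omega) (by omega) hp₁ hq₁ hpqA
    refine hA (⌊p₁.1⌋ + 1 - halfWidth h) (y + 18) h (by omega) (by omega)
      (Or.inr (Or.inr (Or.inl ?_)))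
    refine longCrossing_of_joinedIn (hps.symm.trans (hpt.mono inter_subset_left))
      (by rw [hs]; push_cast; exact le_rfl) ?_ hh0
    rw [ht]
    have : ⌊p₁.1⌋ + 1 - (halfWidth h : ℤ) + h + 1 ≤ x + b := by omega
    exact_mod_cast this

/-- In a regular set, a crossing of a strip contains exponentially many separated crossings of
thinner strips. -/
lemma Regular.exists_separated_crossings (hA : Regular A N) (hA' : Regular (Prod.swap ⁻¹' A) N)
    {y : ℤ} (i : ℕ) : ∀ {h : ℕ}, 100 ≤ h → h + 36 * i ≤ N →
    (∃ p q : Plane, p.2 = y ∧ q.2 = y + (h + 36 * i : ℕ) ∧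
      JoinedIn (slab A y (h + 36 * i : ℕ)) p q) →
    ∃ (ι : Type) (p q : ι → Plane), Nat.card ι = 2 ^ i ∧
      (∀ j, (p j).2 = (y + 18 * i : ℤ) ∧ (q j).2 = (y + 18 * i : ℤ) + h ∧
        JoinedIn (slab A (y + 18 * i : ℤ) h) (p j) (q j)) ∧
      ∀ j j', j ≠ j' → ¬ JoinedIn (slab A (y + 18 * i : ℤ) h) (p j) (p j') := by
  induction i with
  | zero =>
    rintro h - - ⟨p, q, hp, hq, hpq⟩
    exact ⟨Unit, fun _ => p, fun _ => q, by simp, fun _ => ⟨by simpa using hp, by simpa using hq,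
      by simpa using hpq⟩, fun j j' hj => absurd rfl hj⟩
  | succ i ih =>
    rintro h h1 h2 hex
    obtain ⟨ι, p, q, hι, hpq, hsep⟩ := ih (h := h + 36) (by omega) (by omega)
      (by rwa [show h + 36 + 36 * i = h + 36 * (i + 1) by ring])
    choose p₁ q₁ p₂ q₂ hp₁ hq₁ hp₂ hq₂ hj₁ hj₂ hpp₁ hpp₂ hn using fun j =>
      hA.exists_two_crossings hA' h1 (by omega) (hpq j).1 (hpq j).2.1 (hpq j).2.2
    have e : (y + 18 * i + 18 : ℤ) = y + 18 * (i + 1 : ℕ) := by push_cast; ring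
    rw [e] at hp₁ hq₁ hp₂ hq₂ hj₁ hj₂ hn
    have hsub : slab A (y + 18 * (i + 1 : ℕ) : ℤ) h ⊆ slab A (y + 18 * i : ℤ) (h + 36 : ℕ) := by
      rintro v ⟨hv1, hv2, hv3⟩
      push_cast at hv2 hv3
      refine ⟨hv1, ?_, ?_⟩ <;> push_cast <;> linarith
    refine ⟨ι × Bool, fun j => if j.2 then p₁ j.1 else p₂ j.1,
      fun j => if j.2 then q₁ j.1 else q₂ j.1, by simp [hι, pow_succ], ?_, ?_⟩
    · rintro ⟨j, _ | _⟩
      · exact ⟨hp₂ j, hq₂ j, hj₂ j⟩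
      · exact ⟨hp₁ j, hq₁ j, hj₁ j⟩
    · rintro ⟨j, s⟩ ⟨j', s'⟩ hne hc
      by_cases hjj : j = j'
      · subst hjj
        rcases s with _ | _ <;> rcases s' with _ | _
        · exact hne rfl
        · exact hn j hc.symm
        · exact hn j hc
        · exact hne rfl
      · refine hsep j j' hjj ?_
        -- Descendants stay joined to their parents in the thicker strip, so a link between
        -- descendants of different parents would join the parents.
        have hs : ∀ (s : Bool) j, JoinedIn (slab A (y + 18 * i : ℤ) (h + 36 : ℕ)) (p j)
            (if s then p₁ j else p₂ j) := by
          rintro (_ | _) j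
          · exact hpp₂ j
          · exact hpp₁ j
        exact (hs s j).trans ((hc.mono hsub).trans (hs s' j').symm)

end Doubling

end Strips

/-! ### Components of a graph after adding an edge -/

section GraphComponents

open SimpleGraph

variable {V : Type*} {G : SimpleGraph V} {u v x y : V}

/-- Repeated uses of the new edge cancel, so a walk needs it at most once. -/
lemma reachable_sup_edge (h : (G ⊔ edge u v).Reachable x y) :
    G.Reachable x y ∨ (G.Reachable x u ∧ G.Reachable v y) ∨
      (G.Reachable x v ∧ G.Reachable u y) := by
  obtain ⟨w⟩ := h
  induction w with
  | nil => exact Or.inl (Reachable.refl _)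
  | cons hadj _ ih =>
    rw [sup_adj, edge_adj] at hadj
    rcases hadj with hG | ⟨⟨rfl, rfl⟩ | ⟨rfl, rfl⟩, -⟩
    · rcases ih with h | ⟨h1, h2⟩ | ⟨h1, h2⟩
      · exact Or.inl (hG.reachable.trans h)
      · exact Or.inr (Or.inl ⟨hG.reachable.trans h1, h2⟩)
      · exact Or.inr (Or.inr ⟨hG.reachable.trans h1, h2⟩)
    · rcases ih with h | ⟨h1, h2⟩ | ⟨h1, h2⟩
      · exact Or.inr (Or.inl ⟨Reachable.refl _, h⟩)
      · exact Or.inr (Or.inl ⟨Reachable.refl _, h2⟩)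
      · exact Or.inl h2
    · rcases ih with h | ⟨h1, h2⟩ | ⟨h1, h2⟩
      · exact Or.inr (Or.inr ⟨Reachable.refl _, h⟩)
      · exact Or.inl h2
      · exact Or.inr (Or.inr ⟨Reachable.refl _, h2⟩)

lemma card_connectedComponent_sup_edge_of_reachable (h : G.Reachable u v) :
    Nat.card (G ⊔ edge u v).ConnectedComponent = Nat.card G.ConnectedComponent := by
  have : (G ⊔ edge u v).Reachable = G.Reachable := by
    funext x y
    refine propext ⟨fun hr => ?_, fun hr => hr.mono le_sup_left⟩
    rcases reachable_sup_edge hr with h' | ⟨h1, h2⟩ | ⟨h1, h2⟩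
    · exact h'
    · exact h1.trans (h.trans h2)
    · exact h1.trans (h.symm.trans h2)
  unfold ConnectedComponent
  rw [this]

/-- The old components other than that of `v` correspond bijectively to the new ones. -/
lemma card_connectedComponent_sup_edge_of_not_reachable [Finite V] (h : ¬ G.Reachable u v) :
    Nat.card (G ⊔ edge u v).ConnectedComponent + 1 = Nat.card G.ConnectedComponent := by
  classical
  have huv : u ≠ v := fun e => h (e ▸ Reachable.refl _)
  have hadj : (G ⊔ edge u v).Reachable u v := Adj.reachable (by
    rw [sup_adj, edge_adj]; exact Or.inr ⟨Or.inl ⟨rfl, rfl⟩, huv⟩)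
  let f : {c : G.ConnectedComponent // c ≠ G.connectedComponentMk v} →
      (G ⊔ edge u v).ConnectedComponent := fun c => c.1.map (Hom.ofLE le_sup_left)
  have hf : Function.Bijective f := by
    constructor
    · rintro ⟨c, hc⟩ ⟨c', hc'⟩ hcc
      induction c using ConnectedComponent.ind with | _ x => ?_
      induction c' using ConnectedComponent.ind with | _ y => ?_
      have hxy : (G ⊔ edge u v).Reachable x y := ConnectedComponent.exact hcc
      rcases reachable_sup_edge hxy with h' | ⟨h1, h2⟩ | ⟨h1, h2⟩
      · exact Subtype.ext (ConnectedComponent.sound h')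
      · exact absurd (ConnectedComponent.sound h2.symm) hc'
      · exact absurd (ConnectedComponent.sound h1) hc
    · intro c
      induction c using ConnectedComponent.ind with | _ x => ?_
      by_cases hx : G.Reachable x v
      · exact ⟨⟨G.connectedComponentMk u, fun e => h (ConnectedComponent.exact e)⟩,
          ConnectedComponent.sound (hadj.trans (hx.mono le_sup_left).symm)⟩
      · exact ⟨⟨G.connectedComponentMk x, fun e => hx (ConnectedComponent.exact e)⟩, rfl⟩
  rw [← Nat.card_congr (Equiv.ofBijective f hf),
    ← Nat.card_congr (Equiv.optionSubtypeNe (G.connectedComponentMk v)), Finite.card_option]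

end GraphComponents

/-! ### Random-cluster weights and the FKG lattice condition -/

namespace PlanarLattice

open SimpleGraph

variable (L : PlanarLattice)

/-- The graph of the open edges outside `S`. -/
def openGraph (S : Set L.Edge) (ω : L.Config) : SimpleGraph Plane :=
  SimpleGraph.fromEdgeSet
    {e : Sym2 Plane | ∃ h : e ∈ L.graph.edgeSet, (⟨e, h⟩ : L.Edge) ∉ S ∧ ω ⟨e, h⟩ = true}

variable {L}

lemma openGraph_adj {S : Set L.Edge} {ω : L.Config} {x y : Plane} :
    (L.openGraph S ω).Adj x y ↔
      ∃ h : L.graph.Adj x y, (⟨s(x, y), h⟩ : L.Edge) ∉ S ∧ ω ⟨s(x, y), h⟩ = true := by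
  rw [openGraph, fromEdgeSet_adj]
  constructor
  · rintro ⟨⟨h, h'⟩, -⟩
    exact ⟨h, h'⟩
  · rintro ⟨h, h'⟩
    exact ⟨⟨h, h'⟩, h.ne⟩

lemma inducedBC_r_iff {F : Finset L.Edge} {ω : L.Config} {a b : L.boundary F} :
    (L.inducedBC F ω).r a b ↔ (L.openGraph F ω).Reachable a b := Iff.rfl

lemma exists_edge_of_reachable {S : Set L.Edge} {ω : L.Config} {x y : Plane}
    (h : (L.openGraph S ω).Reachable x y) (hne : x ≠ y) :
    ∃ e : L.Edge, e ∉ S ∧ x ∈ (e : Sym2 Plane) := by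
  obtain ⟨w⟩ := h
  cases w with
  | nil => exact absurd rfl hne
  | cons hadj _ =>
    obtain ⟨h, h1, -⟩ := openGraph_adj.1 hadj
    exact ⟨_, h1, Sym2.mem_mk_left _ _⟩

lemma mem_verts_left {F : Finset L.Edge} {x y : Plane} {h : s(x, y) ∈ L.graph.edgeSet}
    (he : (⟨s(x, y), h⟩ : L.Edge) ∈ F) : x ∈ L.verts F := ⟨_, he, Sym2.mem_mk_left _ _⟩

lemma mem_verts_right {F : Finset L.Edge} {x y : Plane} {h : s(x, y) ∈ L.graph.edgeSet}
    (he : (⟨s(x, y), h⟩ : L.Edge) ∈ F) : y ∈ L.verts F := ⟨_, he, Sym2.mem_mk_right _ _⟩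

/-- Distinct end-points of an open path outside `F` are boundary vertices, and the induced boundary
condition wires them. -/
lemma wiredGraph_reachable_of_reachable {F : Finset L.Edge} {ω : L.Config} {η : F → Bool}
    {x y : L.verts F} (h : (L.openGraph F ω).Reachable x y) :
    (L.wiredGraph F (L.inducedBC F ω) η).Reachable x y := by
  by_cases hne : (x : Plane) = y
  · rw [Subtype.ext hne]
  · have hx : (x : Plane) ∈ L.boundary F := ⟨x.2, exists_edge_of_reachable h hne⟩
    have hy : (y : Plane) ∈ L.boundary F := ⟨y.2, exists_edge_of_reachable h.symm (Ne.symm hne)⟩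
    refine Adj.reachable ?_
    rw [wiredGraph, fromRel_adj]
    exact ⟨fun e => hne (congrArg _ e), Or.inl (Or.inr ⟨hx, hy, h⟩)⟩

/-- Connections in the wired configuration are the connections in the whole lattice. -/
lemma wiredGraph_reachable_iff {F : Finset L.Edge} {ω : L.Config} {x y : L.verts F} :
    (L.wiredGraph F (L.inducedBC F ω) (fun e => ω e)).Reachable x y ↔
      (L.openGraph ∅ ω).Reachable x y := by
  constructor
  · rintro ⟨w⟩
    induction w with
    | nil => exact Reachable.refl _
    | @cons a b c hadj _ ih =>
      refine Reachable.trans ?_ ih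
      have key : ∀ a b : L.verts F, ((∃ e : F, ω e = true ∧
          ((e : L.Edge) : Sym2 Plane) = s((a : Plane), (b : Plane))) ∨
          ∃ (hx : (a : Plane) ∈ L.boundary F) (hy : (b : Plane) ∈ L.boundary F),
            (L.inducedBC F ω).r ⟨a, hx⟩ ⟨b, hy⟩) → (L.openGraph ∅ ω).Reachable a b := by
        rintro a b (⟨⟨⟨e, he⟩, hF⟩, ho, hab⟩ | ⟨hx, hy, hr⟩)
        · refine Adj.reachable (openGraph_adj.2 ?_)
          subst hab
          exact ⟨he, by simp, ho⟩
        · refine Reachable.mono ?_ (inducedBC_r_iff.1 hr)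
          intro u v huv
          obtain ⟨h, -, h2⟩ := openGraph_adj.1 huv
          exact openGraph_adj.2 ⟨h, by simp, h2⟩
      rw [wiredGraph, fromRel_adj] at hadj
      rcases hadj.2 with h | h
      · exact key _ _ h
      · exact (key _ _ h).symm
  · rintro ⟨w⟩
    -- A walk may end outside the vertices of `F`, so the induction remembers a vertex `x'` of `F`,
    -- reached in the wired graph, from which the rest of the walk uses only edges outside `F`.
    suffices H : ∀ {a b : Plane} (w : (L.openGraph ∅ ω).Walk a b), a = x →
        ∃ x' : L.verts F, (L.wiredGraph F (L.inducedBC F ω) (fun e => ω e)).Reachable x x' ∧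
          (L.openGraph F ω).Reachable x' b by
      obtain ⟨x', h1, h2⟩ := H w rfl
      exact h1.trans (wiredGraph_reachable_of_reachable h2)
    intro a b w hax
    induction w using Walk.concatRec with
    | Hnil => exact ⟨x, Reachable.refl _, hax ▸ Reachable.refl _⟩
    | @Hconcat u v w p hadj ih =>
      obtain ⟨x', h1, h2⟩ := ih hax
      obtain ⟨h, -, ho⟩ := openGraph_adj.1 hadj
      by_cases hF : (⟨s(v, w), h⟩ : L.Edge) ∈ F
      · refine ⟨⟨w, mem_verts_right hF⟩, ?_, Reachable.refl _⟩
        have h3 := wiredGraph_reachable_of_reachable (η := fun e => ω e) (x := x')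
          (y := ⟨v, mem_verts_left hF⟩) h2
        refine h1.trans (h3.trans (Adj.reachable ?_))
        rw [wiredGraph, fromRel_adj]
        exact ⟨fun e => h.ne (congrArg Subtype.val e), Or.inl (Or.inl ⟨⟨_, hF⟩, ho, rfl⟩)⟩
      · exact ⟨x', h1, h2.trans (Adj.reachable (openGraph_adj.2 ⟨h, hF, ho⟩))⟩

instance finite_verts (F : Finset L.Edge) : Finite (L.verts F) := by
  have : L.verts F = ⋃ e ∈ F, {x | x ∈ (e : Sym2 Plane)} := by
    ext x; simp [verts]
  rw [Set.finite_coe_iff, this]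
  refine F.finite_toSet.biUnion fun e _ => ?_
  obtain ⟨⟨a, b⟩, hab⟩ := Quot.exists_rep (e : Sym2 Plane)
  have : {x | x ∈ (e : Sym2 Plane)} ⊆ {a, b} := fun x hx => by
    rw [Set.mem_ofPred_eq, ← hab] at hx
    simpa using Sym2.mem_iff.1 hx
  exact (Set.toFinite _).subset this

instance finite_boundary (F : Finset L.Edge) : Finite (L.boundary F) :=
  Set.finite_coe_iff.2 ((Set.finite_coe_iff.1 (finite_verts F)).subset fun _ hx => hx.1)

instance finite_boundaryCondition (F : Finset L.Edge) : Finite (L.BoundaryCondition F) :=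
  Finite.of_injective (fun ξ : L.BoundaryCondition F => ξ.r) fun _ _ h => Setoid.ext_iff.2
    fun {a b} => Iff.of_eq (congrFun (congrFun h a) b)

/-- The end-points of `e` are connected in the wired configuration. -/
def Linked {F : Finset L.Edge} (ξ : L.BoundaryCondition F) (η : F → Bool) (e : F) : Prop :=
  ∃ u v : L.verts F, ((e : L.Edge) : Sym2 Plane) = s((u : Plane), (v : Plane)) ∧
    (L.wiredGraph F ξ η).Reachable u v

lemma exists_endpoints {F : Finset L.Edge} (e : F) : ∃ u v : L.verts F,
    ((e : L.Edge) : Sym2 Plane) = s((u : Plane), (v : Plane)) ∧ u ≠ v := by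
  obtain ⟨⟨e, he⟩, hF⟩ := e
  induction e with | _ a b => ?_
  exact ⟨⟨a, mem_verts_left hF⟩, ⟨b, mem_verts_right hF⟩, rfl,
    fun h => (L.graph.mem_edgeSet.1 he).ne (congrArg Subtype.val h)⟩

lemma linked_iff {F : Finset L.Edge} {ξ : L.BoundaryCondition F} {η : F → Bool} {e : F}
    {u v : L.verts F} (he : ((e : L.Edge) : Sym2 Plane) = s((u : Plane), (v : Plane))) :
    Linked ξ η e ↔ (L.wiredGraph F ξ η).Reachable u v := by
  constructor
  · rintro ⟨a, b, hab, h⟩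
    rw [he, Sym2.eq_iff] at hab
    rcases hab with ⟨h1, h2⟩ | ⟨h1, h2⟩
    · rwa [Subtype.ext h1, Subtype.ext h2]
    · rw [Subtype.ext h1, Subtype.ext h2]; exact h.symm
  · exact fun h => ⟨u, v, he, h⟩

lemma wiredGraph_mono {F : Finset L.Edge} {ξ : L.BoundaryCondition F} {η η' : F → Bool}
    (h : η ≤ η') : L.wiredGraph F ξ η ≤ L.wiredGraph F ξ η' := by
  intro x y hxy
  rw [wiredGraph, fromRel_adj] at hxy ⊢
  have key : ∀ e : F, η e = true → η' e = true := fun e he => by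
    have := h e
    rw [he] at this
    exact top_le_iff.1 this
  refine ⟨hxy.1, hxy.2.imp (Or.imp_left ?_) (Or.imp_left ?_)⟩ <;>
  · rintro ⟨e, he, h'⟩
    exact ⟨e, key e he, h'⟩

open Classical in
lemma wiredGraph_update {F : Finset L.Edge} (ξ : L.BoundaryCondition F) (η : F → Bool) {e : F}
    {u v : L.verts F} (he : ((e : L.Edge) : Sym2 Plane) = s((u : Plane), (v : Plane)))
    (huv : u ≠ v) : L.wiredGraph F ξ (Function.update η e true) =
      L.wiredGraph F ξ (Function.update η e false) ⊔ edge u v := by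
  apply le_antisymm
  · intro x y hxy
    rw [sup_adj, edge_adj]
    by_cases hs : s(x, y) = s(u, v)
    · rw [Sym2.eq_iff] at hs
      exact Or.inr ⟨by simpa using hs, hxy.ne⟩
    · left
      have hs' : s((x : Plane), (y : Plane)) ≠ s((u : Plane), (v : Plane)) := fun h => hs (by
        rw [Sym2.eq_iff] at h ⊢
        simpa [Subtype.ext_iff] using h)
      rw [wiredGraph, fromRel_adj] at hxy ⊢
      have key : ∀ e' : F, ((e' : L.Edge) : Sym2 Plane) = s((x : Plane), (y : Plane)) →
          Function.update η e true e' = true → Function.update η e false e' = true := by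
        intro e' h1 h2
        have : e' ≠ e := fun h => hs' (by rw [← h1, h, he])
        rwa [Function.update_of_ne this] at h2 ⊢
      refine ⟨hxy.1, hxy.2.imp (Or.imp_left ?_) (Or.imp_left ?_)⟩
      · rintro ⟨e', h1, h2⟩
        exact ⟨e', key e' h2 h1, h2⟩
      · rintro ⟨e', h1, h2⟩
        exact ⟨e', key e' (h2.trans Sym2.eq_swap) h1, h2⟩
  · refine sup_le (wiredGraph_mono ?_) ?_
    · exact update_le_update_iff.2 ⟨by simp, fun _ _ => le_rfl⟩
    · intro x y hxy
      rw [edge_adj] at hxy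
      rw [wiredGraph, fromRel_adj]
      refine ⟨hxy.2, ?_⟩
      rcases hxy.1 with ⟨rfl, rfl⟩ | ⟨rfl, rfl⟩
      · exact Or.inl (Or.inl ⟨e, by simp, he⟩)
      · exact Or.inr (Or.inl ⟨e, by simp, he⟩)

lemma card_update {ι : Type*} [Finite ι] [DecidableEq ι] (η : ι → Bool) (e : ι) (b : Bool) :
    Nat.card {i // Function.update η e b i = b} =
      Nat.card {i // Function.update η e (!b) i = b} + 1 := by
  have : {i | Function.update η e b i = b} = insert e {i | Function.update η e (!b) i = b} := by
    ext i
    by_cases hi : i = e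
    · subst hi; simp
    · simp [hi]
  change Nat.card {i | Function.update η e b i = b} = Nat.card {i | _} + 1
  rw [Nat.card_coe_set_eq, Nat.card_coe_set_eq, this, Set.ncard_insert_of_notMem]
  simp

section Weights

variable {p q : ℝ} {F : Finset L.Edge} (ξ : L.BoundaryCondition F)

-- Opening `e` leaves the clusters unchanged, so the ratio of the weights is `p / (1 - p)`.
open Classical in
lemma weight_update_of_linked {η : F → Bool} {e : F}
    (h : Linked ξ (Function.update η e false) e) :
    L.weight p q F ξ (Function.update η e true) * (1 - p) =
      p * L.weight p q F ξ (Function.update η e false) := by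
  obtain ⟨u, v, he, huv⟩ := exists_endpoints e
  have hk : L.numClusters F ξ (Function.update η e true) =
      L.numClusters F ξ (Function.update η e false) := by
    rw [numClusters, wiredGraph_update ξ η he huv]
    exact card_connectedComponent_sup_edge_of_reachable ((linked_iff he).1 h)
  have h1 := card_update η e true
  have h2 := card_update η e false
  simp only [Bool.not_true, Bool.not_false] at h1 h2
  rw [weight, weight, hk, h1, h2]
  ring

-- Opening `e` merges two clusters, so the ratio of the weights is `p / (q * (1 - p))`.
open Classical in
lemma weight_update_of_not_linked {η : F → Bool} {e : F}
    (h : ¬ Linked ξ (Function.update η e false) e) :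
    L.weight p q F ξ (Function.update η e true) * (q * (1 - p)) =
      p * L.weight p q F ξ (Function.update η e false) := by
  obtain ⟨u, v, he, huv⟩ := exists_endpoints e
  have hk : L.numClusters F ξ (Function.update η e true) + 1 =
      L.numClusters F ξ (Function.update η e false) := by
    rw [numClusters, wiredGraph_update ξ η he huv]
    exact card_connectedComponent_sup_edge_of_not_reachable fun hr => h ((linked_iff he).2 hr)
  have h1 := card_update η e true
  have h2 := card_update η e false
  simp only [Bool.not_true, Bool.not_false] at h1 h2
  rw [weight, weight, ← hk, h1, h2]
  ring

lemma weight_pos (hp : 0 < p) (hp1 : p < 1) (hq : 1 ≤ q) (η : F → Bool) :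
    0 < L.weight p q F ξ η := by
  unfold weight
  have : 0 < 1 - p := by linarith
  positivity

open Classical in
/-- Opening an edge is favoured by the other open edges. -/
lemma weight_update_mul_le (hp : 0 < p) (hp1 : p < 1) (hq : 1 ≤ q) {η η' : F → Bool} (h : η ≤ η')
    (e : F) :
    L.weight p q F ξ (Function.update η e true) * L.weight p q F ξ (Function.update η' e false) ≤
      L.weight p q F ξ (Function.update η e false) *
        L.weight p q F ξ (Function.update η' e true) := by
  have hp' : 0 < 1 - p := by linarith
  have w1 := weight_pos ξ hp hp1 hq (Function.update η e true)
  have w2 := weight_pos ξ hp hp1 hq (Function.update η e false)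
  have w3 := weight_pos ξ hp hp1 hq (Function.update η' e true)
  have w4 := weight_pos ξ hp hp1 hq (Function.update η' e false)
  -- More open edges can only turn an unlinked edge into a linked one, and since `q ≥ 1` the ratio
  -- of the weights is larger for a linked edge.
  have hmono : Linked ξ (Function.update η e false) e → Linked ξ (Function.update η' e false) e := by
    rintro ⟨u, v, he, hr⟩
    refine ⟨u, v, he, hr.mono (wiredGraph_mono ?_)⟩
    exact update_le_update_iff.2 ⟨le_rfl, fun j _ => h j⟩
  have hqp : 0 < q * (1 - p) := by positivity
  by_cases hl : Linked ξ (Function.update η e false) e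
  · have e1 := weight_update_of_linked (p := p) (q := q) ξ hl
    have e2 := weight_update_of_linked (p := p) (q := q) ξ (hmono hl)
    refine le_of_mul_le_mul_right ?_ hp'
    nlinarith
  · have e1 := weight_update_of_not_linked (p := p) (q := q) ξ hl
    refine le_of_mul_le_mul_right ?_ hqp
    by_cases hl' : Linked ξ (Function.update η' e false) e
    · have e2 := weight_update_of_linked (p := p) (q := q) ξ hl'
      have : L.weight p q F ξ (Function.update η e true) *
          L.weight p q F ξ (Function.update η' e false) * (q * (1 - p)) =
          L.weight p q F ξ (Function.update η e false) *
          (L.weight p q F ξ (Function.update η' e true) * (1 - p)) := by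
        rw [e2]; linear_combination L.weight p q F ξ (Function.update η' e false) * e1
      rw [this, mul_assoc]
      gcongr
      nlinarith
    · have e2 := weight_update_of_not_linked (p := p) (q := q) ξ hl'
      apply le_of_eq
      linear_combination L.weight p q F ξ (Function.update η' e false) * e1 -
        L.weight p q F ξ (Function.update η e false) * e2

-- The one-edge inequality is iterated over the edges that are open in `a` and closed in `b`:
-- opening them turns `a ⊓ b` into `a` and `b` into `a ⊔ b`.
open Classical in
lemma weight_lattice (hp : 0 < p) (hp1 : p < 1) (hq : 1 ≤ q) (a b : F → Bool) :
    L.weight p q F ξ a * L.weight p q F ξ b ≤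
      L.weight p q F ξ (a ⊓ b) * L.weight p q F ξ (a ⊔ b) := by
  have key : ∀ (T : Finset F) (η η' : F → Bool), η ≤ η' →
      L.weight p q F ξ (fun e => if e ∈ T then true else η e) *
        L.weight p q F ξ (fun e => if e ∈ T then false else η' e) ≤
      L.weight p q F ξ (fun e => if e ∈ T then false else η e) *
        L.weight p q F ξ (fun e => if e ∈ T then true else η' e) := by
    intro T
    induction T using Finset.induction_on with
    | empty => intro η η' _; simp
    | insert e T he ih =>
      intro η η' hη
      have upd : ∀ (η : F → Bool) (b : Bool), (fun e' => if e' ∈ insert e T then b else η e') =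
          Function.update (fun e' => if e' ∈ T then b else η e') e b := fun η b => by
        funext e'
        by_cases h : e' = e
        · subst h; simp
        · simp [h]
      have upd' : ∀ (η : F → Bool) (b c : Bool), (fun e' => if e' ∈ T then b else
          Function.update η e c e') = Function.update (fun e' => if e' ∈ T then b else η e') e c :=
        fun η b c => by
          funext e'
          by_cases h : e' = e
          · subst h; simp [he]
          · simp [h]
      simp only [upd]
      have i1 := ih (Function.update η e false) (Function.update η' e false)
        (update_le_update_iff.2 ⟨le_rfl, fun j _ => hη j⟩)
      simp only [upd'] at i1
      have i2 := weight_update_mul_le ξ hp hp1 hq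
        (η := fun e' => if e' ∈ T then true else η e')
        (η' := fun e' => if e' ∈ T then true else η' e')
        (fun e' => by by_cases h : e' ∈ T <;> simp [h, hη e']) e
      have w1 := weight_pos ξ hp hp1 hq
        (Function.update (fun e' => if e' ∈ T then true else η e') e false)
      have w2 := weight_pos ξ hp hp1 hq
        (Function.update (fun e' => if e' ∈ T then true else η' e') e false)
      have w3 := weight_pos ξ hp hp1 hq
        (Function.update (fun e' => if e' ∈ T then true else η e') e true)
      have w4 := weight_pos ξ hp hp1 hq
        (Function.update (fun e' => if e' ∈ T then false else η' e') e false)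
      refine le_of_mul_le_mul_right ?_ (mul_pos w1 w2)
      have := mul_le_mul i1 i2 (by positivity) (mul_pos (weight_pos ξ hp hp1 hq _) w2).le
      linarith
  have := key (Finset.univ.filter fun e => a e = true ∧ b e = false) (a ⊓ b) b inf_le_right
  convert this using 2
  · congr 1; funext e
    cases ha : a e <;> cases hb : b e <;> simp [ha, hb]
  · congr 1; funext e
    cases ha : a e <;> cases hb : b e <;> simp [ha, hb]
  · congr 1; funext e
    cases ha : a e <;> cases hb : b e <;> simp [ha, hb]
  · congr 1; funext e
    cases ha : a e <;> cases hb : b e <;> simp [ha, hb]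

end Weights

end PlanarLattice

/-! ### From infinite-volume measures to the single-edge relation -/

namespace PlanarLattice

open SimpleGraph MeasureTheory

variable {L : PlanarLattice}

instance countable_edge : Countable L.Edge := by
  have hV : L.V.Countable := by
    have : L.V = ⋃ n : ℕ, L.V ∩ Metric.closedBall 0 n := by
      rw [← Set.inter_iUnion, Metric.iUnion_closedBall_nat, Set.inter_univ]
    rw [this]
    exact Set.countable_iUnion fun n =>
      (L.finite_of_bounded _ Metric.isBounded_closedBall).countable
  have hV' := hV.to_subtype
  have hsub : L.graph.edgeSet ⊆ Set.range (Sym2.map (Subtype.val : L.V → Plane)) := by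
    intro e he
    induction e with | _ a b => ?_
    exact ⟨s(⟨a, L.mem_of_adj _ _ he⟩, ⟨b, L.mem_of_adj _ _ (L.graph.mem_edgeSet.1 he).symm⟩), rfl⟩
  have : Countable (Sym2 L.V) := Quotient.countable
  exact ((Set.countable_range _).mono hsub).to_subtype

lemma measurableSet_eq (e : L.Edge) (b : Bool) : MeasurableSet {ω : L.Config | ω e = b} :=
  (measurable_pi_apply e : Measurable fun ω : L.Config => ω e) (measurableSet_singleton b)

/-- A path uses finitely many edges, so connection events are countable unions of cylinder events,
hence measurable. -/
lemma reachable_iff_exists_finset {S : Set L.Edge} {ω : L.Config} {x y : Plane} :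
    (L.openGraph S ω).Reachable x y ↔ ∃ T : Finset L.Edge,
      (fromEdgeSet {e : Sym2 Plane | ∃ h : e ∈ L.graph.edgeSet, (⟨e, h⟩ : L.Edge) ∈ T}).Reachable
        x y ∧ ∀ e ∈ T, e ∉ S ∧ ω e = true := by
  classical
  constructor
  · rintro ⟨w⟩
    induction w with
    | nil => exact ⟨∅, Reachable.refl _, by simp⟩
    | @cons a b c hadj _ ih =>
      obtain ⟨T, hT, hT'⟩ := ih
      obtain ⟨h, h1, h2⟩ := openGraph_adj.1 hadj
      refine ⟨insert ⟨s(a, b), h⟩ T, ?_, ?_⟩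
      · refine Reachable.trans (Adj.reachable ?_) (hT.mono (fromEdgeSet_mono ?_))
        · rw [fromEdgeSet_adj]
          exact ⟨⟨h, Finset.mem_insert_self _ _⟩, h.ne⟩
        · rintro e ⟨he, he'⟩
          exact ⟨he, Finset.mem_insert_of_mem he'⟩
      · simp only [Finset.forall_mem_insert]
        exact ⟨⟨h1, h2⟩, hT'⟩
  · rintro ⟨T, hT, hT'⟩
    refine hT.mono (fromEdgeSet_mono ?_)
    rintro e ⟨he, he'⟩
    exact ⟨he, hT' _ he'⟩

lemma measurableSet_reachable (S : Set L.Edge) (x y : Plane) :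
    MeasurableSet {ω : L.Config | (L.openGraph S ω).Reachable x y} := by
  simp only [reachable_iff_exists_finset]
  rw [Set.ofPred_exists]
  refine MeasurableSet.iUnion fun T => ?_
  by_cases hT : (fromEdgeSet {e : Sym2 Plane | ∃ h : e ∈ L.graph.edgeSet,
      (⟨e, h⟩ : L.Edge) ∈ T}).Reachable x y
  · have : {ω : L.Config | (fromEdgeSet {e : Sym2 Plane | ∃ h : e ∈ L.graph.edgeSet,
      (⟨e, h⟩ : L.Edge) ∈ T}).Reachable x y ∧ ∀ e ∈ T, e ∉ S ∧ ω e = true} =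
        ⋂ e ∈ T, {ω | e ∉ S ∧ ω e = true} := by
      ext ω; simp [hT]
    rw [this]
    exact Finset.measurableSet_biInter _ fun e _ =>
      (MeasurableSet.const _).inter (measurableSet_eq e true)
  · simp [hT]

lemma measurableSet_inducedBC (F : Finset L.Edge) (ξ : L.BoundaryCondition F) :
    MeasurableSet {ω : L.Config | L.inducedBC F ω = ξ} := by
  have : {ω : L.Config | L.inducedBC F ω = ξ} = ⋂ a : L.boundary F, ⋂ b : L.boundary F,
      {ω | (L.openGraph F ω).Reachable a b ↔ ξ.r a b} := by
    ext ω
    simp only [Set.mem_ofPred_eq, Set.mem_iInter, ← inducedBC_r_iff]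
    exact Setoid.ext_iff
  rw [this]
  refine MeasurableSet.iInter fun a => MeasurableSet.iInter fun b => ?_
  exact (measurableSet_reachable _ _ _).iff (MeasurableSet.const _)

lemma openGraph_congr {S : Set L.Edge} {ω ω' : L.Config} (h : ∀ e ∉ S, ω e = ω' e) :
    L.openGraph S ω = L.openGraph S ω' := by
  ext x y
  rw [openGraph_adj, openGraph_adj]
  refine exists_congr fun hxy => and_congr_right fun hS => ?_
  rw [h _ hS]

lemma inducedBC_congr {F : Finset L.Edge} {ω ω' : L.Config} (h : ∀ e ∉ F, ω e = ω' e) :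
    L.inducedBC F ω = L.inducedBC F ω' :=
  Setoid.ext_iff.2 fun {a b} => by
    change (L.openGraph F ω).Reachable a b ↔ (L.openGraph F ω').Reachable a b
    rw [openGraph_congr h]

open Classical in
/-- The configuration obtained by closing `e`. -/
noncomputable def closeEdge (e : L.Edge) (ω : L.Config) : L.Config := Function.update ω e false

lemma closeEdge_self (e : L.Edge) (ω : L.Config) : closeEdge e ω e = false := by
  simp [closeEdge]

lemma closeEdge_of_ne {e e' : L.Edge} (h : e' ≠ e) (ω : L.Config) : closeEdge e ω e' = ω e' := by
  simp [closeEdge, h]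

lemma measurable_closeEdge (e : L.Edge) : Measurable (closeEdge e : L.Config → L.Config) := by
  refine measurable_pi_iff.2 fun e' => ?_
  by_cases h : e' = e
  · subst h; simp only [closeEdge_self]; exact measurable_const
  · simp only [closeEdge_of_ne h]; exact measurable_pi_apply e'

/-- The end-points of `e` are connected by a path of open edges other than `e`. -/
def Bridged (e : L.Edge) : Set L.Config :=
  {ω | ∃ x y : Plane, (e : Sym2 Plane) = s(x, y) ∧ (L.openGraph {e} ω).Reachable x y}

lemma mem_bridged_iff {e : L.Edge} {x y : Plane} (he : (e : Sym2 Plane) = s(x, y))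
    {ω : L.Config} : ω ∈ Bridged e ↔ (L.openGraph {e} ω).Reachable x y := by
  constructor
  · rintro ⟨a, b, hab, h⟩
    rw [he, Sym2.eq_iff] at hab
    rcases hab with ⟨rfl, rfl⟩ | ⟨rfl, rfl⟩
    · exact h
    · exact h.symm
  · exact fun h => ⟨x, y, he, h⟩

lemma measurableSet_bridged (e : L.Edge) : MeasurableSet (Bridged e : Set L.Config) := by
  obtain ⟨⟨x, y⟩, hxy⟩ := Quot.exists_rep (e : Sym2 Plane)
  have : (Bridged e : Set L.Config) = {ω | (L.openGraph {e} ω).Reachable x y} := by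
    ext ω; exact mem_bridged_iff hxy.symm
  rw [this]
  exact measurableSet_reachable _ _ _

lemma openGraph_closeEdge (e : L.Edge) (ω : L.Config) :
    L.openGraph ∅ (closeEdge e ω) = L.openGraph {e} ω := by
  ext x y
  rw [openGraph_adj, openGraph_adj]
  refine exists_congr fun hxy => ?_
  by_cases h : (⟨s(x, y), hxy⟩ : L.Edge) = e
  · simp [h, closeEdge_self]
  · simp [h, closeEdge_of_ne h]

-- Closing `e ∈ F` does not affect the induced boundary condition, so connections in the whole
-- lattice avoiding `e` can be read off from the wired graph with `e` closed.
open Classical in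
lemma mem_bridged_iff_linked {F : Finset L.Edge} {ω : L.Config} (e : F) {η : F → Bool}
    (h : ∀ e' : F, e' ≠ e → ω e' = η e') :
    ω ∈ Bridged (e : L.Edge) ↔ Linked (L.inducedBC F ω) (Function.update η e false) e := by
  obtain ⟨u, v, he, -⟩ := exists_endpoints e
  have h1 : L.inducedBC F ω = L.inducedBC F (closeEdge (e : L.Edge) ω) :=
    inducedBC_congr fun e' he' => (closeEdge_of_ne (fun hc => he' (by rw [hc]; exact e.2)) _).symm
  have h2 : Function.update η e false = fun e' : F => closeEdge (e : L.Edge) ω e' := by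
    funext e'
    by_cases hee : e' = e
    · subst hee; simp [closeEdge_self]
    · rw [Function.update_of_ne hee, closeEdge_of_ne (fun hc => hee (Subtype.ext hc)), h e' hee]
  rw [mem_bridged_iff he, linked_iff he, h1, h2, wiredGraph_reachable_iff, openGraph_closeEdge]

/-- The relation between the two states of a single edge under a random-cluster measure. -/
def SingleEdge (p q : ℝ) (φ : Measure L.Config) : Prop :=
  IsProbabilityMeasure φ ∧ ∀ (e : L.Edge) (G : Set L.Config), MeasurableSet G →
    ENNReal.ofReal (1 - p) * φ (closeEdge e ⁻¹' G ∩ {ω | ω e = true} ∩ Bridged e) =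
      ENNReal.ofReal p * φ (closeEdge e ⁻¹' G ∩ {ω | ω e = false} ∩ Bridged e) ∧
    ENNReal.ofReal (q * (1 - p)) * φ (closeEdge e ⁻¹' G ∩ {ω | ω e = true} ∩ (Bridged e)ᶜ) =
      ENNReal.ofReal p * φ (closeEdge e ⁻¹' G ∩ {ω | ω e = false} ∩ (Bridged e)ᶜ)

/-- The configurations that agree with `η` on `F`. -/
def cylinder (F : Finset L.Edge) (η : L.Config) : Set L.Config := {ω | ∀ e ∈ F, ω e = η e}

lemma measurableSet_cylinder (F : Finset L.Edge) (η : L.Config) :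
    MeasurableSet (cylinder F η) := by
  have : cylinder F η = ⋂ e ∈ F, {ω | ω e = η e} := by ext ω; simp [cylinder]
  rw [this]
  exact Finset.measurableSet_biInter _ fun e _ => measurableSet_eq e _

/-- Finite measures that agree on cylinders are equal. -/
lemma ext_of_cylinder {μ ν : Measure L.Config} [IsFiniteMeasure μ]
    (h : ∀ F η, μ (cylinder F η) = ν (cylinder F η)) : μ = ν := by
  classical
  refine ext_of_generate_finite {S | ∃ F η, S = cylinder F η} ?_ ?_ ?_ ?_
  · apply le_antisymm
    · have hid : @Measurable L.Config L.Config
          (MeasurableSpace.generateFrom {S | ∃ F η, S = cylinder F η}) _ id := by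
        refine (@measurable_pi_iff _ _ _ (_) _ _).2 fun e => ?_
        refine @measurable_to_countable' _ _ _ _ (_) _ fun b => ?_
        refine MeasurableSpace.measurableSet_generateFrom ⟨{e}, fun _ => b, ?_⟩
        ext ω
        simp [cylinder]
      intro S hS
      exact hid hS
    · refine MeasurableSpace.generateFrom_le ?_
      rintro _ ⟨F, η, rfl⟩
      exact measurableSet_cylinder F η
  · rintro _ ⟨F, η, rfl⟩ _ ⟨F', η', rfl⟩ ⟨ω₀, h1, h2⟩
    refine ⟨F ∪ F', ω₀, ?_⟩
    ext ω
    constructor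
    · rintro ⟨h3, h4⟩ e he
      rcases Finset.mem_union.1 he with he | he
      · rw [h3 e he, h1 e he]
      · rw [h4 e he, h2 e he]
    · intro h3
      exact ⟨fun e he => (h3 e (Finset.mem_union_left _ he)).trans (h1 e he),
        fun e he => (h3 e (Finset.mem_union_right _ he)).trans (h2 e he)⟩
  · rintro _ ⟨F, η, rfl⟩
    exact h F η
  · have := h ∅ fun _ => true
    simpa [cylinder] using this

lemma measure_eq_sum_inducedBC (φ : Measure L.Config) (F : Finset L.Edge)
    [Fintype (L.BoundaryCondition F)] (S : Set L.Config) :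
    φ S = ∑ ξ : L.BoundaryCondition F, φ (S ∩ {ω | L.inducedBC F ω = ξ}) := by
  have := sum_measure_preimage_singleton (μ := φ.restrict S) (f := fun ω => L.inducedBC F ω)
    Finset.univ fun ξ _ => measurableSet_inducedBC F ξ
  simp only [Finset.coe_univ, Set.preimage_univ, Measure.restrict_apply_univ] at this
  rw [← this]
  refine Finset.sum_congr rfl fun ξ _ => ?_
  change (φ.restrict S) {ω | L.inducedBC F ω = ξ} = _
  rw [Measure.restrict_apply (measurableSet_inducedBC F ξ), Set.inter_comm]

section

variable {p q : ℝ}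

lemma partitionFunction_pos (hp : 0 < p) (hp1 : p < 1) (hq : 1 ≤ q) (F : Finset L.Edge)
    (ξ : L.BoundaryCondition F) : 0 < L.partitionFunction p q F ξ :=
  Finset.sum_pos (fun η _ => weight_pos ξ hp hp1 hq η) Finset.univ_nonempty

lemma IsInfiniteVolume.measure_inter {φ : Measure L.Config} (hφ : L.IsInfiniteVolume p q φ)
    (F : Finset L.Edge) (ξ : L.BoundaryCondition F) (η : F → Bool) :
    φ ({ω | ∀ e : F, ω e = η e} ∩ {ω | L.inducedBC F ω = ξ}) =
      ENNReal.ofReal (L.finiteVolumeProb p q F ξ η) * φ {ω | L.inducedBC F ω = ξ} := by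
  have := hφ.1
  by_cases h0 : φ {ω | L.inducedBC F ω = ξ} = 0
  · rw [h0, mul_zero]
    exact measure_mono_null Set.inter_subset_right h0
  · rw [← hφ.2 F ξ h0 η, ProbabilityTheory.cond_apply (measurableSet_inducedBC F ξ), mul_comm,
      ← mul_assoc, ENNReal.mul_inv_cancel h0 (measure_ne_top _ _), one_mul, Set.inter_comm]

-- Decompose according to the induced boundary condition. Together with the states of the other
-- edges of `F` it decides whether `e` is bridged, so each term obeys one of the two weight ratios.
open Classical in
lemma IsInfiniteVolume.measure_cylinder {φ : Measure L.Config} (hφ : L.IsInfiniteVolume p q φ)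
    (hp : 0 < p) (hp1 : p < 1) (hq : 1 ≤ q) {F : Finset L.Edge} (e : F) (η : F → Bool) :
    ENNReal.ofReal (1 - p) *
        φ ({ω | ∀ e' : F, ω e' = Function.update η e true e'} ∩ Bridged (e : L.Edge)) =
      ENNReal.ofReal p *
        φ ({ω | ∀ e' : F, ω e' = Function.update η e false e'} ∩ Bridged (e : L.Edge)) ∧
    ENNReal.ofReal (q * (1 - p)) *
        φ ({ω | ∀ e' : F, ω e' = Function.update η e true e'} ∩ (Bridged (e : L.Edge))ᶜ) =
      ENNReal.ofReal p *
        φ ({ω | ∀ e' : F, ω e' = Function.update η e false e'} ∩ (Bridged (e : L.Edge))ᶜ) := by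
  have hp' : 0 < 1 - p := by linarith
  have := Fintype.ofFinite (L.BoundaryCondition F)
  have hbr : ∀ (b : Bool) (ω : L.Config), (∀ e' : F, ω e' = Function.update η e b e') →
      (ω ∈ Bridged (e : L.Edge) ↔
        Linked (L.inducedBC F ω) (Function.update η e false) e) := fun b ω h =>
    mem_bridged_iff_linked e fun e' he' => by rw [h, Function.update_of_ne he']
  have term : ∀ (b : Bool) (ξ : L.BoundaryCondition F),
      φ ({ω | ∀ e' : F, ω e' = Function.update η e b e'} ∩ Bridged (e : L.Edge) ∩
        {ω | L.inducedBC F ω = ξ}) = if Linked ξ (Function.update η e false) e then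
        ENNReal.ofReal (L.finiteVolumeProb p q F ξ (Function.update η e b)) *
          φ {ω | L.inducedBC F ω = ξ} else 0 := by
    intro b ξ
    split_ifs with hl
    · rw [← hφ.measure_inter]
      congr 1
      ext ω
      constructor
      · rintro ⟨⟨h1, h2⟩, h3⟩
        exact ⟨h1, h3⟩
      · rintro ⟨h1, h3⟩
        refine ⟨⟨h1, (hbr b ω h1).2 ?_⟩, h3⟩
        rw [Set.mem_ofPred_eq] at h3
        rwa [h3]
    · convert measure_empty (μ := φ)
      ext ω
      simp only [Set.mem_empty_iff_false, iff_false]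
      rintro ⟨⟨h1, h2⟩, h3⟩
      have h4 := (hbr b ω h1).1 h2
      rw [Set.mem_ofPred_eq] at h3
      rw [h3] at h4
      exact hl h4
  have term' : ∀ (b : Bool) (ξ : L.BoundaryCondition F),
      φ ({ω | ∀ e' : F, ω e' = Function.update η e b e'} ∩ (Bridged (e : L.Edge))ᶜ ∩
        {ω | L.inducedBC F ω = ξ}) = if Linked ξ (Function.update η e false) e then 0 else
        ENNReal.ofReal (L.finiteVolumeProb p q F ξ (Function.update η e b)) *
          φ {ω | L.inducedBC F ω = ξ} := by
    intro b ξ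
    split_ifs with hl
    · convert measure_empty (μ := φ)
      ext ω
      simp only [Set.mem_empty_iff_false, iff_false]
      rintro ⟨⟨h1, h2⟩, h3⟩
      rw [Set.mem_ofPred_eq] at h3
      rw [← h3] at hl
      exact h2 ((hbr b ω h1).2 hl)
    · rw [← hφ.measure_inter]
      congr 1
      ext ω
      constructor
      · rintro ⟨⟨h1, h2⟩, h3⟩
        exact ⟨h1, h3⟩
      · rintro ⟨h1, h3⟩
        refine ⟨⟨h1, fun hc => hl ?_⟩, h3⟩
        have h4 := (hbr b ω h1).1 hc
        rw [Set.mem_ofPred_eq] at h3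
        rwa [h3] at h4
  have hw : ∀ (ξ : L.BoundaryCondition F) (η : F → Bool), 0 ≤ L.finiteVolumeProb p q F ξ η :=
    fun ξ η => div_nonneg (weight_pos ξ hp hp1 hq η).le (partitionFunction_pos hp hp1 hq F ξ).le
  constructor
  · rw [measure_eq_sum_inducedBC φ F, measure_eq_sum_inducedBC φ F
      ({ω | ∀ e' : F, ω e' = Function.update η e false e'} ∩ Bridged (e : L.Edge)),
      Finset.mul_sum, Finset.mul_sum]
    refine Finset.sum_congr rfl fun ξ _ => ?_
    rw [term, term]
    split_ifs with hl
    · rw [← mul_assoc, ← mul_assoc, ← ENNReal.ofReal_mul hp'.le, ← ENNReal.ofReal_mul hp.le]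
      congr 2
      have := weight_update_of_linked (p := p) (q := q) ξ hl
      rw [finiteVolumeProb, finiteVolumeProb, mul_div_assoc', mul_div_assoc', ← this, mul_comm]
    · simp
  · rw [measure_eq_sum_inducedBC φ F, measure_eq_sum_inducedBC φ F
      ({ω | ∀ e' : F, ω e' = Function.update η e false e'} ∩ (Bridged (e : L.Edge))ᶜ),
      Finset.mul_sum, Finset.mul_sum]
    refine Finset.sum_congr rfl fun ξ _ => ?_
    rw [term', term']
    split_ifs with hl
    · simp
    · rw [← mul_assoc, ← mul_assoc, ← ENNReal.ofReal_mul (by positivity),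
        ← ENNReal.ofReal_mul hp.le]
      congr 2
      have := weight_update_of_not_linked (p := p) (q := q) ξ hl
      rw [finiteVolumeProb, finiteVolumeProb, mul_div_assoc', mul_div_assoc', ← this, mul_comm]

lemma closeEdge_preimage_cylinder_eq_empty {e : L.Edge} {F : Finset L.Edge} {η : L.Config}
    (h : e ∈ F ∧ η e = true) : closeEdge e ⁻¹' cylinder F η = ∅ := by
  ext ω
  simp only [Set.mem_preimage, Set.mem_empty_iff_false, iff_false]
  intro hω
  have := hω e h.1
  rw [closeEdge_self, h.2] at this
  exact absurd this (by simp)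

open Classical in
lemma closeEdge_preimage_cylinder {e : L.Edge} {F : Finset L.Edge} {η : L.Config}
    (h : ¬ (e ∈ F ∧ η e = true)) (b : Bool) :
    closeEdge e ⁻¹' cylinder F η ∩ {ω | ω e = b} =
      {ω | ∀ e' : (insert e F : Finset L.Edge), ω e' =
        Function.update (fun e' : (insert e F : Finset L.Edge) => η e')
          ⟨e, Finset.mem_insert_self e F⟩ b e'} := by
  ext ω
  constructor
  · rintro ⟨h1, h2⟩ ⟨e', he'⟩
    by_cases hee : e' = e
    · subst hee; simpa using h2
    · have hF : e' ∈ F := (Finset.mem_insert.1 he').resolve_left hee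
      rw [Function.update_of_ne (fun hc => hee (congrArg Subtype.val hc))]
      have := h1 e' hF
      rwa [closeEdge_of_ne hee] at this
  · intro h1
    refine ⟨fun e' he' => ?_, ?_⟩
    · by_cases hee : e' = e
      · subst hee
        rw [closeEdge_self]
        cases hη : η e' with
        | false => rfl
        | true => exact absurd ⟨he', hη⟩ h
      · have := h1 ⟨e', Finset.mem_insert_of_mem he'⟩
        rw [Function.update_of_ne (fun hc => hee (congrArg Subtype.val hc))] at this
        rwa [closeEdge_of_ne hee]
    · have := h1 ⟨e, Finset.mem_insert_self e F⟩
      simpa using this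

/-- Both sides are finite measures of `G`, pushed forward by `closeEdge e`, so it is enough to
compare them on cylinders. -/
lemma measure_closeEdge_ext {φ : Measure L.Config} [IsFiniteMeasure φ] {e : L.Edge} {a b : ℝ}
    {A B : Set L.Config} (hA : MeasurableSet A) (hB : MeasurableSet B)
    (h : ∀ F η, ENNReal.ofReal a * φ (closeEdge e ⁻¹' cylinder F η ∩ A) =
      ENNReal.ofReal b * φ (closeEdge e ⁻¹' cylinder F η ∩ B))
    {G : Set L.Config} (hG : MeasurableSet G) :
    ENNReal.ofReal a * φ (closeEdge e ⁻¹' G ∩ A) =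
      ENNReal.ofReal b * φ (closeEdge e ⁻¹' G ∩ B) := by
  have key : ∀ (c : ℝ) (A : Set L.Config), MeasurableSet A → ∀ G : Set L.Config, MeasurableSet G →
      (ENNReal.ofReal c • (φ.restrict A).map (closeEdge e)) G =
        ENNReal.ofReal c * φ (closeEdge e ⁻¹' G ∩ A) := by
    intro c A hA G hG
    rw [Measure.smul_apply, Measure.map_apply (measurable_closeEdge e) hG,
      Measure.restrict_apply (measurable_closeEdge e hG), smul_eq_mul]
  have : IsFiniteMeasure (ENNReal.ofReal a • (φ.restrict A).map (closeEdge e)) :=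
    ⟨by
      rw [key a A hA _ MeasurableSet.univ]
      exact ENNReal.mul_lt_top ENNReal.ofReal_lt_top (measure_lt_top _ _)⟩
  have := ext_of_cylinder (μ := ENNReal.ofReal a • (φ.restrict A).map (closeEdge e))
    (ν := ENNReal.ofReal b • (φ.restrict B).map (closeEdge e)) (fun F η => by
      rw [key a A hA _ (measurableSet_cylinder F η), key b B hB _ (measurableSet_cylinder F η)]
      exact h F η)
  rw [← key a A hA G hG, ← key b B hB G hG, this]

/-- The events `closeEdge e ⁻¹' G` are those not depending on `e`, so this conditions on the full
configuration off `e`, while the definition conditions only on a partition. The approximation by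
larger and larger `F` makes the difference disappear. -/
theorem IsInfiniteVolume.singleEdge {φ : Measure L.Config} (hφ : L.IsInfiniteVolume p q φ)
    (hp : 0 < p) (hp1 : p < 1) (hq : 1 ≤ q) : SingleEdge p q φ := by
  classical
  have := hφ.1
  refine ⟨hφ.1, fun e G hG => ⟨?_, ?_⟩⟩
  · rw [Set.inter_assoc, Set.inter_assoc]
    refine measure_closeEdge_ext ((measurableSet_eq e _).inter (measurableSet_bridged e))
      ((measurableSet_eq e _).inter (measurableSet_bridged e)) (fun F η => ?_) hG
    by_cases h : e ∈ F ∧ η e = true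
    · rw [closeEdge_preimage_cylinder_eq_empty h]; simp
    · rw [← Set.inter_assoc, ← Set.inter_assoc, closeEdge_preimage_cylinder h,
        closeEdge_preimage_cylinder h]
      exact (hφ.measure_cylinder hp hp1 hq ⟨e, Finset.mem_insert_self e F⟩ _).1
  · rw [Set.inter_assoc, Set.inter_assoc]
    refine measure_closeEdge_ext ((measurableSet_eq e _).inter (measurableSet_bridged e).compl)
      ((measurableSet_eq e _).inter (measurableSet_bridged e).compl) (fun F η => ?_) hG
    by_cases h : e ∈ F ∧ η e = true
    · rw [closeEdge_preimage_cylinder_eq_empty h]; simp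
    · rw [← Set.inter_assoc, ← Set.inter_assoc, closeEdge_preimage_cylinder h,
        closeEdge_preimage_cylinder h]
      exact (hφ.measure_cylinder hp hp1 hq ⟨e, Finset.mem_insert_self e F⟩ _).2

end

end PlanarLattice

/-! ### From the single-edge relation to conditional laws in finite sets -/

namespace PlanarLattice

open SimpleGraph MeasureTheory

variable {L : PlanarLattice} {p q : ℝ}

/-- The configurations that are equal to `η` on `F`. -/
def agreeOn {F : Finset L.Edge} (η : F → Bool) : Set L.Config := {ω | ∀ e : F, ω e = η e}

lemma measurableSet_agreeOn {F : Finset L.Edge} (η : F → Bool) :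
    MeasurableSet (agreeOn η : Set L.Config) := by
  have : (agreeOn η : Set L.Config) = ⋂ e : F, {ω | ω e = η e} := by ext ω; simp [agreeOn]
  rw [this]
  exact MeasurableSet.iInter fun e => measurableSet_eq _ _

/-- `G` does not depend on the edges of `F`. -/
def IsExterior (F : Finset L.Edge) (G : Set L.Config) : Prop :=
  ∀ ω ω' : L.Config, (∀ e ∉ F, ω e = ω' e) → (ω ∈ G ↔ ω' ∈ G)

open Classical in
lemma closeEdge_preimage_agreeOn {F : Finset L.Edge} {G : Set L.Config} (hG : IsExterior F G)
    (η : F → Bool) (e : F) (b : Bool) :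
    closeEdge (e : L.Edge) ⁻¹' (G ∩ agreeOn (Function.update η e false)) ∩ {ω | ω e = b} =
      G ∩ agreeOn (Function.update η e b) := by
  ext ω
  have h1 : closeEdge (e : L.Edge) ω ∈ G ↔ ω ∈ G := hG _ _ fun e' he' =>
    closeEdge_of_ne (fun hc => he' (by rw [hc]; exact e.2)) _
  have h2 : ∀ e' : F, e' ≠ e → closeEdge (e : L.Edge) ω e' = ω e' := fun e' he' =>
    closeEdge_of_ne (fun hc => he' (Subtype.ext hc)) _
  constructor
  · rintro ⟨⟨h3, h4⟩, h5⟩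
    refine ⟨h1.1 h3, fun e' => ?_⟩
    by_cases hee : e' = e
    · subst hee; simpa using h5
    · rw [Function.update_of_ne hee, ← h2 e' hee, h4 e', Function.update_of_ne hee]
  · rintro ⟨h3, h4⟩
    refine ⟨⟨h1.2 h3, fun e' => ?_⟩, ?_⟩
    · by_cases hee : e' = e
      · subst hee; simp [closeEdge_self]
      · rw [h2 e' hee, h4 e', Function.update_of_ne hee, Function.update_of_ne hee]
    · have := h4 e
      simpa using this

open Classical in
lemma SingleEdge.measure_update {φ : Measure L.Config} (hφ : SingleEdge p q φ) (hp : 0 < p)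
    (hp1 : p < 1) (hq : 1 ≤ q) {F : Finset L.Edge} {ξ : L.BoundaryCondition F}
    {G : Set L.Config} (hG : MeasurableSet G) (hGF : IsExterior F G)
    (hξ : ∀ ω ∈ G, L.inducedBC F ω = ξ) (η : F → Bool) (e : F) :
    φ.real (G ∩ agreeOn (Function.update η e true)) *
        L.weight p q F ξ (Function.update η e false) =
      φ.real (G ∩ agreeOn (Function.update η e false)) *
        L.weight p q F ξ (Function.update η e true) := by
  have hp' : 0 < 1 - p := by linarith
  have hqp : 0 < q * (1 - p) := by positivity
  have hm : MeasurableSet (G ∩ agreeOn (Function.update η e false)) :=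
    hG.inter (measurableSet_agreeOn _)
  have hbr : ∀ (b : Bool), ∀ ω ∈ G ∩ agreeOn (Function.update η e b),
      (ω ∈ Bridged (e : L.Edge) ↔ Linked ξ (Function.update η e false) e) := fun b ω h => by
    rw [mem_bridged_iff_linked e (η := η) fun e' he' => by rw [h.2 e', Function.update_of_ne he'],
      hξ ω h.1]
  by_cases hl : Linked ξ (Function.update η e false) e
  · have hsub : ∀ b, G ∩ agreeOn (Function.update η e b) ⊆ Bridged (e : L.Edge) :=
      fun b ω h => (hbr b ω h).2 hl
    have h1 := (hφ.2 e _ hm).1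
    rw [closeEdge_preimage_agreeOn hGF, closeEdge_preimage_agreeOn hGF,
      Set.inter_eq_left.2 (hsub _), Set.inter_eq_left.2 (hsub _)] at h1
    have h2 := congrArg ENNReal.toReal h1
    rw [ENNReal.toReal_mul, ENNReal.toReal_mul, ENNReal.toReal_ofReal hp'.le,
      ENNReal.toReal_ofReal hp.le] at h2
    have h3 := weight_update_of_linked (p := p) (q := q) ξ hl
    refine mul_left_cancel₀ hp.ne' ?_
    simp only [Measure.real]
    linear_combination L.weight p q F ξ (Function.update η e true) * h2 -
      (φ (G ∩ agreeOn (Function.update η e true))).toReal * h3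
  · have hsub : ∀ b, G ∩ agreeOn (Function.update η e b) ⊆ (Bridged (e : L.Edge))ᶜ :=
      fun b ω h hc => hl ((hbr b ω h).1 hc)
    have h1 := (hφ.2 e _ hm).2
    rw [closeEdge_preimage_agreeOn hGF, closeEdge_preimage_agreeOn hGF,
      Set.inter_eq_left.2 (hsub _), Set.inter_eq_left.2 (hsub _)] at h1
    have h2 := congrArg ENNReal.toReal h1
    rw [ENNReal.toReal_mul, ENNReal.toReal_mul, ENNReal.toReal_ofReal hqp.le,
      ENNReal.toReal_ofReal hp.le] at h2
    have h3 := weight_update_of_not_linked (p := p) (q := q) ξ hl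
    refine mul_left_cancel₀ hp.ne' ?_
    simp only [Measure.real]
    linear_combination L.weight p q F ξ (Function.update η e true) * h2 -
      (φ (G ∩ agreeOn (Function.update η e true))).toReal * h3

/-- Any two configurations on a finite set differ by finitely many flips. This is applied to the
probability divided by the weight. -/
lemma eq_of_forall_update {ι α : Type*} [Finite ι] [DecidableEq ι] {f : (ι → Bool) → α}
    (h : ∀ η e, f (Function.update η e true) = f (Function.update η e false)) (η η' : ι → Bool) :
    f η = f η' := by
  have := Fintype.ofFinite ι
  have h' : ∀ η e b, f (Function.update η e b) = f η := by
    intro η e b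
    have : η = Function.update η e (η e) := by simp
    conv_rhs => rw [this]
    cases b <;> cases η e <;> simp [h]
  have key : ∀ T : Finset ι, f (T.piecewise η η') = f η' := by
    intro T
    induction T using Finset.induction_on with
    | empty => simp
    | insert e T _ ih => rw [Finset.piecewise_insert, h', ih]
  have := key Finset.univ
  rwa [Finset.piecewise_univ] at this

open Classical in
lemma sum_measure_agreeOn (φ : Measure L.Config) [IsFiniteMeasure φ] (F : Finset L.Edge)
    (G : Set L.Config) : ∑ η : F → Bool, φ.real (G ∩ agreeOn η) = φ.real G := by
  have h : ∀ η : F → Bool, (fun (ω : L.Config) (e : F) => ω e) ⁻¹' {η} = agreeOn η := fun η => by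
    ext ω
    simp only [Set.mem_preimage, Set.mem_singleton_iff, agreeOn, Set.mem_ofPred_eq, funext_iff]
  have := sum_measure_preimage_singleton (μ := φ.restrict G)
    (f := fun (ω : L.Config) (e : F) => ω e) Finset.univ
    fun η _ => by rw [h]; exact measurableSet_agreeOn η
  simp only [Finset.coe_univ, Set.preimage_univ, Measure.restrict_apply_univ, h] at this
  rw [Measure.real, ← this, ENNReal.toReal_sum (fun _ _ => measure_ne_top _ _)]
  refine Finset.sum_congr rfl fun η _ => ?_
  rw [Measure.restrict_apply (measurableSet_agreeOn η), Set.inter_comm, Measure.real]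

/-- The conditional law of the configuration in `F` given any event that is determined outside `F`
and determines the boundary condition. -/
lemma SingleEdge.measure_inter {φ : Measure L.Config} (hφ : SingleEdge p q φ) (hp : 0 < p)
    (hp1 : p < 1) (hq : 1 ≤ q) {F : Finset L.Edge} {ξ : L.BoundaryCondition F}
    {G : Set L.Config} (hG : MeasurableSet G) (hGF : IsExterior F G)
    (hξ : ∀ ω ∈ G, L.inducedBC F ω = ξ) (η : F → Bool) :
    φ.real (G ∩ agreeOn η) = L.finiteVolumeProb p q F ξ η * φ.real G := by
  classical
  have := hφ.1
  have hw := fun η => weight_pos ξ hp hp1 hq (F := F) η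
  have hc : ∀ η', φ.real (G ∩ agreeOn η') / L.weight p q F ξ η' =
      φ.real (G ∩ agreeOn η) / L.weight p q F ξ η := fun η' =>
    eq_of_forall_update (f := fun η => φ.real (G ∩ agreeOn η) / L.weight p q F ξ η)
      (fun η e => by
        rw [div_eq_div_iff (hw _).ne' (hw _).ne']
        exact hφ.measure_update hp hp1 hq hG hGF hξ η e) η' η
  have hZ := partitionFunction_pos hp hp1 hq F ξ
  have hsum : φ.real G = φ.real (G ∩ agreeOn η) / L.weight p q F ξ η *
      L.partitionFunction p q F ξ := by
    rw [← sum_measure_agreeOn φ F G, partitionFunction, Finset.mul_sum]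
    refine Finset.sum_congr rfl fun η' _ => ?_
    rw [← hc η', div_mul_cancel₀ _ (hw _).ne']
  rw [hsum, finiteVolumeProb]
  have := (hw η).ne'
  field_simp

lemma isExterior_inducedBC (F : Finset L.Edge) (ξ : L.BoundaryCondition F) :
    IsExterior F {ω | L.inducedBC F ω = ξ} := fun ω ω' h => by
  rw [Set.mem_ofPred_eq, Set.mem_ofPred_eq, inducedBC_congr h]

theorem SingleEdge.isInfiniteVolume {φ : Measure L.Config} (hφ : SingleEdge p q φ) (hp : 0 < p)
    (hp1 : p < 1) (hq : 1 ≤ q) : L.IsInfiniteVolume p q φ := by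
  have := hφ.1
  refine ⟨hφ.1, fun F ξ h0 η => ?_⟩
  have h1 := hφ.measure_inter hp hp1 hq (measurableSet_inducedBC F ξ) (isExterior_inducedBC F ξ)
    (fun _ h => h) η
  change ProbabilityTheory.cond φ _ (agreeOn η) = _
  have h2 : φ.real {ω | L.inducedBC F ω = ξ} ≠ 0 := (measureReal_ne_zero_iff).2 h0
  rw [← ENNReal.ofReal_toReal (measure_ne_top (ProbabilityTheory.cond φ _) _),
    ProbabilityTheory.cond_apply (measurableSet_inducedBC F ξ), ENNReal.toReal_mul,
    ENNReal.toReal_inv]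
  congr 1
  change (φ.real _)⁻¹ * φ.real _ = _
  rw [h1]
  field_simp

/-! ### Conditional probabilities given the exterior -/

open Classical in
/-- The configuration equal to `η` on `F` and to `ω` elsewhere. -/
noncomputable def glue {F : Finset L.Edge} (η : F → Bool) (ω : L.Config) : L.Config :=
  fun e => if h : e ∈ F then η ⟨e, h⟩ else ω e

lemma glue_of_mem {F : Finset L.Edge} (η : F → Bool) (ω : L.Config) (e : F) :
    glue η ω e = η e := by
  simp [glue]

lemma glue_of_notMem {F : Finset L.Edge} (η : F → Bool) (ω : L.Config) {e : L.Edge}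
    (h : e ∉ F) : glue η ω e = ω e := by
  simp [glue, h]

lemma glue_congr {F : Finset L.Edge} (η : F → Bool) {ω ω' : L.Config}
    (h : ∀ e ∉ F, ω e = ω' e) : glue η ω = glue η ω' := by
  funext e
  by_cases he : e ∈ F
  · simp [glue, he]
  · rw [glue_of_notMem η ω he, glue_of_notMem η ω' he, h e he]

lemma glue_eq_self {F : Finset L.Edge} {η : F → Bool} {ω : L.Config} (h : ω ∈ agreeOn η) :
    glue η ω = ω := by
  funext e
  by_cases he : e ∈ F
  · rw [glue_of_mem η ω ⟨e, he⟩, h ⟨e, he⟩]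
  · rw [glue_of_notMem η ω he]

lemma measurable_glue {F : Finset L.Edge} (η : F → Bool) :
    Measurable (glue η : L.Config → L.Config) := by
  refine measurable_pi_iff.2 fun e => ?_
  by_cases he : e ∈ F
  · simp only [glue_of_mem η _ ⟨e, he⟩]; exact measurable_const
  · simp only [glue_of_notMem η _ he]; exact measurable_pi_apply e

lemma glue_mono {F : Finset L.Edge} {η η' : F → Bool} (h : η ≤ η') (ω : L.Config) :
    glue η ω ≤ glue η' ω := by
  intro e
  by_cases he : e ∈ F
  · rw [glue_of_mem η ω ⟨e, he⟩, glue_of_mem η' ω ⟨e, he⟩]; exact h _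
  · rw [glue_of_notMem η ω he, glue_of_notMem η' ω he]

open Classical in
/-- The probability of `B` under the random-cluster measure on `F` with the boundary condition and
the exterior configuration given by `ω`. -/
noncomputable def condProb (p q : ℝ) (F : Finset L.Edge) (B : Set L.Config) (ω : L.Config) : ℝ :=
  ∑ η : F → Bool, L.finiteVolumeProb p q F (L.inducedBC F ω) η *
    (if glue η ω ∈ B then 1 else 0)

lemma condProb_congr {F : Finset L.Edge} (B : Set L.Config) {ω ω' : L.Config}
    (h : ∀ e ∉ F, ω e = ω' e) : condProb p q F B ω = condProb p q F B ω' := by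
  refine Finset.sum_congr rfl fun η _ => ?_
  rw [inducedBC_congr h, glue_congr η h]

lemma finiteVolumeProb_nonneg (hp : 0 < p) (hp1 : p < 1) (hq : 1 ≤ q) {F : Finset L.Edge}
    (ξ : L.BoundaryCondition F) (η : F → Bool) : 0 ≤ L.finiteVolumeProb p q F ξ η :=
  div_nonneg (weight_pos ξ hp hp1 hq η).le (partitionFunction_pos hp hp1 hq F ξ).le

lemma sum_finiteVolumeProb (hp : 0 < p) (hp1 : p < 1) (hq : 1 ≤ q) {F : Finset L.Edge}
    [Fintype (F → Bool)] (ξ : L.BoundaryCondition F) :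
    ∑ η : F → Bool, L.finiteVolumeProb p q F ξ η = 1 := by
  simp only [finiteVolumeProb, ← Finset.sum_div]
  convert div_self (partitionFunction_pos hp hp1 hq F ξ).ne'
  rw [partitionFunction]
  congr!

lemma condProb_nonneg (hp : 0 < p) (hp1 : p < 1) (hq : 1 ≤ q) (F : Finset L.Edge)
    (B : Set L.Config) (ω : L.Config) : 0 ≤ condProb p q F B ω :=
  Finset.sum_nonneg fun η _ => mul_nonneg (finiteVolumeProb_nonneg hp hp1 hq _ _)
    (by split_ifs <;> norm_num)

lemma condProb_le_one (hp : 0 < p) (hp1 : p < 1) (hq : 1 ≤ q) (F : Finset L.Edge)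
    (B : Set L.Config) (ω : L.Config) : condProb p q F B ω ≤ 1 := by
  classical
  rw [← sum_finiteVolumeProb hp hp1 hq (L.inducedBC F ω)]
  refine Finset.sum_le_sum fun η _ => mul_le_of_le_one_right
    (finiteVolumeProb_nonneg hp hp1 hq _ _) (by split_ifs <;> norm_num)

lemma measurable_condProb (F : Finset L.Edge) {B : Set L.Config} (hB : MeasurableSet B) :
    Measurable (condProb p q F B) := by
  classical
  refine Finset.measurable_sum _ fun η _ => Measurable.mul ?_ ?_
  · let _ : MeasurableSpace (L.BoundaryCondition F) := ⊤
    have h1 : Measurable fun ξ => L.finiteVolumeProb p q F ξ η := measurable_from_top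
    exact h1.comp (measurable_to_countable' fun ξ => measurableSet_inducedBC F ξ)
  · exact Measurable.ite (measurable_glue η hB) measurable_const measurable_const

/-- The random-cluster measures on finite subgraphs are positively associated. -/
lemma condProb_mul_le (hp : 0 < p) (hp1 : p < 1) (hq : 1 ≤ q) (F : Finset L.Edge)
    {A B : Set L.Config} (hA : IsUpperSet A) (hB : IsUpperSet B) (ω : L.Config) :
    condProb p q F A ω * condProb p q F B ω ≤ condProb p q F (A ∩ B) ω := by
  classical
  have hmono : ∀ {A : Set L.Config}, IsUpperSet A →
      Monotone fun η : F → Bool => if glue η ω ∈ A then (1 : ℝ) else 0 := by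
    intro A hA η η' h
    dsimp only
    split_ifs with h1 h2
    · exact le_rfl
    · exact absurd (hA (glue_mono h ω) h1) h2
    · norm_num
    · exact le_rfl
  have h := fkg (α := F → Bool) (μ := fun η => L.weight p q F (L.inducedBC F ω) η)
    (f := fun η => if glue η ω ∈ A then (1 : ℝ) else 0)
    (g := fun η => if glue η ω ∈ B then (1 : ℝ) else 0)
    (fun η => (weight_pos _ hp hp1 hq η).le) (fun η => by dsimp; split_ifs <;> norm_num)
    (fun η => by dsimp; split_ifs <;> norm_num) (hmono hA) (hmono hB)
    fun a b => weight_lattice _ hp hp1 hq a b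
  have hZ := partitionFunction_pos hp hp1 hq F (L.inducedBC F ω)
  have hc : ∀ B : Set L.Config, condProb p q F B ω = (∑ η : F → Bool,
      L.weight p q F (L.inducedBC F ω) η * (if glue η ω ∈ B then 1 else 0)) /
        L.partitionFunction p q F (L.inducedBC F ω) := fun B => by
    simp only [condProb, finiteVolumeProb, Finset.sum_div]
    exact Finset.sum_congr rfl fun η _ => by ring
  have hZ' : ∑ η : F → Bool, L.weight p q F (L.inducedBC F ω) η =
      L.partitionFunction p q F (L.inducedBC F ω) := by
    rw [partitionFunction]
  rw [hc, hc, hc, div_mul_div_comm, div_le_div_iff₀ (by positivity) hZ]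
  rw [hZ'] at h
  have h' : ∀ η : F → Bool, (if glue η ω ∈ A then (1 : ℝ) else 0) *
      (if glue η ω ∈ B then 1 else 0) = if glue η ω ∈ A ∩ B then 1 else 0 := fun η => by
    by_cases h1 : glue η ω ∈ A <;> by_cases h2 : glue η ω ∈ B <;> simp [h1, h2]
  simp only [h'] at h
  refine (mul_le_mul_of_nonneg_right h hZ.le).trans (le_of_eq ?_)
  rw [mul_comm (L.partitionFunction p q F _), mul_assoc]
  congr!

/-- `condProb` is a conditional probability. -/
lemma SingleEdge.integral_condProb {φ : Measure L.Config} (hφ : SingleEdge p q φ) (hp : 0 < p)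
    (hp1 : p < 1) (hq : 1 ≤ q) {F : Finset L.Edge} {B D : Set L.Config} (hB : MeasurableSet B)
    (hD : MeasurableSet D) (hDF : IsExterior F D) :
    ∫ ω in D, condProb p q F B ω ∂φ = φ.real (D ∩ B) := by
  classical
  have := hφ.1
  have := Fintype.ofFinite (L.BoundaryCondition F)
  have hm : ∀ (ξ : L.BoundaryCondition F) (η : F → Bool),
      MeasurableSet ({ω : L.Config | L.inducedBC F ω = ξ} ∩ glue η ⁻¹' B) := fun ξ η =>
    (measurableSet_inducedBC F ξ).inter (measurable_glue η hB)
  have h1 : ∀ ω, condProb p q F B ω = ∑ ξ : L.BoundaryCondition F, ∑ η : F → Bool,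
      L.finiteVolumeProb p q F ξ η *
        ({ω : L.Config | L.inducedBC F ω = ξ} ∩ glue η ⁻¹' B).indicator 1 ω := by
    intro ω
    rw [Finset.sum_eq_single (L.inducedBC F ω)]
    · refine Finset.sum_congr rfl fun η _ => ?_
      by_cases h : glue η ω ∈ B <;> simp [h]
    · intro ξ _ hξ
      refine Finset.sum_eq_zero fun η _ => ?_
      rw [Set.indicator_of_notMem (fun h => hξ h.1.symm), mul_zero]
    · simp
  have h2 : ∀ ξ : L.BoundaryCondition F, φ.real (D ∩ B ∩ {ω | L.inducedBC F ω = ξ}) =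
      ∑ η : F → Bool, L.finiteVolumeProb p q F ξ η *
        φ.real ({ω : L.Config | L.inducedBC F ω = ξ} ∩ glue η ⁻¹' B ∩ D) := by
    intro ξ
    rw [← sum_measure_agreeOn φ F]
    refine Finset.sum_congr rfl fun η _ => ?_
    rw [← hφ.measure_inter hp hp1 hq ((hm ξ η).inter hD)]
    · congr 1
      ext ω
      constructor
      · rintro ⟨⟨⟨h3, h4⟩, h5⟩, h6⟩
        exact ⟨⟨⟨h5, by rwa [Set.mem_preimage, glue_eq_self h6]⟩, h3⟩, h6⟩
      · rintro ⟨⟨⟨h5, h4⟩, h3⟩, h6⟩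
        exact ⟨⟨⟨h3, by rwa [Set.mem_preimage, glue_eq_self h6] at h4⟩, h5⟩, h6⟩
    · intro ω ω' h
      refine and_congr (and_congr (isExterior_inducedBC F ξ ω ω' h) ?_) (hDF ω ω' h)
      rw [Set.mem_preimage, Set.mem_preimage, glue_congr η h]
    · exact fun ω h => h.1.1
  have h3 : φ.real (D ∩ B) = ∑ ξ : L.BoundaryCondition F,
      φ.real (D ∩ B ∩ {ω | L.inducedBC F ω = ξ}) := by
    rw [Measure.real, measure_eq_sum_inducedBC φ F,
      ENNReal.toReal_sum fun _ _ => measure_ne_top _ _]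
    rfl
  have hint : ∀ (ξ : L.BoundaryCondition F) (η : F → Bool), Integrable
      (fun ω => L.finiteVolumeProb p q F ξ η *
        ({ω : L.Config | L.inducedBC F ω = ξ} ∩ glue η ⁻¹' B).indicator 1 ω)
      (φ.restrict D) := fun ξ η =>
    ((integrable_const (1 : ℝ)).indicator (hm ξ η)).const_mul _
  simp only [h1]
  rw [integral_finsetSum _ fun ξ _ => integrable_finsetSum _ fun η _ => hint ξ η, h3]
  refine Finset.sum_congr rfl fun ξ _ => ?_
  rw [integral_finsetSum _ fun η _ => hint ξ η, h2]
  refine Finset.sum_congr rfl fun η _ => ?_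
  rw [integral_const_mul, integral_indicator_one (hm ξ η), measureReal_restrict_apply (hm ξ η)]

lemma integrable_condProb (hp : 0 < p) (hp1 : p < 1) (hq : 1 ≤ q) (μ : Measure L.Config)
    [IsFiniteMeasure μ] (F : Finset L.Edge) {B : Set L.Config} (hB : MeasurableSet B) :
    Integrable (condProb p q F B) μ :=
  Integrable.of_bound (measurable_condProb F hB).aestronglyMeasurable 1
    (Filter.Eventually.of_forall fun ω => by
      rw [Real.norm_of_nonneg (condProb_nonneg hp hp1 hq F B ω)]
      exact condProb_le_one hp hp1 hq F B ω)

/-- The map `r` below closes the edges of `F` and so retains only the exterior. After pushing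
forward by `r`, the two measures integrating `Z` coincide by `SingleEdge.integral_condProb`. -/
lemma SingleEdge.lintegral_condProb_mul {φ : Measure L.Config} (hφ : SingleEdge p q φ)
    (hp : 0 < p) (hp1 : p < 1) (hq : 1 ≤ q) {F : Finset L.Edge} {B : Set L.Config}
    (hB : MeasurableSet B) {Z : L.Config → ENNReal} (hZ : Measurable Z)
    (hZF : ∀ ω ω' : L.Config, (∀ e ∉ F, ω e = ω' e) → Z ω = Z ω') :
    ∫⁻ ω, ENNReal.ofReal (condProb p q F B ω) * Z ω ∂φ = ∫⁻ ω in B, Z ω ∂φ := by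
  have := hφ.1
  let r : L.Config → L.Config := glue (F := F) fun _ => false
  have hr : Measurable r := measurable_glue _
  have hZr : ∀ ω, Z ω = Z (r ω) := fun ω => hZF _ _ fun e he => (glue_of_notMem _ _ he).symm
  have hc : Measurable fun ω => ENNReal.ofReal (condProb p q F B ω) :=
    (measurable_condProb F hB).ennreal_ofReal
  have heq : (φ.withDensity fun ω => ENNReal.ofReal (condProb p q F B ω)).map r =
      (φ.restrict B).map r := by
    ext G hG
    rw [Measure.map_apply hr hG, Measure.map_apply hr hG, withDensity_apply _ (hr hG),
      Measure.restrict_apply (hr hG),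
      ← ofReal_integral_eq_lintegral_ofReal (integrable_condProb hp hp1 hq _ F hB)
        (Filter.Eventually.of_forall fun ω => condProb_nonneg hp hp1 hq F B ω),
      hφ.integral_condProb hp hp1 hq hB (hr hG), ofReal_measureReal]
    intro ω ω' h
    rw [Set.mem_preimage, Set.mem_preimage]
    exact iff_of_eq (congrArg (· ∈ G) (glue_congr _ h))
  calc _ = ∫⁻ ω, Z ω ∂(φ.withDensity fun ω => ENNReal.ofReal (condProb p q F B ω)) :=
        (lintegral_withDensity_eq_lintegral_mul _ hc hZ).symm
    _ = ∫⁻ ω, Z (r ω) ∂(φ.withDensity fun ω => ENNReal.ofReal (condProb p q F B ω)) :=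
        lintegral_congr hZr
    _ = ∫⁻ ω, Z (r ω) ∂(φ.restrict B) := by
        rw [← lintegral_map hZ hr, heq, lintegral_map hZ hr]
    _ = _ := lintegral_congr fun ω => (hZr ω).symm

/-- Random-cluster measures can be weighted by functions that do not depend on any single edge. -/
lemma SingleEdge.withDensity {φ : Measure L.Config} (hφ : SingleEdge p q φ)
    {Y : L.Config → ENNReal} (hY : Measurable Y) (hYe : ∀ e ω, Y (closeEdge e ω) = Y ω)
    (hY1 : ∫⁻ ω, Y ω ∂φ = 1) : SingleEdge p q (φ.withDensity Y) := by
  have key : ∀ (e : L.Edge) (a b : ENNReal) (A B : Set L.Config), MeasurableSet A →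
      MeasurableSet B → (∀ G, MeasurableSet G →
        a * φ (closeEdge e ⁻¹' G ∩ A) = b * φ (closeEdge e ⁻¹' G ∩ B)) →
      ∀ G, MeasurableSet G → a * (φ.withDensity Y) (closeEdge e ⁻¹' G ∩ A) =
        b * (φ.withDensity Y) (closeEdge e ⁻¹' G ∩ B) := by
    intro e a b A B hA hB h G hG
    have hm := measurable_closeEdge e (L := L)
    have heq : a • (φ.restrict A).map (closeEdge e) = b • (φ.restrict B).map (closeEdge e) := by
      ext G hG
      simp only [Measure.smul_apply, smul_eq_mul, Measure.map_apply hm hG,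
        Measure.restrict_apply (hm hG)]
      exact h G hG
    -- As `Y` is unchanged by `closeEdge e`, it can be integrated after the push-forward, where the
    -- single-edge relation is an equality of measures.
    have hval : ∀ (a : ENNReal) (A : Set L.Config), MeasurableSet A →
        a * (φ.withDensity Y) (closeEdge e ⁻¹' G ∩ A) =
          ∫⁻ ω in G, Y ω ∂(a • (φ.restrict A).map (closeEdge e)) := by
      intro a A hA
      rw [withDensity_apply _ ((hm hG).inter hA), Measure.restrict_smul, lintegral_smul_measure,
        setLIntegral_map hG hY hm, Measure.restrict_restrict (hm hG), smul_eq_mul]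
      simp only [hYe]
    rw [hval a A hA, hval b B hB, heq]
  refine ⟨⟨by rw [withDensity_apply _ MeasurableSet.univ, Measure.restrict_univ, hY1]⟩,
    fun e G hG => ⟨?_, ?_⟩⟩
  · rw [Set.inter_assoc, Set.inter_assoc]
    refine key e _ _ _ _ ((measurableSet_eq e _).inter (measurableSet_bridged e))
      ((measurableSet_eq e _).inter (measurableSet_bridged e)) (fun G hG => ?_) G hG
    rw [← Set.inter_assoc, ← Set.inter_assoc]
    exact (hφ.2 e G hG).1
  · rw [Set.inter_assoc, Set.inter_assoc]
    refine key e _ _ _ _ ((measurableSet_eq e _).inter (measurableSet_bridged e).compl)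
      ((measurableSet_eq e _).inter (measurableSet_bridged e).compl) (fun G hG => ?_) G hG
    rw [← Set.inter_assoc, ← Set.inter_assoc]
    exact (hφ.2 e G hG).2

end PlanarLattice

/-! ### Tail limits and positive association -/

namespace PlanarLattice

open MeasureTheory Filter Topology

variable {L : PlanarLattice} {p q : ℝ}

lemma exists_exhaustion (L : PlanarLattice) : ∃ F : ℕ → Finset L.Edge, Monotone F ∧
    ∀ e, ∃ n, e ∈ F n := by
  classical
  obtain ⟨f, hf⟩ := Countable.exists_injective_nat L.Edge
  have hfin : ∀ n, (f ⁻¹' (Set.Iio n)).Finite := fun n =>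
    (Set.finite_Iio n).preimage hf.injOn
  refine ⟨fun n => (hfin n).toFinset, fun m n hmn e he => ?_, fun e => ⟨f e + 1, ?_⟩⟩
  · simp only [Set.Finite.mem_toFinset, Set.mem_preimage, Set.mem_Iio] at he ⊢
    omega
  · simp

lemma memLp_condProb (hp : 0 < p) (hp1 : p < 1) (hq : 1 ≤ q) (μ : Measure L.Config)
    [IsFiniteMeasure μ] (F : Finset L.Edge) {B : Set L.Config} (hB : MeasurableSet B) :
    MemLp (condProb p q F B) 2 μ :=
  MemLp.of_bound (measurable_condProb F hB).aestronglyMeasurable 1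
    (Filter.Eventually.of_forall fun ω => by
      rw [Real.norm_of_nonneg (condProb_nonneg hp hp1 hq F B ω)]
      exact condProb_le_one hp hp1 hq F B ω)

/-- The right side does not involve `F`, so the inner product equals the squared norm for `F'`:
conditional probabilities given smaller and smaller exteriors form a reversed martingale. -/
lemma SingleEdge.integral_condProb_mul {φ : Measure L.Config} (hφ : SingleEdge p q φ)
    (hp : 0 < p) (hp1 : p < 1) (hq : 1 ≤ q) {F F' : Finset L.Edge} (hF : F ⊆ F')
    {B : Set L.Config} (hB : MeasurableSet B) :
    ∫ ω, condProb p q F B ω * condProb p q F' B ω ∂φ = ∫ ω in B, condProb p q F' B ω ∂φ := by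
  have := hφ.1
  have h := hφ.lintegral_condProb_mul hp hp1 hq hB (F := F)
    (Z := fun ω => ENNReal.ofReal (condProb p q F' B ω))
    (measurable_condProb F' hB).ennreal_ofReal
    fun ω ω' h => by rw [condProb_congr B fun e he => h e fun h' => he (hF h')]
  rw [integral_eq_lintegral_of_nonneg_ae, integral_eq_lintegral_of_nonneg_ae, ← h]
  · congr 1
    exact lintegral_congr fun ω => ENNReal.ofReal_mul (condProb_nonneg hp hp1 hq F B ω)
  · exact Eventually.of_forall fun ω => condProb_nonneg hp hp1 hq F' B ω
  · exact (measurable_condProb F' hB).aestronglyMeasurable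
  · exact Eventually.of_forall fun ω =>
      mul_nonneg (condProb_nonneg hp hp1 hq F B ω) (condProb_nonneg hp hp1 hq F' B ω)
  · exact ((measurable_condProb F hB).mul (measurable_condProb F' hB)).aestronglyMeasurable

/-- By orthogonality the squared distances are differences of squared norms, which decrease and
converge. -/
lemma cauchySeq_of_inner {E : Type*} [NormedAddCommGroup E] [InnerProductSpace ℝ E] {y : ℕ → E}
    (h : ∀ n m, n ≤ m → inner ℝ (y n) (y m) = ‖y m‖ ^ 2) : CauchySeq y := by
  have hdist : ∀ n m, n ≤ m → dist (y m) (y n) ^ 2 = ‖y n‖ ^ 2 - ‖y m‖ ^ 2 := by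
    intro n m hnm
    rw [dist_comm, dist_eq_norm, norm_sub_sq_real, h n m hnm]
    ring
  have hanti : Antitone fun n => ‖y n‖ ^ 2 := fun n m hnm => by
    have := hdist n m hnm
    have := sq_nonneg (dist (y m) (y n))
    dsimp only
    linarith
  have hc : CauchySeq fun n => ‖y n‖ ^ 2 :=
    (tendsto_atTop_ciInf hanti ⟨0, by rintro _ ⟨n, rfl⟩; positivity⟩).cauchySeq
  rw [Metric.cauchySeq_iff'] at hc ⊢
  intro ε hε
  obtain ⟨N, hN⟩ := hc (ε ^ 2) (by positivity)
  refine ⟨N, fun n hn => ?_⟩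
  have h1 := hN n hn
  rw [dist_comm, Real.dist_eq] at h1
  refine lt_of_pow_lt_pow_left₀ 2 hε.le ?_
  rw [hdist N n hn]
  exact (le_abs_self _).trans_lt h1

/-- Conditional probabilities given the configuration outside growing finite sets converge, along a
subsequence, to a function that does not depend on any single edge. -/
lemma SingleEdge.exists_tail_limit {φ : Measure L.Config} (hφ : SingleEdge p q φ)
    (hp : 0 < p) (hp1 : p < 1) (hq : 1 ≤ q) {B : Set L.Config} (hB : MeasurableSet B) :
    ∃ (F : ℕ → Finset L.Edge) (Y : L.Config → ENNReal), Measurable Y ∧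
      (∀ e ω, Y (closeEdge e ω) = Y ω) ∧
      ∀ᵐ ω ∂φ, Tendsto (fun k => ENNReal.ofReal (condProb p q (F k) B ω)) atTop (𝓝 (Y ω)) := by
  have := hφ.1
  obtain ⟨F, hF, hF'⟩ := exists_exhaustion L
  let y : ℕ → Lp ℝ 2 φ := fun n => (memLp_condProb hp hp1 hq φ (F n) hB).toLp _
  have hy : ∀ n, y n =ᵐ[φ] condProb p q (F n) B := fun n => MemLp.coeFn_toLp _
  have hinner : ∀ n m, inner ℝ (y n) (y m) =
      ∫ ω, condProb p q (F n) B ω * condProb p q (F m) B ω ∂φ := by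
    intro n m
    rw [L2.inner_def]
    refine integral_congr_ae ?_
    filter_upwards [hy n, hy m] with ω h1 h2
    rw [h1, h2]
    simp [mul_comm]
  have hc : CauchySeq y := cauchySeq_of_inner fun n m hnm => by
    rw [← real_inner_self_eq_norm_sq, hinner, hinner,
      hφ.integral_condProb_mul hp hp1 hq (hF hnm) hB,
      hφ.integral_condProb_mul hp hp1 hq (Finset.Subset.refl _) hB]
  obtain ⟨g, hg⟩ := cauchySeq_tendsto_of_complete hc
  obtain ⟨ns, hns, hae⟩ := (tendstoInMeasure_of_tendsto_Lp hg).exists_seq_tendsto_ae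
  -- Taking the upper limit makes `Y` invariant under `closeEdge e` everywhere and not only almost
  -- surely: as soon as `e` lies in the finite set, the conditional probability ignores it.
  refine ⟨fun k => F (ns k), fun ω => limsup (fun k =>
    ENNReal.ofReal (condProb p q (F (ns k)) B ω)) atTop, ?_, ?_, ?_⟩
  · exact Measurable.limsup fun k => (measurable_condProb _ hB).ennreal_ofReal
  · intro e ω
    obtain ⟨n, hn⟩ := hF' e
    refine limsup_congr ?_
    filter_upwards [eventually_ge_atTop n] with k hk
    rw [condProb_congr (ω := closeEdge e ω) (ω' := ω) B fun e' he' => closeEdge_of_ne (fun h => he' ?_) ω]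
    rw [h]
    exact hF (hk.trans (hns.id_le k)) hn
  · filter_upwards [hae, ae_all_iff.2 hy] with ω h1 h2
    simp only [h2] at h1
    have h3 := (ENNReal.continuous_ofReal.tendsto _).comp h1
    have h4 : limsup (fun k => ENNReal.ofReal (condProb p q (F (ns k)) B ω)) atTop =
        ENNReal.ofReal (g ω) := h3.limsup_eq
    rw [h4]
    exact h3

/-- Positive association of the unique infinite-volume measure. -/
theorem SingleEdge.mul_le_measure_inter {φ : Measure L.Config} (hφ : SingleEdge p q φ)
    (huniq : ∀ ψ : Measure L.Config, SingleEdge p q ψ → ψ = φ)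
    (hp : 0 < p) (hp1 : p < 1) (hq : 1 ≤ q) {A B : Set L.Config} (hA : MeasurableSet A)
    (hB : MeasurableSet B) (hA' : IsUpperSet A) (hB' : IsUpperSet B) :
    φ A * φ B ≤ φ (A ∩ B) := by
  have := hφ.1
  by_cases h0 : φ B = 0
  · simp [h0]
  obtain ⟨F, Y, hY, hYe, hlim⟩ := hφ.exists_tail_limit hp hp1 hq hB
  have hle : ∀ k ω, ENNReal.ofReal (condProb p q (F k) B ω) ≤ 1 := fun k ω => by
    rw [ENNReal.ofReal_le_one]
    exact condProb_le_one hp hp1 hq _ _ _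
  have hlim' : ∀ D : Set L.Config, Tendsto
      (fun k => ∫⁻ ω in D, ENNReal.ofReal (condProb p q (F k) B ω) ∂φ) atTop
      (𝓝 (∫⁻ ω in D, Y ω ∂φ)) := fun D =>
    tendsto_lintegral_of_dominated_convergence (fun _ => 1)
      (fun k => (measurable_condProb _ hB).ennreal_ofReal)
      (fun k => Eventually.of_forall (hle k)) (by simp) (ae_restrict_of_ae hlim)
  have hint : ∀ (k : ℕ) (B : Set L.Config), MeasurableSet B →
      ∫⁻ ω, ENNReal.ofReal (condProb p q (F k) B ω) ∂φ = φ B := fun k B hB => by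
    have := hφ.lintegral_condProb_mul hp hp1 hq hB (F := F k) (Z := fun _ => 1) measurable_const
      fun _ _ _ => rfl
    simpa using this
  have hYint : ∫⁻ ω, Y ω ∂φ = φ B := by
    have h1 := hlim' Set.univ
    simp only [Measure.restrict_univ, hint _ B hB] at h1
    exact tendsto_nhds_unique h1 tendsto_const_nhds
  -- The normalized reweighting is again a random-cluster measure, hence equal to `φ`; so the
  -- integral of `Y` over `A` is `φ A * φ B`.
  have hψ := huniq _ (hφ.withDensity (Y := fun ω => (φ B)⁻¹ * Y ω) (hY.const_mul _)
    (fun e ω => by rw [hYe]) (by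
      rw [lintegral_const_mul _ hY, hYint, ENNReal.inv_mul_cancel h0 (measure_ne_top _ _)]))
  have hYA : ∫⁻ ω in A, Y ω ∂φ = φ A * φ B := by
    have h1 := congrArg (fun μ : Measure L.Config => μ A) hψ
    simp only [withDensity_apply _ hA, lintegral_const_mul _ hY] at h1
    rw [← h1, mul_comm, ← mul_assoc, ENNReal.mul_inv_cancel h0 (measure_ne_top _ _), one_mul]
  rw [← hYA]
  -- For each finite set, the integral over `A` is that of the product of the conditional
  -- probabilities of `A` and `B`, which the finite-volume FKG inequality bounds by the conditional
  -- probability of `A ∩ B`.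
  refine le_of_tendsto' (hlim' A) fun k => ?_
  rw [← hφ.lintegral_condProb_mul hp hp1 hq hA (F := F k)
    (measurable_condProb _ hB).ennreal_ofReal
    fun ω ω' h => by rw [condProb_congr B h], ← hint k _ (hA.inter hB)]
  refine lintegral_mono fun ω => ?_
  rw [← ENNReal.ofReal_mul (condProb_nonneg hp hp1 hq _ _ _)]
  exact ENNReal.ofReal_le_ofReal (condProb_mul_le hp hp1 hq _ hA' hB' ω)

end PlanarLattice

namespace PlanarLattice

open MeasureTheory

variable {L : PlanarLattice} {p q : ℝ}

/-! ### Symmetries -/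

variable (L) in
/-- The affine symmetries of the graph. -/
def symmetryGroup : Subgroup (Plane ≃ᵃ[ℝ] Plane) where
  carrier := {τ | ∀ x y, L.graph.Adj (τ x) (τ y) ↔ L.graph.Adj x y}
  mul_mem' := fun {a b} ha hb x y => (ha (b x) (b y)).trans (hb x y)
  one_mem' := fun x y => Iff.rfl
  inv_mem' := fun {a} ha x y => by
    rw [← ha]
    change L.graph.Adj (a (a.symm x)) (a (a.symm y)) ↔ _
    rw [a.apply_symm_apply, a.apply_symm_apply]

/-- The translation by an integer vector. -/
noncomputable def shift (a b : ℤ) : Plane ≃ᵃ[ℝ] Plane :=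
  AffineEquiv.constVAdd ℝ Plane ((a : ℝ), (b : ℝ))

@[simp] lemma shift_apply (a b : ℤ) (z : Plane) : shift a b z = (z.1 + a, z.2 + b) := by
  simp [shift, add_comm, Prod.ext_iff]

/-- The reflection in the vertical axis. -/
noncomputable def mirror : Plane ≃ᵃ[ℝ] Plane :=
  ((LinearEquiv.neg ℝ (M := ℝ)).prodCongr (LinearEquiv.refl ℝ ℝ)).toAffineEquiv

@[simp] lemma mirror_apply (z : Plane) : mirror z = (-z.1, z.2) := rfl

/-- The reflection in the diagonal. -/
noncomputable def diagonal : Plane ≃ᵃ[ℝ] Plane := (LinearEquiv.prodComm ℝ ℝ ℝ).toAffineEquiv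

lemma shift_mem_symmetryGroup (a b : ℤ) : shift a b ∈ L.symmetryGroup := by
  have hr : shift 1 0 ∈ L.symmetryGroup := fun x y => by
    simpa using L.translation_right.2 x y
  have hu : shift 0 1 ∈ L.symmetryGroup := fun x y => by
    simpa using L.translation_up.2 x y
  have key : ∀ (v : Plane) (n : ℤ), (AffineEquiv.constVAdd ℝ Plane v) ^ n =
      AffineEquiv.constVAdd ℝ Plane (n • v) := fun v n =>
    (AffineEquiv.constVAdd_zsmul ℝ Plane n v).symm
  have : shift a b = shift 1 0 ^ a * shift 0 1 ^ b := by
    unfold shift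
    rw [key, key]
    ext z <;> simp [AffineEquiv.mul_def]
  rw [this]
  exact mul_mem (zpow_mem hr _) (zpow_mem hu _)

lemma mirror_mem_symmetryGroup : mirror ∈ L.symmetryGroup := fun x y => L.reflection.2 x y

/-- The diagonal reflection is the quarter turn followed by the reflection in the vertical axis. -/
lemma diagonal_mem_symmetryGroup : diagonal ∈ L.symmetryGroup := fun x y => by
  have h1 := L.reflection.2 (-x.2, x.1) (-y.2, y.1)
  have h2 := L.rotation.2 x y
  simp only [neg_neg] at h1 h2
  exact h1.trans h2

/-- The symmetries as automorphisms of the graph. -/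
def symmetryIso {τ : Plane ≃ᵃ[ℝ] Plane} (hτ : τ ∈ L.symmetryGroup) : L.graph ≃g L.graph :=
  ⟨τ.toEquiv, fun {x y} => hτ x y⟩

/-- The action of the symmetries on configurations. -/
def pull {τ : Plane ≃ᵃ[ℝ] Plane} (hτ : τ ∈ L.symmetryGroup) (ω : L.Config) : L.Config :=
  fun e => ω ((symmetryIso hτ).mapEdgeSet e)

lemma measurable_pull {τ : Plane ≃ᵃ[ℝ] Plane} (hτ : τ ∈ L.symmetryGroup) :
    Measurable (pull hτ) :=
  measurable_pi_iff.2 fun _ => measurable_pi_apply _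

lemma openSet_pull {τ : Plane ≃ᵃ[ℝ] Plane} (hτ : τ ∈ L.symmetryGroup) (ω : L.Config) :
    L.openSet (pull hτ ω) = τ ⁻¹' L.openSet ω := by
  have hseg : ∀ x y z, τ z ∈ segment ℝ (τ x) (τ y) ↔ z ∈ segment ℝ x y := fun x y z => by
    have := image_segment ℝ τ.toAffineMap x y
    change _ = segment ℝ (τ x) (τ y) at this
    rw [← this]
    exact τ.injective.mem_set_image
  ext z
  constructor
  · rintro ⟨x, y, h, h1, h2⟩
    exact ⟨τ x, τ y, (hτ x y).2 h, h1, (hseg x y z).2 h2⟩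
  · rintro ⟨x, y, h, h1, h2⟩
    obtain ⟨x, rfl⟩ := τ.surjective x
    obtain ⟨y, rfl⟩ := τ.surjective y
    exact ⟨x, y, (hτ x y).1 h, h1, (hseg x y z).1 h2⟩

lemma closeEdge_pull {τ : Plane ≃ᵃ[ℝ] Plane} (hτ : τ ∈ L.symmetryGroup) (e : L.Edge)
    (ω : L.Config) :
    closeEdge e (pull hτ ω) = pull hτ (closeEdge ((symmetryIso hτ).mapEdgeSet e) ω) := by
  funext e'
  by_cases h : e' = e
  · subst h
    rw [closeEdge_self, pull, closeEdge_self]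
  · rw [closeEdge_of_ne h, pull, pull, closeEdge_of_ne]
    exact fun h' => h ((symmetryIso hτ).mapEdgeSet.injective h')

lemma pull_mem_bridged {τ : Plane ≃ᵃ[ℝ] Plane} (hτ : τ ∈ L.symmetryGroup) (e : L.Edge)
    (ω : L.Config) :
    pull hτ ω ∈ Bridged e ↔ ω ∈ Bridged ((symmetryIso hτ).mapEdgeSet e) := by
  let σ : L.openGraph {e} (pull hτ ω) ≃g
      L.openGraph {(symmetryIso hτ).mapEdgeSet e} ω := ⟨τ.toEquiv, fun {x y} => by
    rw [openGraph_adj, openGraph_adj]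
    constructor
    · rintro ⟨h, h1, h2⟩
      refine ⟨(hτ x y).1 h, fun hc => h1 ?_, h2⟩
      rw [Set.mem_singleton_iff] at hc ⊢
      rw [← hc]; rfl
    · rintro ⟨h, h1, h2⟩
      refine ⟨(hτ x y).2 h, fun hc => h1 ?_, h2⟩
      rw [Set.mem_singleton_iff] at hc ⊢
      exact (symmetryIso hτ).mapEdgeSet.injective hc⟩
  obtain ⟨⟨x, y⟩, hxy⟩ := Quot.exists_rep (e : Sym2 Plane)
  have he' : (((symmetryIso hτ).mapEdgeSet e : L.Edge) : Sym2 Plane) = s(τ x, τ y) := by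
    change Sym2.map τ (e : Sym2 Plane) = _
    rw [← hxy]; rfl
  rw [mem_bridged_iff hxy.symm, mem_bridged_iff he']
  exact σ.reachable_iff.symm

lemma SingleEdge.map_pull {φ : Measure L.Config} (hφ : SingleEdge p q φ)
    {τ : Plane ≃ᵃ[ℝ] Plane} (hτ : τ ∈ L.symmetryGroup) : SingleEdge p q (φ.map (pull hτ)) := by
  have := hφ.1
  have hm := measurable_pull hτ (L := L)
  refine ⟨Measure.isProbabilityMeasure_map hm.aemeasurable, fun e G hG => ?_⟩
  have key : ∀ (b : Bool) (S S' : Set L.Config), MeasurableSet S → pull hτ ⁻¹' S = S' →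
      φ.map (pull hτ) (closeEdge e ⁻¹' G ∩ {ω | ω e = b} ∩ S) =
        φ (closeEdge ((symmetryIso hτ).mapEdgeSet e) ⁻¹' (pull hτ ⁻¹' G) ∩
          {ω | ω ((symmetryIso hτ).mapEdgeSet e) = b} ∩ S') := by
    rintro b S _ hS rfl
    rw [Measure.map_apply hm (((measurable_closeEdge e hG).inter (measurableSet_eq e b)).inter hS)]
    congr 1
    ext ω
    simp only [Set.mem_preimage, Set.mem_inter_iff, closeEdge_pull]
    rfl
  have hb : pull hτ ⁻¹' Bridged e = Bridged ((symmetryIso hτ).mapEdgeSet e) := by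
    ext ω; exact pull_mem_bridged hτ e ω
  have hb' : pull hτ ⁻¹' (Bridged e)ᶜ = (Bridged ((symmetryIso hτ).mapEdgeSet e))ᶜ := by
    rw [Set.preimage_compl, hb]
  rw [key _ _ _ (measurableSet_bridged e) hb, key _ _ _ (measurableSet_bridged e) hb,
    key _ _ _ (measurableSet_bridged e).compl hb', key _ _ _ (measurableSet_bridged e).compl hb']
  exact hφ.2 _ _ (hm hG)

/-! ### Local finiteness and measurability -/

/-- Every edge can be translated so that one end lies in the unit square, which contains finitely
many vertices, each of finite degree. -/
lemma exists_edge_length_bound (L : PlanarLattice) :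
    ∃ R : ℝ, ∀ x y, L.graph.Adj x y → dist x y ≤ R := by
  have hfin : (L.V ∩ (Set.Icc 0 1 ×ˢ Set.Icc 0 1 : Set Plane)).Finite :=
    L.finite_of_bounded _ ((Metric.isBounded_Icc _ _).prod (Metric.isBounded_Icc _ _))
  have hfin' : (⋃ x ∈ L.V ∩ (Set.Icc 0 1 ×ˢ Set.Icc 0 1 : Set Plane),
      (fun y => dist x y) '' L.graph.neighborSet x).Finite :=
    hfin.biUnion fun x _ => (L.finite_neighbors x).image _
  obtain ⟨R, hR⟩ := hfin'.bddAbove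
  refine ⟨R, fun x y hxy => ?_⟩
  have hs := shift_mem_symmetryGroup (L := L) (-⌊x.1⌋) (-⌊x.2⌋)
  have hadj := (hs x y).2 hxy
  have h1 : dist (shift (-⌊x.1⌋) (-⌊x.2⌋) x) (shift (-⌊x.1⌋) (-⌊x.2⌋) y) = dist x y := by
    simp [Prod.dist_eq]
  rw [← h1]
  refine hR (Set.mem_biUnion (x := shift (-⌊x.1⌋) (-⌊x.2⌋) x) ⟨L.mem_of_adj _ _ hadj, ?_⟩
    ⟨_, hadj, rfl⟩)
  simp only [shift_apply, Int.cast_neg, Set.mem_prod, Set.mem_Icc]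
  have := Int.floor_le x.1
  have := Int.lt_floor_add_one x.1
  have := Int.floor_le x.2
  have := Int.lt_floor_add_one x.2
  refine ⟨⟨?_, ?_⟩, ⟨?_, ?_⟩⟩ <;> linarith

lemma finite_edges_of_bounded (L : PlanarLattice) {K : Set Plane} (hK : Bornology.IsBounded K) :
    {e : L.Edge | ∃ x y, (e : Sym2 Plane) = s(x, y) ∧ (segment ℝ x y ∩ K).Nonempty}.Finite := by
  obtain ⟨R, hR⟩ := L.exists_edge_length_bound
  obtain ⟨r, hr⟩ := hK.subset_closedBall 0
  have hfin : (⋃ x ∈ L.V ∩ Metric.closedBall (0 : Plane) (r + R),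
      (fun y => s(x, y)) '' L.graph.neighborSet x).Finite :=
    (L.finite_of_bounded _ Metric.isBounded_closedBall).biUnion
      fun x _ => (L.finite_neighbors x).image _
  refine (hfin.preimage (f := (Subtype.val : L.Edge → Sym2 Plane))
    Subtype.val_injective.injOn).subset ?_
  rintro ⟨e, he⟩ ⟨x, y, rfl, z, hz, hzK⟩
  refine Set.mem_biUnion (x := x) ⟨L.mem_of_adj _ _ he, ?_⟩ ⟨y, he, rfl⟩
  have h1 : dist x z ≤ dist x y := by
    have := dist_add_dist_of_mem_segment hz
    have := dist_nonneg (x := z) (y := y)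
    linarith
  have h2 := hr hzK
  rw [Metric.mem_closedBall] at h2 ⊢
  have := hR x y he
  linarith [dist_triangle x z 0]

/-- Increasing properties of a subset of the plane that have bounded witnesses. -/
structure IsFinitary (P : Set Plane → Prop) : Prop where
  mono : ∀ A B, A ⊆ B → P A → P B
  bounded : ∀ A, P A → ∃ K ⊆ A, Bornology.IsBounded K ∧ P K

lemma openSet_mono {ω ω' : L.Config} (h : ω ≤ ω') : L.openSet ω ⊆ L.openSet ω' := by
  rintro z ⟨x, y, hxy, h1, h2⟩
  refine ⟨x, y, hxy, ?_, h2⟩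
  have := h ⟨s(x, y), hxy⟩
  rw [h1] at this
  exact top_le_iff.1 this

lemma IsFinitary.isUpperSet {P : Set Plane → Prop} (hP : IsFinitary P) :
    IsUpperSet {ω : L.Config | P (L.openSet ω)} :=
  fun _ _ h hω => hP.mono _ _ (openSet_mono h) hω

lemma IsFinitary.measurableSet {P : Set Plane → Prop} (hP : IsFinitary P) :
    MeasurableSet {ω : L.Config | P (L.openSet ω)} := by
  classical
  -- A bounded witness meets only finitely many edges, so the event is a countable union over finite
  -- sets of edges whose openness alone guarantees `P`.
  have : {ω : L.Config | P (L.openSet ω)} = ⋃ T : {T : Finset L.Edge //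
      P (L.openSet fun e => decide (e ∈ T))}, ⋂ e ∈ T.1, {ω | ω e = true} := by
    ext ω
    simp only [Set.mem_iUnion, Set.mem_iInter, Set.mem_ofPred_eq]
    constructor
    · intro h
      obtain ⟨K, hK, hb, hPK⟩ := hP.bounded _ h
      have hfin := L.finite_edges_of_bounded hb
      refine ⟨⟨hfin.toFinset.filter fun e => ω e = true, ?_⟩, fun e he => ?_⟩
      · refine hP.mono _ _ (fun z hz => ?_) hPK
        obtain ⟨x, y, hxy, h1, h2⟩ := hK hz
        refine ⟨x, y, hxy, ?_, h2⟩
        simp only [decide_eq_true_eq, Finset.mem_filter, Set.Finite.mem_toFinset]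
        exact ⟨⟨x, y, rfl, z, h2, hz⟩, h1⟩
      · exact (Finset.mem_filter.1 he).2
    · rintro ⟨⟨T, hT⟩, h⟩
      refine hP.mono _ _ (openSet_mono fun e => ?_) hT
      by_cases he : e ∈ T
      · rw [h e he]; exact le_top
      · simp [he]
  rw [this]
  exact MeasurableSet.iUnion fun T => Finset.measurableSet_biInter _ fun e _ =>
    measurableSet_eq e true

lemma IsFinitary.joinedIn (R : Set Plane) (x y : Plane) :
    IsFinitary fun A => JoinedIn (A ∩ R) x y where
  mono A B h hA := hA.mono (Set.inter_subset_inter_left _ h)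
  bounded A hA := by
    obtain ⟨γ, hγ⟩ := hA
    refine ⟨Set.range γ, ?_, (isCompact_range γ.continuous).isBounded, γ, fun t => ?_⟩
    · rintro _ ⟨t, rfl⟩; exact (hγ t).1
    · exact ⟨⟨t, rfl⟩, (hγ t).2⟩

lemma IsFinitary.exists {ι : Sort*} {P : ι → Set Plane → Prop} (h : ∀ i, IsFinitary (P i)) :
    IsFinitary fun A => ∃ i, P i A where
  mono A B hAB := fun ⟨i, hi⟩ => ⟨i, (h i).mono A B hAB hi⟩
  bounded A := fun ⟨i, hi⟩ => by
    obtain ⟨K, h1, h2, h3⟩ := (h i).bounded A hi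
    exact ⟨K, h1, h2, i, h3⟩

lemma IsFinitary.and {P Q : Set Plane → Prop} (hP : IsFinitary P) (hQ : IsFinitary Q) :
    IsFinitary fun A => P A ∧ Q A where
  mono A B h := And.imp (hP.mono A B h) (hQ.mono A B h)
  bounded A := fun ⟨h1, h2⟩ => by
    obtain ⟨K, k1, k2, k3⟩ := hP.bounded A h1
    obtain ⟨K', k1', k2', k3'⟩ := hQ.bounded A h2
    exact ⟨K ∪ K', Set.union_subset k1 k1', k2.union k2', hP.mono _ _ Set.subset_union_left k3,
      hQ.mono _ _ Set.subset_union_right k3'⟩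

lemma IsFinitary.const (r : Prop) : IsFinitary fun _ => r where
  mono _ _ _ h := h
  bounded _ h := ⟨∅, Set.empty_subset _, Bornology.isBounded_empty, h⟩

lemma IsFinitary.comap {P : Set Plane → Prop} (hP : IsFinitary P) {f : Plane → Plane}
    (hf : Continuous f) : IsFinitary fun A => P (f ⁻¹' A) where
  mono A B h := hP.mono _ _ (Set.preimage_mono h)
  bounded A h := by
    obtain ⟨K, k1, k2, k3⟩ := hP.bounded _ h
    refine ⟨f '' K, Set.image_subset_iff.2 k1, ?_, hP.mono _ _ (Set.subset_preimage_image f K) k3⟩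
    exact ((k2.isCompact_closure.image hf).isBounded).subset (Set.image_mono subset_closure)

/-! ### Properties of the open set under the infinite-volume measure -/

/-- The unique infinite-volume measure, through the relation for single edges. -/
structure IsUniqueSingleEdge (p q : ℝ) (φ : Measure L.Config) : Prop where
  pos : 0 < p
  lt_one : p < 1
  one_le : 1 ≤ q
  singleEdge : SingleEdge p q φ
  unique : ∀ ψ : Measure L.Config, SingleEdge p q ψ → ψ = φ

lemma IsUniqueSingleEdge.map_pull {φ : Measure L.Config} (hφ : IsUniqueSingleEdge p q φ)
    {τ : Plane ≃ᵃ[ℝ] Plane} (hτ : τ ∈ L.symmetryGroup) : φ.map (pull hτ) = φ :=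
  hφ.unique _ (hφ.singleEdge.map_pull hτ)

/-- The probability that the set of open points has the property `P`. -/
noncomputable def prob (φ : Measure L.Config) (P : Set Plane → Prop) : ℝ :=
  φ.real {ω | P (L.openSet ω)}

/-- `P` is arbitrary, possibly not measurable, so only an inequality for the outer measure is
available. Applied to the inverse symmetry, it gives equality in `IsUniqueSingleEdge.prob_preimage`.
-/
lemma IsUniqueSingleEdge.prob_preimage_le {φ : Measure L.Config} (hφ : IsUniqueSingleEdge p q φ)
    {τ : Plane ≃ᵃ[ℝ] Plane} (hτ : τ ∈ L.symmetryGroup) (P : Set Plane → Prop) :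
    prob φ (fun A => P (τ ⁻¹' A)) ≤ prob φ P := by
  have := hφ.singleEdge.1
  refine ENNReal.toReal_mono (measure_ne_top _ _) ?_
  have := Measure.le_map_apply (μ := φ) (measurable_pull hτ).aemeasurable
    {ω | P (L.openSet ω)}
  rw [hφ.map_pull hτ] at this
  simpa only [Set.preimage_ofPred_eq, openSet_pull] using this

lemma IsUniqueSingleEdge.prob_preimage {φ : Measure L.Config} (hφ : IsUniqueSingleEdge p q φ)
    {τ : Plane ≃ᵃ[ℝ] Plane} (hτ : τ ∈ L.symmetryGroup) (P : Set Plane → Prop) :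
    prob φ (fun A => P (τ ⁻¹' A)) = prob φ P := by
  refine le_antisymm (hφ.prob_preimage_le hτ P) ?_
  have h := hφ.prob_preimage_le (inv_mem hτ) fun A => P (τ ⁻¹' A)
  have h1 : ∀ A : Set Plane, τ ⁻¹' ((τ⁻¹ : Plane ≃ᵃ[ℝ] Plane) ⁻¹' A) = A := fun A => by
    ext z
    change τ.symm (τ z) ∈ A ↔ _
    rw [τ.symm_apply_apply]
  simpa only [h1] using h

lemma IsUniqueSingleEdge.prob_mul_le {φ : Measure L.Config} (hφ : IsUniqueSingleEdge p q φ)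
    {P Q : Set Plane → Prop} (hP : IsFinitary P) (hQ : IsFinitary Q) :
    prob φ P * prob φ Q ≤ prob φ fun A => P A ∧ Q A := by
  have := hφ.singleEdge.1
  have h := hφ.singleEdge.mul_le_measure_inter hφ.unique hφ.pos hφ.lt_one hφ.one_le
    hP.measurableSet hQ.measurableSet hP.isUpperSet hQ.isUpperSet
  have h' := ENNReal.toReal_mono (measure_ne_top _ _) h
  rwa [ENNReal.toReal_mul] at h'

end PlanarLattice

/-! ### Translations and reflections of exceptional crossings -/

section Symmetry

open Set

variable {A : Set Plane} {x y h b : ℝ}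

/-- The translation by `(a, c)`. -/
def moveBy (a c : ℝ) (v : Plane) : Plane := (v.1 + a, v.2 + c)

lemma continuous_moveBy (a c : ℝ) : Continuous (moveBy a c) := by
  unfold moveBy; fun_prop

/-- The reflection in the vertical axis. -/
def flipFst (v : Plane) : Plane := (-v.1, v.2)

lemma continuous_flipFst : Continuous flipFst := by unfold flipFst; fun_prop

lemma DriftRight.moved (a c : ℝ) (hA : DriftRight A (x + a) (y + c) h) :
    DriftRight (moveBy a c ⁻¹' A) x y h := by
  obtain ⟨p, q, h1, h2, h3, h4, h5, h6⟩ := hA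
  refine ⟨moveBy (-a) (-c) p, moveBy (-a) (-c) q, ?_, ?_, ?_, ?_, ?_,
    h6.mapsTo (continuous_moveBy _ _) ?_⟩
  on_goal 6 =>
    rintro v ⟨k1, k2, k3⟩
    refine ⟨by simpa [moveBy] using k1, ?_, ?_⟩
  all_goals simp only [moveBy]; linarith

/-- The reflection sends the starting interval `[x, x + 1]` to `[-x - 1, -x]`, whence the new
position. -/
lemma DriftRight.flipped (hA : DriftRight A x y h) :
    DriftLeft (flipFst ⁻¹' A) (-x - 1) y h := by
  obtain ⟨p, q, h1, h2, h3, h4, h5, h6⟩ := hA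
  refine ⟨flipFst p, flipFst q, ?_, ?_, ?_, ?_, ?_,
    h6.mapsTo continuous_flipFst ?_⟩
  on_goal 6 =>
    rintro v ⟨k1, k2, k3⟩
    refine ⟨by simpa [flipFst] using k1, ?_, ?_⟩
  all_goals simp only [flipFst]; linarith

lemma DriftLeft.flipped (hA : DriftLeft A x y h) :
    DriftRight (flipFst ⁻¹' A) (-x - 1) y h := by
  obtain ⟨p, q, h1, h2, h3, h4, h5, h6⟩ := hA
  refine ⟨flipFst p, flipFst q, ?_, ?_, ?_, ?_, ?_,
    h6.mapsTo continuous_flipFst ?_⟩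
  on_goal 6 =>
    rintro v ⟨k1, k2, k3⟩
    refine ⟨by simpa [flipFst] using k1, ?_, ?_⟩
  all_goals simp only [flipFst]; linarith

lemma LongCrossing.moved (a c : ℝ) (hA : LongCrossing A (x + a) (y + c) h) :
    LongCrossing (moveBy a c ⁻¹' A) x y h := by
  obtain ⟨p, q, h1, h2, h3⟩ := hA
  refine ⟨moveBy (-a) (-c) p, moveBy (-a) (-c) q, ?_, ?_,
    h3.mapsTo (continuous_moveBy _ _) ?_⟩
  on_goal 3 =>
    rintro v ⟨⟨k1, k2, k3⟩, k4, k5⟩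
    refine ⟨⟨by simpa [moveBy] using k1, ?_, ?_⟩, ?_, ?_⟩
  all_goals simp only [moveBy]; linarith

lemma StaysLeft.moved (a c : ℝ) (hA : StaysLeft A (x + a) (y + c) h b) :
    StaysLeft (moveBy a c ⁻¹' A) x y h b := by
  obtain ⟨p, q, h1, h2, h3, h4, h5⟩ := hA
  refine ⟨moveBy (-a) (-c) p, moveBy (-a) (-c) q, ?_, ?_, ?_, ?_,
    h5.mapsTo (continuous_moveBy _ _) ?_⟩
  on_goal 5 =>
    rintro v ⟨⟨k1, k2, k3⟩, k4⟩
    rw [mem_ofPred_eq] at k4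
    refine ⟨⟨by simpa [moveBy] using k1, ?_, ?_⟩, mem_ofPred_eq ▸ ?_⟩
  all_goals simp only [moveBy]; linarith

lemma StaysLeft.flipped (hA : StaysLeft A x y h b) :
    StaysRight (flipFst ⁻¹' A) (-x - 1) y h b := by
  obtain ⟨p, q, h1, h2, h3, h4, h5⟩ := hA
  refine ⟨flipFst p, flipFst q, ?_, ?_, ?_, ?_,
    h5.mapsTo continuous_flipFst ?_⟩
  on_goal 5 =>
    rintro v ⟨⟨k1, k2, k3⟩, k4⟩
    rw [mem_ofPred_eq] at k4
    refine ⟨⟨by simpa [flipFst] using k1, ?_, ?_⟩, mem_ofPred_eq ▸ ?_⟩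
  all_goals simp only [flipFst]; linarith

lemma StaysRight.flipped (hA : StaysRight A x y h b) :
    StaysLeft (flipFst ⁻¹' A) (-x - 1) y h b := by
  obtain ⟨p, q, h1, h2, h3, h4, h5⟩ := hA
  refine ⟨flipFst p, flipFst q, ?_, ?_, ?_, ?_,
    h5.mapsTo continuous_flipFst ?_⟩
  on_goal 5 =>
    rintro v ⟨⟨k1, k2, k3⟩, k4⟩
    rw [mem_ofPred_eq] at k4
    refine ⟨⟨by simpa [flipFst] using k1, ?_, ?_⟩, mem_ofPred_eq ▸ ?_⟩
  all_goals simp only [flipFst]; linarith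

lemma LeftThenRight.moved (a c : ℝ) (hA : LeftThenRight A (x + a) (y + c) h b) :
    LeftThenRight (moveBy a c ⁻¹' A) x y h b := by
  obtain ⟨p, w, q, h1, h2, h3, h4, h5, h6⟩ := hA
  refine ⟨moveBy (-a) (-c) p, moveBy (-a) (-c) w,
    moveBy (-a) (-c) q, ?_, ?_, ?_, ?_, h5.mapsTo (continuous_moveBy _ _) ?_,
    h6.mapsTo (continuous_moveBy _ _) ?_⟩
  on_goal 5 =>
    rintro v ⟨⟨k1, k2, k3⟩, k4⟩
    rw [mem_ofPred_eq] at k4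
    refine ⟨⟨by simpa [moveBy] using k1, ?_, ?_⟩, mem_ofPred_eq ▸ ?_⟩
  on_goal 8 =>
    rintro v ⟨⟨k1, k2, k3⟩, k4⟩
    rw [mem_ofPred_eq] at k4
    refine ⟨⟨by simpa [moveBy] using k1, ?_, ?_⟩, mem_ofPred_eq ▸ ?_⟩
  all_goals simp only [moveBy]; linarith

lemma LeftThenRight.flipped (hA : LeftThenRight A x y h b) :
    RightThenLeft (flipFst ⁻¹' A) (-x - 1) y h b := by
  obtain ⟨p, w, q, h1, h2, h3, h4, h5, h6⟩ := hA
  refine ⟨flipFst p, flipFst w, flipFst q, ?_, ?_, ?_, ?_,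
    h5.mapsTo continuous_flipFst ?_, h6.mapsTo continuous_flipFst ?_⟩
  on_goal 5 =>
    rintro v ⟨⟨k1, k2, k3⟩, k4⟩
    rw [mem_ofPred_eq] at k4
    refine ⟨⟨by simpa [flipFst] using k1, ?_, ?_⟩, mem_ofPred_eq ▸ ?_⟩
  on_goal 8 =>
    rintro v ⟨⟨k1, k2, k3⟩, k4⟩
    rw [mem_ofPred_eq] at k4
    refine ⟨⟨by simpa [flipFst] using k1, ?_, ?_⟩, mem_ofPred_eq ▸ ?_⟩
  all_goals simp only [flipFst]; linarith

lemma RightThenLeft.flipped (hA : RightThenLeft A x y h b) :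
    LeftThenRight (flipFst ⁻¹' A) (-x - 1) y h b := by
  obtain ⟨p, w, q, h1, h2, h3, h4, h5, h6⟩ := hA
  refine ⟨flipFst p, flipFst w, flipFst q, ?_, ?_, ?_, ?_,
    h5.mapsTo continuous_flipFst ?_, h6.mapsTo continuous_flipFst ?_⟩
  on_goal 5 =>
    rintro v ⟨⟨k1, k2, k3⟩, k4⟩
    rw [mem_ofPred_eq] at k4
    refine ⟨⟨by simpa [flipFst] using k1, ?_, ?_⟩, mem_ofPred_eq ▸ ?_⟩
  on_goal 8 =>
    rintro v ⟨⟨k1, k2, k3⟩, k4⟩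
    rw [mem_ofPred_eq] at k4
    refine ⟨⟨by simpa [flipFst] using k1, ?_, ?_⟩, mem_ofPred_eq ▸ ?_⟩
  all_goals simp only [flipFst]; linarith

end Symmetry

/-! ### Probabilities of exceptional crossings -/

section ExceptionalProbability

open Set

open PlanarLattice (IsFinitary)

lemma IsFinitary.joinedIn_slab (y h : ℝ) (p q : Plane) :
    IsFinitary fun A => JoinedIn (slab A y h) p q := IsFinitary.joinedIn _ p q

lemma IsFinitary.joinedIn_slab_inter (y h : ℝ) (R : Set Plane) (p q : Plane) :
    IsFinitary fun A => JoinedIn (slab A y h ∩ R) p q := by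
  simp only [slab, inter_assoc]
  exact IsFinitary.joinedIn _ p q

lemma isFinitary_driftRight (x y h : ℝ) : IsFinitary fun A => DriftRight A x y h :=
  .exists fun _ => .exists fun _ => .and (.const _) <| .and (.const _) <| .and (.const _) <|
    .and (.const _) <| .and (.const _) <| IsFinitary.joinedIn_slab _ _ _ _

lemma isFinitary_driftLeft (x y h : ℝ) : IsFinitary fun A => DriftLeft A x y h :=
  .exists fun _ => .exists fun _ => .and (.const _) <| .and (.const _) <| .and (.const _) <|
    .and (.const _) <| .and (.const _) <| IsFinitary.joinedIn_slab _ _ _ _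

lemma isFinitary_longCrossing (x y h : ℝ) : IsFinitary fun A => LongCrossing A x y h :=
  .exists fun _ => .exists fun _ => .and (.const _) <| .and (.const _) <|
    IsFinitary.joinedIn_slab_inter _ _ _ _ _

lemma isFinitary_staysLeft (x y h b : ℝ) : IsFinitary fun A => StaysLeft A x y h b :=
  .exists fun _ => .exists fun _ => .and (.const _) <| .and (.const _) <| .and (.const _) <|
    .and (.const _) <| IsFinitary.joinedIn_slab_inter _ _ _ _ _

lemma isFinitary_staysRight (x y h b : ℝ) : IsFinitary fun A => StaysRight A x y h b :=
  .exists fun _ => .exists fun _ => .and (.const _) <| .and (.const _) <| .and (.const _) <|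
    .and (.const _) <| IsFinitary.joinedIn_slab_inter _ _ _ _ _

lemma isFinitary_leftThenRight (x y h b : ℝ) : IsFinitary fun A => LeftThenRight A x y h b :=
  .exists fun _ => .exists fun _ => .exists fun _ => .and (.const _) <| .and (.const _) <|
    .and (.const _) <| .and (.const _) <| .and (IsFinitary.joinedIn_slab_inter _ _ _ _ _)
    (IsFinitary.joinedIn_slab_inter _ _ _ _ _)

lemma isFinitary_rightThenLeft (x y h b : ℝ) : IsFinitary fun A => RightThenLeft A x y h b :=
  .exists fun _ => .exists fun _ => .exists fun _ => .and (.const _) <| .and (.const _) <|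
    .and (.const _) <| .and (.const _) <| .and (IsFinitary.joinedIn_slab_inter _ _ _ _ _)
    (IsFinitary.joinedIn_slab_inter _ _ _ _ _)

/-- There is a long horizontal curve in the strip of height `N`. -/
def HasLongCurve (N : ℕ) (A : Set Plane) : Prop :=
  ∃ p q : Plane, p.1 ≤ 0 ∧ 2 * N + 2 ≤ q.1 ∧ JoinedIn (slab A 0 N) p q

/-- The probabilities of the properties of a random subset of the plane whose law is positively
associated and has the symmetries of the square lattice. -/
structure IsLatticeProb (pr : (Set Plane → Prop) → ℝ) : Prop where
  nonneg : ∀ P, 0 ≤ pr P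
  true_eq : pr (fun _ => True) = 1
  false_eq : pr (fun _ => False) = 0
  mono : ∀ P Q : Set Plane → Prop, (∀ A, P A → Q A) → pr P ≤ pr Q
  or_le : ∀ P Q, pr (fun A => P A ∨ Q A) ≤ pr P + pr Q
  mul_le : ∀ P Q, IsFinitary P → IsFinitary Q → pr P * pr Q ≤ pr fun A => P A ∧ Q A
  move : ∀ (a c : ℤ) (P : Set Plane → Prop), pr (fun A => P (moveBy a c ⁻¹' A)) = pr P
  flip : ∀ P : Set Plane → Prop, pr (fun A => P (flipFst ⁻¹' A)) = pr P
  swap : ∀ P : Set Plane → Prop, pr (fun A => P (Prod.swap ⁻¹' A)) = pr P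

namespace IsLatticeProb

variable {pr : (Set Plane → Prop) → ℝ}

lemma le_one (hpr : IsLatticeProb pr) (P : Set Plane → Prop) : pr P ≤ 1 :=
  hpr.true_eq ▸ hpr.mono _ _ fun _ _ => trivial

lemma le_of_moved (hpr : IsLatticeProb pr) {P : Set Plane → ℝ → ℝ → Prop}
    (hP : ∀ A x y a c, P A (x + a) (y + c) → P (moveBy a c ⁻¹' A) x y) (x y x' y' : ℤ) :
    pr (fun A => P A x y) ≤ pr fun A => P A x' y' := by
  rw [← hpr.move (x - x') (y - y') fun A => P A x' y']
  refine hpr.mono _ _ fun A hA => hP _ _ _ _ _ ?_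
  push_cast
  simpa using hA

/-- Iterated positive association; the conjunction stays finitary, which the next step of the
induction needs. -/
lemma pow_le (hpr : IsLatticeProb pr) {P : ℕ → Set Plane → Prop} (hP : ∀ i, IsFinitary (P i))
    {d : ℝ} (hd : 0 ≤ d) (hdP : ∀ i, d ≤ pr (P i)) (n : ℕ) :
    IsFinitary (fun A => ∀ i < n, P i A) ∧ d ^ n ≤ pr fun A => ∀ i < n, P i A := by
  induction n with
  | zero => simp [hpr.true_eq, IsFinitary.const]
  | succ n ih =>
    have h1 : ∀ A, (∀ i < n + 1, P i A) ↔ (∀ i < n, P i A) ∧ P n A := fun A =>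
      Nat.forall_lt_succ_right
    simp only [h1]
    refine ⟨ih.1.and (hP n), le_trans ?_ (hpr.mul_le _ _ ih.1 (hP n))⟩
    rw [pow_succ]
    exact mul_le_mul ih.2 (hdP n) hd (hpr.nonneg _)

lemma exists_le_sum (hpr : IsLatticeProb pr) {ι : Type*} (s : Finset ι) (P : ι → Set Plane → Prop) :
    pr (fun A => ∃ i ∈ s, P i A) ≤ ∑ i ∈ s, pr (P i) := by
  classical
  induction s using Finset.induction_on with
  | empty => simp [hpr.false_eq]
  | insert i s hi ih =>
    rw [Finset.sum_insert hi]
    simp only [Finset.exists_mem_insert]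
    exact (hpr.or_le _ _).trans (by gcongr)

lemma driftRight_le_of_int (hpr : IsLatticeProb pr) (x y x' y' : ℤ) (h : ℝ) :
    pr (fun A => DriftRight A x y h) ≤ pr fun A => DriftRight A x' y' h :=
  hpr.le_of_moved (P := fun A x y => DriftRight A x y h) (fun _ _ _ a c => .moved a c) x y x' y'

lemma longCrossing_le_of_int (hpr : IsLatticeProb pr) (x y x' y' : ℤ) (h : ℝ) :
    pr (fun A => LongCrossing A x y h) ≤ pr fun A => LongCrossing A x' y' h :=
  hpr.le_of_moved (P := fun A x y => LongCrossing A x y h) (fun _ _ _ a c => .moved a c) x y x' y'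

lemma staysLeft_le_of_int (hpr : IsLatticeProb pr) (x y x' y' : ℤ) (h b : ℝ) :
    pr (fun A => StaysLeft A x y h b) ≤ pr fun A => StaysLeft A x' y' h b :=
  hpr.le_of_moved (P := fun A x y => StaysLeft A x y h b) (fun _ _ _ a c => .moved a c) x y x' y'

lemma leftThenRight_le_of_int (hpr : IsLatticeProb pr) (x y x' y' : ℤ) (h b : ℝ) :
    pr (fun A => LeftThenRight A x y h b) ≤ pr fun A => LeftThenRight A x' y' h b :=
  hpr.le_of_moved (P := fun A x y => LeftThenRight A x y h b) (fun _ _ _ a c => .moved a c)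
    x y x' y'

lemma driftRight_le_driftLeft (hpr : IsLatticeProb pr) (x y x' y' : ℤ) (h : ℝ) :
    pr (fun A => DriftRight A x y h) ≤ pr fun A => DriftLeft A x' y' h := by
  refine (hpr.driftRight_le_of_int x y (-x' - 1) y' _).trans ?_
  rw [← hpr.flip fun A => DriftLeft A x' y' h]
  refine hpr.mono _ _ fun A hA => ?_
  have := hA.flipped
  push_cast at this
  simpa using this

lemma driftLeft_le_driftRight (hpr : IsLatticeProb pr) (x y x' y' : ℤ) (h : ℝ) :
    pr (fun A => DriftLeft A x y h) ≤ pr fun A => DriftRight A x' y' h := by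
  refine le_trans ?_ (hpr.driftRight_le_of_int (-x - 1) y x' y' _)
  rw [← hpr.flip fun A => DriftRight A ((-x - 1 : ℤ) : ℝ) y h]
  refine hpr.mono _ _ fun A hA => ?_
  have := hA.flipped
  push_cast
  exact this

lemma staysLeft_le_staysRight (hpr : IsLatticeProb pr) (x y x' y' : ℤ) (h b : ℝ) :
    pr (fun A => StaysLeft A x y h b) ≤ pr fun A => StaysRight A x' y' h b := by
  refine (hpr.staysLeft_le_of_int x y (-x' - 1) y' _ _).trans ?_
  rw [← hpr.flip fun A => StaysRight A x' y' h b]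
  refine hpr.mono _ _ fun A hA => ?_
  have := hA.flipped
  push_cast at this
  simpa using this

lemma staysRight_le_staysLeft (hpr : IsLatticeProb pr) (x y x' y' : ℤ) (h b : ℝ) :
    pr (fun A => StaysRight A x y h b) ≤ pr fun A => StaysLeft A x' y' h b := by
  refine le_trans ?_ (hpr.staysLeft_le_of_int (-x - 1) y x' y' _ _)
  rw [← hpr.flip fun A => StaysLeft A ((-x - 1 : ℤ) : ℝ) y h b]
  refine hpr.mono _ _ fun A hA => ?_
  have := hA.flipped
  push_cast
  exact this

lemma leftThenRight_le_rightThenLeft (hpr : IsLatticeProb pr) (x y x' y' : ℤ) (h b : ℝ) :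
    pr (fun A => LeftThenRight A x y h b) ≤ pr fun A => RightThenLeft A x' y' h b := by
  refine (hpr.leftThenRight_le_of_int x y (-x' - 1) y' _ _).trans ?_
  rw [← hpr.flip fun A => RightThenLeft A x' y' h b]
  refine hpr.mono _ _ fun A hA => ?_
  have := hA.flipped
  push_cast at this
  simpa using this

lemma rightThenLeft_le_leftThenRight (hpr : IsLatticeProb pr) (x y x' y' : ℤ) (h b : ℝ) :
    pr (fun A => RightThenLeft A x y h b) ≤ pr fun A => LeftThenRight A x' y' h b := by
  refine le_trans ?_ (hpr.leftThenRight_le_of_int (-x - 1) y x' y' _ _)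
  rw [← hpr.flip fun A => LeftThenRight A ((-x - 1 : ℤ) : ℝ) y h b]
  refine hpr.mono _ _ fun A hA => ?_
  have := hA.flipped
  push_cast
  exact this

variable {N h : ℕ}

/-- Chaining `N + 2` right drifts, starting from `x = -1`, and `N + 1` left drifts covers the
required length. The exponent is enlarged to the one needed for long crossings. -/
lemma driftRight_pow_le (hpr : IsLatticeProb pr) (hN : h ≤ N) (x y : ℤ) :
    pr (fun A => DriftRight A x y h) ^ (4 * N + 5) ≤ pr (HasLongCurve N) := by
  set d := pr (fun A => DriftRight A x y h) with hd
  have hd0 : 0 ≤ d := hpr.nonneg _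
  have hR := hpr.pow_le (P := fun j A => DriftRight A ((-1 + 2 * j : ℤ) : ℝ) (0 : ℤ) h)
    (fun j => isFinitary_driftRight _ _ _) hd0
    (fun j => hpr.driftRight_le_of_int x y _ _ _)
    (N + 2)
  have hL := hpr.pow_le (P := fun j A => DriftLeft A ((-1 + 2 * j + 3 : ℤ) : ℝ) (0 : ℤ) h)
    (fun j => isFinitary_driftLeft _ _ _) hd0
    (fun j => hpr.driftRight_le_driftLeft x y _ _ _) (N + 1)
  calc d ^ (4 * N + 5) ≤ d ^ (N + 2 + (N + 1)) :=
        pow_le_pow_of_le_one hd0 (hpr.le_one _) (by omega)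
    _ = d ^ (N + 2) * d ^ (N + 1) := pow_add _ _ _
    _ ≤ _ := mul_le_mul hR.2 hL.2 (by positivity) (hpr.nonneg _)
    _ ≤ _ := hpr.mul_le _ _ hR.1 hL.1
    _ ≤ _ := by
      refine hpr.mono _ _ fun A ⟨h1, h2⟩ => ?_
      obtain ⟨p, q, hp, hq, hpq⟩ := exists_long_of_drift (A := A) (x := -1) (y := 0) (h := h)
        (M := N + 1) (fun j hj => by have := h1 j (by omega); push_cast at this; exact this)
        (fun j hj => by have := h2 j hj; push_cast at this; exact this)
      refine ⟨p, q, by linarith, by push_cast at hq; linarith, hpq.mono ?_⟩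
      rintro v ⟨k1, k2, k3⟩
      have : (h : ℝ) ≤ N := by exact_mod_cast hN
      exact ⟨k1, k2, by linarith⟩

/-- Chaining `2 * N + 3` horizontal and `2 * N + 2` vertical long crossings, each advancing by one
unit, covers the required length. -/
lemma longCrossing_pow_le (hpr : IsLatticeProb pr) (hN : h ≤ N) (x y : ℤ) :
    pr (fun A => LongCrossing A x y h) ^ (4 * N + 5) ≤ pr (HasLongCurve N) := by
  set d := pr (fun A => LongCrossing A x y h) with hd
  have hd0 : 0 ≤ d := hpr.nonneg _
  have hH := hpr.pow_le (P := fun j A => LongCrossing A ((j : ℤ) : ℝ) (0 : ℤ) h)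
    (fun j => isFinitary_longCrossing _ _ _) hd0
    (fun j => hpr.longCrossing_le_of_int x y _ _ _)
    (2 * N + 3)
  have hV := hpr.pow_le
    (P := fun j A => LongCrossing (Prod.swap ⁻¹' A) (0 : ℤ) ((j + 1 : ℤ) : ℝ) h)
    (fun j => (isFinitary_longCrossing _ _ _).comap continuous_swap) hd0
    (fun j => by
      rw [hpr.swap fun A => LongCrossing A (0 : ℤ) ((j + 1 : ℤ) : ℝ) h]
      exact hpr.longCrossing_le_of_int x y _ _ _)
    (2 * N + 2)
  calc d ^ (4 * N + 5) = d ^ (2 * N + 3) * d ^ (2 * N + 2) := by rw [← pow_add]; congr 1; omega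
    _ ≤ _ := mul_le_mul hH.2 hV.2 (by positivity) (hpr.nonneg _)
    _ ≤ _ := hpr.mul_le _ _ hH.1 hV.1
    _ ≤ _ := by
      refine hpr.mono _ _ fun A ⟨h1, h2⟩ => ?_
      obtain ⟨p, q, hp, hq, hpq⟩ := exists_long_of_longCrossing (A := A) (x := 0) (y := 0)
        (h := h) (M := 2 * N + 2)
        (fun j hj => by have := h1 j (by omega); push_cast at this; simpa using this)
        (fun j hj => by have := h2 j hj; push_cast at this; simpa using this) (Nat.cast_nonneg _)
      have h0 : (0 : ℝ) ≤ h := Nat.cast_nonneg _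
      refine ⟨p, q, hp.le, by push_cast at hq; linarith, hpq.mono ?_⟩
      rintro v ⟨k1, k2, k3⟩
      have : (h : ℝ) ≤ N := by exact_mod_cast hN
      exact ⟨k1, k2, by linarith⟩

/-- All exceptional crossings are unlikely when long horizontal curves are. -/
lemma exceptional_le (hpr : IsLatticeProb pr) {κ : ℝ} (hκ0 : 0 ≤ κ) (hκ1 : κ ≤ 1)
    (hκ : ∀ d : ℝ, 0 ≤ d → d ^ (4 * N + 5) ≤ pr (HasLongCurve N) → d ≤ κ ^ 4) (h20 : 20 ≤ h)
    (hN : h ≤ N) (x y : ℤ) : pr (fun A => Exceptional A x y h) ≤ 21 * κ := by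
  have hDR : ∀ x y : ℤ, pr (fun A => DriftRight A x y h) ≤ κ ^ 4 := fun x y =>
    hκ _ (hpr.nonneg _) (hpr.driftRight_pow_le hN x y)
  have hDL : ∀ x y : ℤ, pr (fun A => DriftLeft A x y h) ≤ κ ^ 4 := fun x y =>
    (hpr.driftLeft_le_driftRight x y x y h).trans (hDR x y)
  have hLC : ∀ (x y : ℤ) (k : ℕ), k ≤ N → pr (fun A => LongCrossing A x y k) ≤ κ ^ 4 :=
    fun x y k hk => hκ _ (hpr.nonneg _) (hpr.longCrossing_pow_le hk x y)
  have hb := two_mul_halfWidth (h := h) (by omega)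
  have hb1 : 2 * (halfWidth h : ℝ) + 3 ≤ h := by exact_mod_cast hb.1
  have hb2 : (3 : ℝ) ≤ halfWidth h := by
    have : (h : ℝ) ≤ 2 * halfWidth h + 4 := by exact_mod_cast hb.2
    have : (20 : ℝ) ≤ h := by exact_mod_cast h20
    linarith
  have hκ2 : κ ^ 2 ≤ κ := by nlinarith
  have hκ4 : κ ^ 4 ≤ κ ^ 2 := by nlinarith [sq_nonneg κ]
  -- By reflection and positive association, the square of this probability is bounded by that of
  -- the opposite pair of events, which forces one of three events of probability at most `κ ^ 4`.
  -- The same argument, fed with the present bound, gives `3 * κ` for the turning crossings.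
  have hSL : ∀ x y : ℤ, pr (fun A => StaysLeft A x y h (halfWidth h)) ≤ 2 * κ ^ 2 := by
    intro x y
    set s := pr (fun A => StaysLeft A x y h (halfWidth h)) with hs
    have hs0 : 0 ≤ s := hpr.nonneg _
    have h1 : s * s ≤ 3 * κ ^ 4 := calc
      s * s ≤ s * pr (fun A => StaysRight A ((x - 3 : ℤ) : ℝ) y h (halfWidth h)) :=
          mul_le_mul_of_nonneg_left (hpr.staysLeft_le_staysRight _ _ _ _ _ _) hs0
      _ ≤ _ := hpr.mul_le _ _ (isFinitary_staysLeft _ _ _ _) (isFinitary_staysRight _ _ _ _)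
      _ ≤ pr (fun A => DriftLeft A x y h ∨ DriftRight A ((x - 3 : ℤ) : ℝ) y h ∨
            LongCrossing (Prod.swap ⁻¹' A) y ((x - 2 - halfWidth h : ℤ) : ℝ) (h - 1 : ℕ)) := by
          refine hpr.mono _ _ fun A ⟨k1, k2⟩ => ?_
          push_cast [Nat.cast_sub (show 1 ≤ h by omega)] at k2 ⊢
          exact drift_or_long_of_stays hb1 k1 k2
      _ ≤ κ ^ 4 + (κ ^ 4 + κ ^ 4) := by
          refine (hpr.or_le _ _).trans (add_le_add (hDL _ _) ?_)
          refine (hpr.or_le _ _).trans (add_le_add (hDR _ _) ?_)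
          rw [hpr.swap fun A => LongCrossing A y ((x - 2 - halfWidth h : ℤ) : ℝ) (h - 1 : ℕ)]
          exact hLC _ _ _ (by omega)
      _ = 3 * κ ^ 4 := by ring
    refine le_of_sq_le_sq ?_ (by positivity)
    nlinarith [pow_nonneg hκ0 4]
  have hSR : ∀ x y : ℤ, pr (fun A => StaysRight A x y h (halfWidth h)) ≤ 2 * κ ^ 2 := fun x y =>
    (hpr.staysRight_le_staysLeft x y x y h _).trans (hSL x y)
  have hLR : ∀ x y : ℤ, pr (fun A => LeftThenRight A x y h (halfWidth h)) ≤ 3 * κ := by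
    intro x y
    set s := pr (fun A => LeftThenRight A x y h (halfWidth h)) with hs
    have hs0 : 0 ≤ s := hpr.nonneg _
    have h1 : s * s ≤ 2 * κ ^ 4 + 4 * κ ^ 2 := calc
      s * s ≤ s * pr (fun A => RightThenLeft A ((x + 3 : ℤ) : ℝ) y h (halfWidth h)) :=
          mul_le_mul_of_nonneg_left (hpr.leftThenRight_le_rightThenLeft _ _ _ _ _ _) hs0
      _ ≤ _ := hpr.mul_le _ _ (isFinitary_leftThenRight _ _ _ _)
          (isFinitary_rightThenLeft _ _ _ _)
      _ ≤ pr (fun A => DriftRight A x y h ∨ DriftLeft A ((x + 3 : ℤ) : ℝ) y h ∨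
            StaysLeft A x y h (halfWidth h) ∨
            StaysRight A ((x + 3 : ℤ) : ℝ) y h (halfWidth h)) := by
          refine hpr.mono _ _ fun A ⟨k1, k2⟩ => ?_
          push_cast at k2 ⊢
          exact drift_or_stays_of_turns hb2 k1 k2
      _ ≤ κ ^ 4 + (κ ^ 4 + (2 * κ ^ 2 + 2 * κ ^ 2)) := by
          refine (hpr.or_le _ _).trans (add_le_add (hDR _ _) ?_)
          refine (hpr.or_le _ _).trans (add_le_add (hDL _ _) ?_)
          exact (hpr.or_le _ _).trans (add_le_add (hSL _ _) (hSR _ _))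
      _ = 2 * κ ^ 4 + 4 * κ ^ 2 := by ring
    refine le_of_sq_le_sq ?_ (by positivity)
    nlinarith
  have hRL : ∀ x y : ℤ, pr (fun A => RightThenLeft A x y h (halfWidth h)) ≤ 3 * κ := fun x y =>
    (hpr.rightThenLeft_le_leftThenRight x y x y h _).trans (hLR x y)
  calc pr (fun A => Exceptional A x y h)
      ≤ κ ^ 4 + (κ ^ 4 + (κ ^ 4 + (2 * κ ^ 2 + (2 * κ ^ 2 + (3 * κ + 3 * κ))))) := by
        refine (hpr.or_le _ _).trans (add_le_add (hDR _ _) ?_)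
        refine (hpr.or_le _ _).trans (add_le_add (hDL _ _) ?_)
        refine (hpr.or_le _ _).trans (add_le_add (hLC _ _ _ hN) ?_)
        refine (hpr.or_le _ _).trans (add_le_add (hSL _ _) ?_)
        refine (hpr.or_le _ _).trans (add_le_add (hSR _ _) ?_)
        exact (hpr.or_le _ _).trans (add_le_add (hLR _ _) (hRL _ _))
    _ ≤ 21 * κ := by linarith

end IsLatticeProb

/-! ### Union bound over positions, heights and orientations -/

/-- The exceptional crossings in a bounded set are at bounded positions. -/
lemma Exceptional.mem_Icc {A : Set Plane} {x y : ℤ} {h N : ℕ} (hA : Exceptional A x y h)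
    (hN : h ≤ N) (hN' : 1 ≤ N)
    (hAN : ∀ v ∈ A, 0 ≤ v.1 ∧ v.1 ≤ 2 * N + 2 ∧ 0 ≤ v.2 ∧ v.2 ≤ 2 * N + 2) :
    x ∈ Finset.Icc (-N : ℤ) (2 * N + 2) ∧ y ∈ Finset.Icc (-N : ℤ) (2 * N + 2) := by
  have hN1 : (1 : ℝ) ≤ N := by exact_mod_cast hN'
  have hh : (h : ℝ) ≤ N := by exact_mod_cast hN
  have hh0 : (0 : ℝ) ≤ h := Nat.cast_nonneg _
  suffices hs : ∃ p ∈ A, (x : ℝ) ≤ p.1 ∧ p.1 ≤ x + 1 ∧ y ≤ p.2 ∧ p.2 ≤ y + h by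
    obtain ⟨p, hp, h1, h2, h3, h4⟩ := hs
    obtain ⟨k1, k2, k3, k4⟩ := hAN p hp
    simp only [Finset.mem_Icc]
    refine ⟨⟨?_, ?_⟩, ?_, ?_⟩ <;> rify <;> linarith
  rcases hA with ⟨p, q, h1, h2, h3, h4, h5, h6⟩ | ⟨p, q, h1, h2, h3, h4, h5, h6⟩ |
    ⟨p, q, h1, h2, h3⟩ | ⟨p, q, h1, h2, h3, h4, h5⟩ | ⟨p, q, h1, h2, h3, h4, h5⟩ |
    ⟨p, w, q, h1, h2, h3, h4, h5, h6⟩ | ⟨p, w, q, h1, h2, h3, h4, h5, h6⟩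
  · exact ⟨p, h6.source_mem.1, h1, h2, h3.ge, by linarith⟩
  · exact ⟨p, h6.source_mem.1, h1, h2, h3.ge, by linarith⟩
  · exact ⟨p, h3.source_mem.1.1, h1.ge, by linarith, h3.source_mem.1.2⟩
  · exact ⟨p, h5.source_mem.1.1, h1, h2, h3.ge, by linarith⟩
  · exact ⟨p, h5.source_mem.1.1, h1, h2, h3.ge, by linarith⟩
  · exact ⟨p, h5.source_mem.1.1, h1, h2, h3.ge, by linarith⟩
  · exact ⟨p, h5.source_mem.1.1, h1, h2, h3.ge, by linarith⟩

/-- `A` or its transpose contains an exceptional crossing at one of finitely many positions. -/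
def HasException (N : ℕ) (A : Set Plane) : Prop :=
  ∃ t ∈ Finset.Icc (-N : ℤ) (2 * N + 2) ×ˢ Finset.Icc (-N : ℤ) (2 * N + 2) ×ˢ Finset.Icc 20 N,
    Exceptional A t.1 t.2.1 t.2.2 ∨ Exceptional (Prod.swap ⁻¹' A) t.1 t.2.1 t.2.2

lemma regular_of_not_hasException {A B : Set Plane} {N : ℕ} (hN : 1 ≤ N) (hA : ¬ HasException N A)
    (hBA : B ⊆ A) (hB : ∀ v ∈ B, 0 ≤ v.1 ∧ v.1 ≤ 2 * N + 2 ∧ 0 ≤ v.2 ∧ v.2 ≤ 2 * N + 2) :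
    Regular B N ∧ Regular (Prod.swap ⁻¹' B) N := by
  constructor
  · intro x y h h1 h2 hex
    obtain ⟨hx, hy⟩ := hex.mem_Icc h2 hN hB
    exact hA ⟨(x, y, h), by simp only [Finset.mem_product]; exact ⟨hx, hy, by simp [h1, h2]⟩,
      Or.inl (hex.mono hBA)⟩
  · intro x y h h1 h2 hex
    obtain ⟨hx, hy⟩ := hex.mem_Icc h2 hN fun v hv => by
      have := hB _ hv
      exact ⟨this.2.2.1, this.2.2.2, this.1, this.2.1⟩
    exact hA ⟨(x, y, h), by simp only [Finset.mem_product]; exact ⟨hx, hy, by simp [h1, h2]⟩,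
      Or.inr (hex.mono (preimage_mono hBA))⟩

lemma IsLatticeProb.hasException_le {pr : (Set Plane → Prop) → ℝ} (hpr : IsLatticeProb pr) {N : ℕ}
    (hN : 3 ≤ N) {κ : ℝ} (hκ0 : 0 ≤ κ) (hκ1 : κ ≤ 1)
    (hκ : ∀ d : ℝ, 0 ≤ d → d ^ (4 * N + 5) ≤ pr (HasLongCurve N) → d ≤ κ ^ 4) :
    pr (HasException N) ≤ 672 * N ^ 3 * κ := by
  have hN' : (3 : ℝ) ≤ N := by exact_mod_cast hN
  calc pr (HasException N) ≤ _ := hpr.exists_le_sum _ _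
    _ ≤ ∑ t ∈ Finset.Icc (-N : ℤ) (2 * N + 2) ×ˢ Finset.Icc (-N : ℤ) (2 * N + 2) ×ˢ
          Finset.Icc 20 N, 42 * κ := by
        refine Finset.sum_le_sum fun t ht => ?_
        simp only [Finset.mem_product, Finset.mem_Icc] at ht
        have h1 := hpr.exceptional_le hκ0 hκ1 hκ ht.2.2.1 ht.2.2.2 t.1 t.2.1
        refine (hpr.or_le _ _).trans ?_
        rw [hpr.swap fun A => Exceptional A t.1 t.2.1 t.2.2]
        linarith
    _ = ((3 * N + 3) * ((3 * N + 3) * (N + 1 - 20 : ℕ))) * (42 * κ) := by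
        rw [Finset.sum_const, Finset.card_product, Finset.card_product, Int.card_Icc,
          Nat.card_Icc, nsmul_eq_mul]
        have : ((2 * N + 2 + 1 - -N : ℤ)).toNat = 3 * N + 3 := by omega
        rw [this]
        push_cast
        ring
    -- At most `16 * N ^ 3` positions and heights, and two orientations with probability at most `21
    -- * κ` each.
    _ ≤ ((4 * N) * ((4 * N) * N)) * (42 * κ) := by
        have h1 : (3 * N + 3 : ℝ) ≤ 4 * N := by linarith
        have h2 : ((N + 1 - 20 : ℕ) : ℝ) ≤ N := by
          have : N + 1 - 20 ≤ N := by omega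
          exact_mod_cast this
        gcongr
    _ = 672 * N ^ 3 * κ := by ring

end ExceptionalProbability

/-! ### Rescaling to the coarse lattice -/

section Rescaling

open Set PlanarLattice MeasureTheory

/-- The dilation by `u`. -/
def scaleBy (u : ℝ) (v : Plane) : Plane := (u * v.1, u * v.2)

lemma continuous_scaleBy (u : ℝ) : Continuous (scaleBy u) := by unfold scaleBy; fun_prop

/-- The scale `u` is an integer so that integer translations of the rescaled picture are symmetries
of the lattice. -/
lemma PlanarLattice.IsUniqueSingleEdge.isLatticeProb {L : PlanarLattice} {p q : ℝ}
    {φ : Measure L.Config} (hφ : IsUniqueSingleEdge p q φ) (u : ℕ) :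
    IsLatticeProb fun P => prob φ fun A => P (scaleBy u ⁻¹' A) := by
  have := hφ.singleEdge.1
  refine ⟨fun P => measureReal_nonneg, by simp [prob], by simp [prob], fun P Q h => ?_,
    fun P Q => ?_, fun P Q hP hQ => ?_, fun a c P => ?_, fun P => ?_, fun P => ?_⟩
  · exact measureReal_mono fun ω hω => h _ hω
  · exact measureReal_union_le _ _
  · exact hφ.prob_mul_le (hP.comap (continuous_scaleBy u)) (hQ.comap (continuous_scaleBy u))
  · refine Eq.trans (congrArg (prob φ) (funext fun A => congrArg P ?_))
      (hφ.prob_preimage (shift_mem_symmetryGroup (u * a) (u * c)) fun A => P (scaleBy u ⁻¹' A))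
    ext v
    simp [moveBy, scaleBy, mul_add]
  · refine Eq.trans (congrArg (prob φ) (funext fun A => congrArg P ?_))
      (hφ.prob_preimage mirror_mem_symmetryGroup fun A => P (scaleBy u ⁻¹' A))
    ext v
    simp [flipFst, scaleBy]
  · exact hφ.prob_preimage diagonal_mem_symmetryGroup fun A => P (scaleBy u ⁻¹' A)

variable {A : Set Plane} {n N I u : ℕ}

/-- Rounding `n / u` down to `N` keeps the curve within height `n`; the length `2 * N + 2` instead
of `2 * N` makes up for it horizontally. -/
lemma HasLongCurve.exists_horizontal (hu : 1 ≤ u) (hN : N = n / u)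
    (hA : HasLongCurve N (scaleBy u ⁻¹' A)) :
    ∃ x y : Plane, x.1 = 0 ∧ y.1 = 2 * n ∧
      JoinedIn (A ∩ Icc (0 : ℝ) (2 * n) ×ˢ Icc (0 : ℝ) n) x y := by
  have hu0 : (0 : ℝ) < u := by exact_mod_cast hu
  have h1 : (N : ℝ) * u ≤ n := by
    rw [hN]; exact_mod_cast Nat.div_mul_le_self n u
  have h2 : (n : ℝ) ≤ (N + 1) * u := by
    have : n < (n / u + 1) * u := by
      rw [mul_comm]; exact Nat.lt_mul_div_succ n hu
    rw [hN]; exact_mod_cast this.le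
  obtain ⟨p, q, hp, hq, hpq⟩ := hA
  have hpq' : JoinedIn (A ∩ {v | 0 ≤ v.2 ∧ v.2 ≤ n}) (scaleBy u p) (scaleBy u q) := by
    refine hpq.mapsTo (continuous_scaleBy u) ?_
    rintro v ⟨k1, k2, k3⟩
    refine ⟨k1, ?_, ?_⟩ <;> simp only [scaleBy]
    · positivity
    · nlinarith
  have hp' : (scaleBy u p).1 ≤ 0 := by simp only [scaleBy]; nlinarith
  have hq' : 2 * (n : ℝ) ≤ (scaleBy u q).1 := by simp only [scaleBy]; nlinarith
  obtain ⟨y, hy, hpy, -⟩ := hpq'.exists_first continuous_fst (c := 2 * (n : ℝ))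
    (by linarith [(Nat.cast_nonneg n : (0 : ℝ) ≤ n)]) hq'
  obtain ⟨x, hx, -, hxy⟩ := hpy.exists_last continuous_fst (c := 0) hp' (by rw [hy]; positivity)
  refine ⟨x, y, hx, hy, hxy.mono ?_⟩
  rintro v ⟨⟨⟨k1, k2, k3⟩, k4⟩, k5⟩
  exact ⟨k1, ⟨k5, k4⟩, k2, k3⟩

/-- Without exceptional crossings, a vertical crossing of a rectangle contains many separated
crossings of a shorter one. -/
lemma exists_separated_of_not_hasException (hu : 1 ≤ u) (hN : N = n / u) (hI : 1 ≤ I)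
    (hNI : 400 * I ≤ N) (hA : ¬ HasException N (scaleBy u ⁻¹' A))
    (hv : ∃ x y : Plane, x.2 = 0 ∧ y.2 = n ∧
      JoinedIn (A ∩ Icc (0 : ℝ) (2 * n) ×ˢ Icc (0 : ℝ) n) x y) :
    ∃ x y : Fin (2 ^ I) → Plane, (∀ i, (x i).2 = 0 ∧ (y i).2 = (n : ℝ) / 2 ∧
        JoinedIn (shift 0 (18 * I * u) ⁻¹' A ∩ Icc (0 : ℝ) (2 * n) ×ˢ Icc (0 : ℝ) ((n : ℝ) / 2))
          (x i) (y i)) ∧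
      ∀ i j, i ≠ j →
        ¬ JoinedIn (shift 0 (18 * I * u) ⁻¹' A ∩ Icc (0 : ℝ) (2 * n) ×ˢ Icc (0 : ℝ) ((n : ℝ) / 2))
          (x i) (x j) := by
  have hu0 : (0 : ℝ) < u := by exact_mod_cast hu
  have h1 : (N : ℝ) * u ≤ n := by
    rw [hN]; exact_mod_cast Nat.div_mul_le_self n u
  have h2 : (n : ℝ) ≤ (N + 1) * u := by
    have : n < (n / u + 1) * u := by
      rw [mul_comm]; exact Nat.lt_mul_div_succ n hu
    rw [hN]; exact_mod_cast this.le
  have hNI' : 400 * (I : ℝ) ≤ N := by exact_mod_cast hNI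
  have hI' : (1 : ℝ) ≤ I := by exact_mod_cast hI
  have hN1 : 1 ≤ N := by omega
  set B : Set Plane := scaleBy u ⁻¹' (A ∩ Icc (0 : ℝ) (2 * n) ×ˢ Icc (0 : ℝ) n) with hB
  have hBbd : ∀ v ∈ B, 0 ≤ v.1 ∧ v.1 ≤ 2 * N + 2 ∧ 0 ≤ v.2 ∧ v.2 ≤ 2 * N + 2 := by
    rintro v ⟨-, ⟨k1, k2⟩, k3, k4⟩
    simp only [scaleBy] at k1 k2 k3 k4
    refine ⟨nonneg_of_mul_nonneg_right k1 hu0, ?_, nonneg_of_mul_nonneg_right k3 hu0, ?_⟩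
    · refine le_of_mul_le_mul_left ?_ hu0
      linarith
    · refine le_of_mul_le_mul_left ?_ hu0
      nlinarith
  obtain ⟨hreg, hreg'⟩ := regular_of_not_hasException hN1 hA
    (fun v hv => hv.1 : B ⊆ scaleBy u ⁻¹' A) hBbd
  obtain ⟨x, y, hx, hy, hxy⟩ := hv
  have hxy' : JoinedIn B (scaleBy (u : ℝ)⁻¹ x) (scaleBy (u : ℝ)⁻¹ y) := by
    refine hxy.mapsTo (continuous_scaleBy _) fun v hv => ?_
    have : scaleBy u (scaleBy (u : ℝ)⁻¹ v) = v := by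
      simp [scaleBy, hu0.ne']
    rw [hB, mem_preimage, this]
    exact hv
  obtain ⟨z, hz, hxz, -⟩ := hxy'.exists_first continuous_snd (c := N)
    (by simp [scaleBy, hx])
    (by
      simp only [scaleBy, hy]
      rw [inv_mul_eq_div, le_div_iff₀ hu0]
      exact h1)
  have hsum : N - 36 * I + 36 * I = N := by omega
  have hh : ((N - 36 * I : ℕ) : ℝ) = N - 36 * I := by
    rw [Nat.cast_sub (by omega)]; push_cast; ring
  obtain ⟨ι, P, Q, hcard, hPQ, hsep⟩ := hreg.exists_separated_crossings hreg' (y := 0) I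
    (h := N - 36 * I) (by omega) (by omega) ⟨scaleBy (u : ℝ)⁻¹ x, z,
      by simp [scaleBy, hx], by rw [hsum]; simp [hz], by
      rw [hsum]
      refine hxz.mono ?_
      rintro v ⟨k1, k2⟩
      rw [mem_ofPred_eq] at k2
      have := (hBbd v k1).2.2.1
      exact ⟨k1, by simpa using this, by simpa using k2⟩⟩
  have hfin : Finite ι := Nat.finite_of_card_ne_zero (by rw [hcard]; positivity)
  let e : Fin (2 ^ I) ≃ ι := (Finite.equivFinOfCardEq hcard).symm
  rw [hh] at hPQ hsep
  push_cast at hPQ hsep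
  simp only [zero_add] at hPQ hsep
  -- The separated crossings start at the rescaled height `18 * I`; each is cut at the level `c`,
  -- which lies `n / 2` higher in the original scale. There is room for this because `400 * I ≤ N`.
  set c : ℝ := 18 * I + n / (2 * u) with hc
  have hcu : c * u = 18 * I * u + n / 2 := by
    rw [hc]; field_simp
  have hc1 : 18 * (I : ℝ) ≤ c := by
    have : (0 : ℝ) ≤ n / (2 * u) := by positivity
    linarith
  have hc2 : c ≤ 18 * I + (N - 36 * I) := by
    refine le_of_mul_le_mul_right ?_ hu0
    rw [hcu]
    nlinarith
  have hcut : ∀ j, ∃ w : Plane, w.2 = c ∧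
      JoinedIn (slab B (18 * I) (N - 36 * I) ∩ {v | v.2 ≤ c}) (P j) w := fun j => by
    obtain ⟨k1, k2, k3⟩ := hPQ j
    obtain ⟨w, hw, hjw, -⟩ := k3.exists_first continuous_snd (c := c) (by rw [k1]; exact hc1)
      (by rw [k2]; exact hc2)
    exact ⟨w, hw, hjw⟩
  choose W hW hPW using hcut
  -- Back to the original scale, with the bottom moved to height `0`; this is why the conclusion
  -- concerns a shifted set.
  let f : Plane → Plane := fun v => (u * v.1, u * v.2 - 18 * I * u)
  have hf : Continuous f := by fun_prop
  let g : Plane → Plane := fun v => (v.1 / u, (v.2 + 18 * I * u) / u)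
  have hg : Continuous g := by fun_prop
  have hgf : ∀ v, g (f v) = v := fun v => by
    simp only [f, g]
    ext
    · simp [hu0.ne']
    · simp [hu0.ne']
  refine ⟨fun i => f (P (e i)), fun i => f (W (e i)), fun i => ⟨?_, ?_, ?_⟩, fun i j hij hc' => ?_⟩
  · simp only [f, (hPQ (e i)).1]; ring
  · simp only [f, hW]; linarith
  · refine (hPW (e i)).mapsTo hf ?_
    rintro v ⟨⟨⟨k1, ⟨k2, k3⟩, k4, k5⟩, k6, k7⟩, k8⟩
    rw [mem_ofPred_eq] at k8
    simp only [scaleBy] at k2 k3 k4 k5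
    refine ⟨?_, ⟨k2, k3⟩, ?_, ?_⟩
    · rw [mem_preimage, shift_apply]
      convert k1 using 1
      simp [f, scaleBy]
    · simp only [f]; nlinarith
    · simp only [f]; nlinarith
  · refine hsep (e i) (e j) (fun h => hij (e.injective h)) ?_
    rw [← hgf (P (e i)), ← hgf (P (e j))]
    refine hc'.mapsTo hg ?_
    rintro v ⟨k1, ⟨k2, k3⟩, k4, k5⟩
    rw [mem_preimage, shift_apply] at k1
    have hsc : scaleBy u (g v) = (v.1, v.2 + 18 * I * u) := by
      simp only [g, scaleBy]
      ext
      · simp only; field_simp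
      · simp only; field_simp
    have hIu : (0 : ℝ) ≤ 18 * I * u := by positivity
    refine ⟨?_, ?_, ?_⟩
    · rw [hB, mem_preimage, hsc]
      refine ⟨by simpa using k1, ⟨k2, k3⟩, by simp only; linarith, ?_⟩
      simp only
      nlinarith
    · simp only [g]
      rw [le_div_iff₀ hu0]; linarith
    · simp only [g]
      rw [div_le_iff₀ hu0]
      nlinarith [mul_le_mul_of_nonneg_right hc2 hu0.le]

end Rescaling

/-! ### Choice of the constants and conclusion -/

theorem lemma4p3 :
    ∃ c₀ c₁ : ℝ, 0 < c₀ ∧ 0 < c₁ ∧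
      ∀ (L : PlanarLattice) (q p : ℝ), 1 ≤ q → 0 < p → p < 1 →
      ∀ φ : MeasureTheory.Measure L.Config, L.IsInfiniteVolume p q φ →
        (∀ ψ : MeasureTheory.Measure L.Config, L.IsInfiniteVolume p q ψ → ψ = φ) →
      ∀ n I : ℕ, 1 ≤ I → (I : ℝ) ≤ (n : ℝ) / 400 →
        (I : ℝ) ^ 2 * φ.real (L.horizontalCrossing (2 * n) n) ^ (c₁ / (I : ℝ)) ≤
          c₀ * φ.real (L.verticalCrossing (2 * n) n) →
        1 / 2 * φ.real (L.verticalCrossing (2 * n) n) ≤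
          φ.real (L.separatedVerticalCrossings (2 * n) ((n : ℝ) / 2) (2 ^ I)) := by
  -- Since `N ≤ 800 * I`, the number `25640 = 8 * (4 * 800 + 5)` yields `κ ≤ t ^ 2` below; the first
  -- constant is small enough for `672 * 800 ^ 3 * c₀ ^ 2 ≤ 1 / 2`.
  refine ⟨1 / 10000000, 1 / 25640, by norm_num, by norm_num, ?_⟩
  intro L q p hq hp hp1 φ hφ huniq n I hI hIn hle
  have hφ' : PlanarLattice.IsUniqueSingleEdge p q φ :=
    ⟨hp, hp1, hq, hφ.singleEdge hp hp1 hq,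
      fun ψ hψ => huniq ψ (hψ.isInfiniteVolume hp hp1 hq)⟩
  have := hφ.1
  have hI0 : (1 : ℝ) ≤ I := by exact_mod_cast hI
  have hIn' : I * 400 ≤ n := by
    rw [le_div_iff₀ (by norm_num)] at hIn
    exact_mod_cast hIn
  obtain ⟨u, hu⟩ : ∃ u, u = n / (400 * I) := ⟨_, rfl⟩
  obtain ⟨N, hN⟩ : ∃ N, N = n / u := ⟨_, rfl⟩
  have hu1 : 1 ≤ u := by
    rw [hu, Nat.le_div_iff_mul_le (by omega)]; omega
  have hNI : 400 * I ≤ N := by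
    rw [hN, Nat.le_div_iff_mul_le hu1, hu, mul_comm]
    exact Nat.div_mul_le_self _ _
  have hNI' : N ≤ 800 * I := by
    have h1 : n < 400 * I * (u + 1) := by
      rw [hu]; exact Nat.lt_mul_div_succ n (by omega)
    refine (Nat.div_lt_of_lt_mul (m := n) (n := u) (k := 800 * I) ?_ |>.le.trans' hN.le)
    nlinarith
  have hNr : (N : ℝ) ≤ 800 * I := by exact_mod_cast hNI'
  set ph := φ.real (L.horizontalCrossing (2 * n) n) with hph
  set v := φ.real (L.verticalCrossing (2 * n) n) with hv
  have hph0 : 0 ≤ ph := MeasureTheory.measureReal_nonneg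
  have hph1 : ph ≤ 1 := MeasureTheory.measureReal_le_one
  have hv0 : 0 ≤ v := MeasureTheory.measureReal_nonneg
  have hv1 : v ≤ 1 := MeasureTheory.measureReal_le_one
  have hpr := hφ'.isLatticeProb u
  have hlong : PlanarLattice.prob φ (fun A => HasLongCurve N (scaleBy u ⁻¹' A)) ≤ ph :=
    MeasureTheory.measureReal_mono fun ω hω => HasLongCurve.exists_horizontal hu1 hN hω
  set κ : ℝ := ph ^ (((4 * (4 * N + 5) : ℕ) : ℝ)⁻¹) with hκ
  have hκ0 : 0 ≤ κ := Real.rpow_nonneg hph0 _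
  have hκ1 : κ ≤ 1 := Real.rpow_le_one hph0 hph1 (by positivity)
  have hκp : (κ ^ 4) ^ (4 * N + 5) = ph := by
    rw [← pow_mul]
    exact Real.rpow_inv_natCast_pow hph0 (by omega)
  have hexc := hpr.hasException_le (N := N) (by omega) hκ0 hκ1 fun d hd hdp => by
    rw [← pow_le_pow_iff_left₀ hd (by positivity) (show 4 * N + 5 ≠ 0 by omega), hκp]
    exact hdp.trans hlong
  set t : ℝ := ph ^ (1 / 25640 / (I : ℝ)) with ht
  have ht0 : 0 ≤ t := Real.rpow_nonneg hph0 _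
  have hκt : κ ≤ t ^ 2 := by
    rw [ht, ← Real.rpow_natCast, ← Real.rpow_mul hph0]
    refine Real.rpow_le_rpow_of_exponent_ge' hph0 hph1 (by positivity) ?_
    push_cast
    rw [div_div, one_div, inv_mul_eq_div, div_le_iff₀ (by positivity), inv_mul_eq_div,
      le_div_iff₀ (by positivity)]
    nlinarith
  -- The bound `t ^ 2` rather than `t` lets the hypothesis be squared, so that `I ^ 4` absorbs the
  -- `I ^ 3` of the union bound and `v ^ 2 ≤ v` is used.
  have hbad : 672 * (N : ℝ) ^ 3 * κ ≤ 1 / 2 * v := calc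
    672 * (N : ℝ) ^ 3 * κ ≤ 672 * (800 * I) ^ 3 * t ^ 2 := by gcongr
    _ = 672 * 800 ^ 3 * ((I : ℝ) ^ 3 * t ^ 2) := by ring
    _ ≤ 672 * 800 ^ 3 * ((I : ℝ) ^ 4 * t ^ 2) := by
      gcongr
      norm_num
    _ = 672 * 800 ^ 3 * ((I : ℝ) ^ 2 * t) ^ 2 := by ring
    _ ≤ 672 * 800 ^ 3 * (1 / 10000000 * v) ^ 2 := by gcongr
    _ = 672 * 800 ^ 3 * (1 / 10000000) ^ 2 * (v * v) := by ring
    _ ≤ 1 / 2 * v := by nlinarith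
  have hsplit : v ≤ PlanarLattice.prob φ (fun A => HasException N (scaleBy u ⁻¹' A)) +
      φ.real (L.separatedVerticalCrossings (2 * n) ((n : ℝ) / 2) (2 ^ I)) := by
    -- The crossings were found in the rectangle raised by `18 * I * u`. The event of separated
    -- crossings is not increasing, so the translation inequality for arbitrary properties is used.
    refine le_trans ?_ (add_le_add_right (hφ'.prob_preimage_le
      (PlanarLattice.shift_mem_symmetryGroup 0 (18 * I * u)) fun A =>
        ∃ x y : Fin (2 ^ I) → Plane, (∀ i, (x i).2 = 0 ∧ (y i).2 = (n : ℝ) / 2 ∧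
          JoinedIn (A ∩ Set.Icc (0 : ℝ) (2 * n) ×ˢ Set.Icc (0 : ℝ) ((n : ℝ) / 2)) (x i) (y i)) ∧
        ∀ i j, i ≠ j →
          ¬ JoinedIn (A ∩ Set.Icc (0 : ℝ) (2 * n) ×ˢ Set.Icc (0 : ℝ) ((n : ℝ) / 2))
            (x i) (x j)) _)
    refine (MeasureTheory.measureReal_mono fun ω hω => ?_).trans
      (MeasureTheory.measureReal_union_le _ _)
    by_cases hex : HasException N (scaleBy u ⁻¹' L.openSet ω)
    · exact Or.inl hex
    · exact Or.inr (exists_separated_of_not_hasException hu1 hN hI hNI hex hω)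
  linarith
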